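/- Let $n\ge 1$, $D=\{(x,y): x>0,\ y\in\mathbb R^{n-1}\}\subset\mathbb R^n$, let $F:\mathbb R\to\mathbb R$ and $h:D\to\mathbb R$, and let $u=u(x,y,t)$ be a classical solution of $$u_t-\Delta u=-F\Big(\frac1t\int_0^t u_x(0,y,s)\,ds\Big)\quad(x>0,\ y\in\mathbb R^{n-1},\ t>0),$$ $$u(0,y,t)=0\quad(y\in\mathbb R^{n-1},\ t>0),\qquad u(x,y,0)=h(x,y)\quad(x>0,\ y\in\mathbb R^{n-1}),$$ that is: $u$ is continuous on $\{x\ge0,\ t>0\}$ and $C^2$ in $(x,y)$ and $C^1$ in $t$ (with jointly continuous derivatives) on $\{x>0,\ t>0\}$; the one-sided derivative $V(y,t)=u_x(0,y,t)$ exists for $t>0$ and $V(y,\cdot)$ is integrable on $(0,t)$ for every $t>0$; the equation and the boundary condition hold; and $u(x,y,t)\to u(x,y,0)=h(x,y)$ as $t\to0^+$ for each $(x,y)\in D$. Put $f(y,t)=F\big(\frac1t\int_0^tV(y,s)\,ds\big)$, and assume that $u$ and $f$ grow more slowly than every Gaussian: for all $T,a>0$ there are a constant $A$ and a function $g\in L^1(0,T)$,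 bounded above on $[s,T]$ for every $s\in(0,T)$, such that for $0<t\le T$, $x>0$, $y\in\mathbb R^{n-1}$ $$|u(x,y,t)|\le A\,e^{a(x^2+|y|^2)},\qquad |f(y,t)|\le g(t)\,e^{a|y|^2}.$$ Let $\operatorname{erf}(\zeta)=\frac{2}{\sqrt\pi}\int_0^\zeta e^{-X^2}\,dX$ and let $$G_1(x,y,t;\xi,\eta,\tau)=\frac{e^{-|y-\eta|^2/4(t-\tau)}}{(2\sqrt{\pi(t-\tau)})^{n-1}}\cdot\frac{e^{-(x-\xi)^2/4(t-\tau)}-e^{-(x+\xi)^2/4(t-\tau)}}{2\sqrt{\pi(t-\tau)}}\qquad(t>\tau)$$ be the Green's function of the heat equation in $D$ with homogeneous Dirichlet condition. Then for all $x\ge0$, $y\in\mathbb R^{n-1}$, $t>0$ $$u(x,y,t)=u_0(x,y,t)-\int_0^t\frac{\operatorname{erf}\big(\frac{x}{2\sqrt{t-\tau}}\big)}{(2\sqrt{\pi(t-\tau)})^{n-1}}\left[\int_{\mathbb R^{n-1}}e^{-\frac{|y-\eta|^2}{4(t-\tau)}}F\Big(\frac1\tau\int_0^\tau V(\eta,s)\,ds\Big)d\eta\right]d\tau,$$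 where $u_0(x,y,t)=\int_D G_1(x,y,t;\xi,\eta,0)\,h(\xi,\eta)\,d\xi\,d\eta$, and for all $y\in\mathbb R^{n-1}$ the flux $V(y,\cdot)$ satisfies, for $t>0$, the Volterra integral equation of the second kind $$V(y,t)=V_0(y,t)-2\int_0^t\frac{1}{(2\sqrt{\pi(t-\tau)})^{n}}\left[\int_{\mathbb R^{n-1}}e^{-\frac{|y-\eta|^2}{4(t-\tau)}}F\Big(\frac1\tau\int_0^\tau V(\eta,s)\,ds\Big)d\eta\right]d\tau,$$ where $V_0(y,t)=\int_D \partial_xG_1(0,y,t;\xi,\eta,0)\,h(\xi,\eta)\,d\xi\,d\eta$. All these integrals over $D$, over $\mathbb R^{n-1}$ and over $(0,t)$ converge absolutely. -/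

import Mathlib

open MeasureTheory Set Filter Topology

noncomputable section

namespace HalfSpaceHeat

/-- The tangential space `ℝ^{n-1}`, with `m = n - 1`. -/
abbrev Tangent (m : ℕ) : Type := EuclideanSpace ℝ (Fin m)

/-- The half-space `D = {(x, y) : x > 0, y ∈ ℝ^m}` of `ℝ^n`, `n = m + 1`. -/
def halfSpace (m : ℕ) : Set (ℝ × Tangent m) := Ioi 0 ×ˢ univ

/-- The error function. -/
def erf (z : ℝ) : ℝ := 2 / √Real.pi * ∫ X in (0 : ℝ)..z, Real.exp (-X ^ 2)

/-- Green's function of the one-dimensional heat equation on the half-line with homogeneous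
Dirichlet condition (meaningful for `τ < t`). -/
def greenLine (x t ξ τ : ℝ) : ℝ :=
  (Real.exp (-(x - ξ) ^ 2 / (4 * (t - τ))) - Real.exp (-(x + ξ) ^ 2 / (4 * (t - τ)))) /
    (2 * √(Real.pi * (t - τ)))

/-- Green's function `G₁(x, y, t; ξ, η, τ)` of the heat equation in the half-space with
homogeneous Dirichlet condition (meaningful for `τ < t`). -/
def green {m : ℕ} (x : ℝ) (y : Tangent m) (t ξ : ℝ) (η : Tangent m) (τ : ℝ) : ℝ :=
  Real.exp (-‖y - η‖ ^ 2 / (4 * (t - τ))) / (2 * √(Real.pi * (t - τ))) ^ m * greenLine x t ξ τ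

/-- The derivative `G_{1,x}` of the Green's function in its first variable. -/
def greenX {m : ℕ} (x : ℝ) (y : Tangent m) (t ξ : ℝ) (η : Tangent m) (τ : ℝ) : ℝ :=
  deriv (fun x' : ℝ => green x' y t ξ η τ) x

/-- `u₀(x, y, t) = ∫_D G₁(x, y, t; ξ, η, 0) h(ξ, η) dξ dη`. -/
def initialPart {m : ℕ} (h : ℝ → Tangent m → ℝ) (x : ℝ) (y : Tangent m) (t : ℝ) : ℝ :=
  ∫ p in halfSpace m, green x y t p.1 p.2 0 * h p.1 p.2

/-- `V₀(y, t) = ∫_D G_{1,x}(0, y, t; ξ, η, 0) h(ξ, η) dξ dη`. -/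
def initialFlux {m : ℕ} (h : ℝ → Tangent m → ℝ) (y : Tangent m) (t : ℝ) : ℝ :=
  ∫ p in halfSpace m, greenX 0 y t p.1 p.2 0 * h p.1 p.2

/-- The boundary heat flux `V(y, t) = u_x(0, y, t)`, a one-sided derivative. -/
def boundaryFlux {m : ℕ} (u : ℝ → Tangent m → ℝ → ℝ) (y : Tangent m) (t : ℝ) : ℝ :=
  derivWithin (fun x : ℝ => u x y t) (Ici 0) 0

/-- The source `F ((1/t) ∫_0^t V(y, s) ds)` for a flux `V`. -/
def source {m : ℕ} (F : ℝ → ℝ) (V : Tangent m → ℝ → ℝ) (y : Tangent m) (t : ℝ) : ℝ :=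
  F (1 / t * ∫ s in (0 : ℝ)..t, V y s)

/-- The Laplacian of `ℝ^n` in the space variables `(x, y)`: `u_xx + Δ_y u`. -/
def spaceLaplacian {m : ℕ} (u : ℝ → Tangent m → ℝ → ℝ) (x : ℝ) (y : Tangent m) (t : ℝ) : ℝ :=
  iteratedDeriv 2 (fun x' : ℝ => u x' y t) x +
    Laplacian.laplacian (fun y' : Tangent m => u x y' t) y

/-- `u` is a classical solution of the problem
`u_t - Δu = -F ((1/t) ∫_0^t u_x(0, y, s) ds)` for `x > 0`, `t > 0`, with `u(0, y, t) = 0` for `t > 0`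
and `u(x, y, 0) = h(x, y)` for `x > 0`. No compatibility of `h` with the boundary condition is
required: `u` need not be continuous at `x = 0`, `t = 0`. -/
structure IsClassicalSolution {m : ℕ} (F : ℝ → ℝ) (h : ℝ → Tangent m → ℝ)
    (u : ℝ → Tangent m → ℝ → ℝ) : Prop where
  /-- `u` is continuous up to the boundary `x = 0` for positive times. -/
  continuousOn : ContinuousOn (fun q : ℝ × Tangent m × ℝ => u q.1 q.2.1 q.2.2)
    {q | 0 ≤ q.1 ∧ 0 < q.2.2}
  /-- `u` is `C²` in space and `C¹` in time in the interior, with jointly continuous derivatives. -/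
  contDiffOn_space : ∀ t : ℝ, 0 < t →
    ContDiffOn ℝ 2 (fun p : ℝ × Tangent m => u p.1 p.2 t) (halfSpace m)
  continuousOn_space_deriv : ∀ k : ℕ, k ≤ 2 →
    ContinuousOn (fun q : ℝ × Tangent m × ℝ =>
      iteratedFDeriv ℝ k (fun p : ℝ × Tangent m => u p.1 p.2 q.2.2) (q.1, q.2.1))
      {q | 0 < q.1 ∧ 0 < q.2.2}
  differentiableAt_time : ∀ (x : ℝ) (y : Tangent m) (t : ℝ), 0 < x → 0 < t →
    DifferentiableAt ℝ (fun t' : ℝ => u x y t') t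
  continuousOn_time_deriv :
    ContinuousOn (fun q : ℝ × Tangent m × ℝ => deriv (fun t' : ℝ => u q.1 q.2.1 t') q.2.2)
      {q | 0 < q.1 ∧ 0 < q.2.2}
  /-- The boundary flux exists and is integrable in time down to `t = 0`, so that its time
  average is defined. -/
  differentiable_boundary : ∀ (y : Tangent m) (t : ℝ), 0 < t →
    DifferentiableWithinAt ℝ (fun x : ℝ => u x y t) (Ici 0) 0
  flux_integrable : ∀ (y : Tangent m) (t : ℝ), 0 < t →
    IntervalIntegrable (fun s : ℝ => boundaryFlux u y s) volume 0 t
  /-- The heat equation. -/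
  equation : ∀ (x : ℝ) (y : Tangent m) (t : ℝ), 0 < x → 0 < t →
    deriv (fun t' : ℝ => u x y t') t - spaceLaplacian u x y t = -source F (boundaryFlux u) y t
  /-- The boundary condition. -/
  boundary : ∀ (y : Tangent m) (t : ℝ), 0 < t → u 0 y t = 0
  /-- The initial condition, attained in the limit `t → 0⁺`. -/
  initial : ∀ (x : ℝ) (y : Tangent m), 0 < x → u x y 0 = h x y
  initial_tendsto : ∀ (x : ℝ) (y : Tangent m), 0 < x →
    Tendsto (fun t : ℝ => u x y t) (𝓝[>] 0) (𝓝 (h x y))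

/-- The growth class in which the half-space problem is considered: on bounded time intervals `u`
and the source grow at infinity more slowly than every Gaussian `exp (a |·|²)`, `a > 0`; the source
may be singular at `t = 0`, but integrably so. -/
structure HasSubGaussianGrowth {m : ℕ} (F : ℝ → ℝ) (u : ℝ → Tangent m → ℝ → ℝ) : Prop where
  solution_bound : ∀ T > (0 : ℝ), ∀ a > (0 : ℝ), ∃ A : ℝ,
    ∀ (x : ℝ) (y : Tangent m) (t : ℝ), 0 < x → 0 < t → t ≤ T →
      |u x y t| ≤ A * Real.exp (a * (x ^ 2 + ‖y‖ ^ 2))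
  source_bound : ∀ T > (0 : ℝ), ∀ a > (0 : ℝ), ∃ g : ℝ → ℝ,
    IntegrableOn g (Ioc 0 T) ∧ (∀ s > (0 : ℝ), BddAbove (g '' Icc s T)) ∧
    ∀ (y : Tangent m) (t : ℝ), 0 < t → t ≤ T →
      |source F (boundaryFlux u) y t| ≤ g t * Real.exp (a * ‖y‖ ^ 2)

/-- The Gaussian integral `∫_{ℝ^m} exp (-|y - η|² / (4 (t - τ))) F ((1/τ) ∫_0^τ V(η, s) ds) dη`. -/
def sourceIntegral {m : ℕ} (F : ℝ → ℝ) (V : Tangent m → ℝ → ℝ) (y : Tangent m) (t τ : ℝ) : ℝ :=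
  ∫ η : Tangent m, Real.exp (-‖y - η‖ ^ 2 / (4 * (t - τ))) * source F V η τ

end HalfSpaceHeat

end

/-! For a fixed pole `P = (x, y, t)` the Green's function `G₁(P; ξ, η, τ)` solves the backward heat
equation in `(ξ, η, τ)` and vanishes at `ξ = 0`. Green's second identity, multiplied by a slowly
varying cutoff that the Gaussian decay of `G₁` lets one remove, therefore says that between two
times `0 < s ≤ r < t` the integral `∫_D G₁ u` changes by `-∫_s^r ∫_D G₁ f`, where `f` is the source;
as `f` does not depend on `ξ`, the integral over `ξ > 0` is an error function. Letting `s → 0⁺`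
gives `u₀`. Letting `r → t⁻` gives `u(P)`, because the first Gaussian in `G₁` concentrates at `P`
and the second one at the mirror point of `P`, outside the half-space. Differentiating the resulting
representation at `x = 0` under the integral signs yields the equation for the flux. -/

noncomputable section

namespace HalfSpaceHeat

section DirectionalDerivatives

variable {E G : Type*} [NormedAddCommGroup E] [NormedSpace ℝ E] [NormedAddCommGroup G]
  [NormedSpace ℝ G] {f g : E → ℝ} {p : E}

/-- The second derivative `∂_w ∂_w f` of `f` in the direction `w`. -/
def secondDeriv (w : E) (f : E → ℝ) (p : E) : ℝ := fderiv ℝ (fun z => fderiv ℝ f z w) p w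

lemma differentiableAt_fderiv_apply (hf : ContDiffAt ℝ 2 f p) (w : E) :
    DifferentiableAt ℝ (fun z => fderiv ℝ f z w) p :=
  ((hf.fderiv_right (m := 1) (by norm_num)).differentiableAt (by norm_num)).clm_apply
    (differentiableAt_const w)

lemma eventually_differentiableAt (hf : ContDiffAt ℝ 2 f p) :
    ∀ᶠ z in 𝓝 p, DifferentiableAt ℝ f z :=
  (hf.eventually (by norm_num)).mono fun _ hz => hz.differentiableAt (by norm_num)

lemma iteratedFDeriv_two_eq_secondDeriv (hf : ContDiffAt ℝ 2 f p) (w : E) :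
    iteratedFDeriv ℝ 2 f p ![w, w] = secondDeriv w f p := by
  have hdf : DifferentiableAt ℝ (fderiv ℝ f) p :=
    (hf.fderiv_right (m := 1) (by norm_num)).differentiableAt (by norm_num)
  rw [iteratedFDeriv_two_apply, secondDeriv, fderiv_clm_apply hdf (differentiableAt_const w)]
  simp

lemma secondDeriv_mul (hf : ContDiffAt ℝ 2 f p) (hg : ContDiffAt ℝ 2 g p) (w : E) :
    secondDeriv w (fun z => f z * g z) p =
      secondDeriv w f p * g p + 2 * (fderiv ℝ f p w * fderiv ℝ g p w) +
        f p * secondDeriv w g p := by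
  have first : (fun z => fderiv ℝ (fun z' => f z' * g z') z w) =ᶠ[𝓝 p]
      fun z => f z * fderiv ℝ g z w + g z * fderiv ℝ f z w := by
    filter_upwards [eventually_differentiableAt hf, eventually_differentiableAt hg] with z hfz hgz
    rw [fderiv_fun_mul hfz hgz]
    rfl
  have df := hf.differentiableAt (by norm_num)
  have dg := hg.differentiableAt (by norm_num)
  have ddf := differentiableAt_fderiv_apply hf w
  have ddg := differentiableAt_fderiv_apply hg w
  rw [secondDeriv, first.fderiv_eq, fderiv_fun_add (df.fun_mul ddg) (dg.fun_mul ddf),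
    fderiv_fun_mul df ddg, fderiv_fun_mul dg ddf]
  simp only [add_apply, smul_apply, smul_eq_mul, secondDeriv]
  ring

lemma secondDeriv_sub (hf : ContDiffAt ℝ 2 f p) (hg : ContDiffAt ℝ 2 g p) (w : E) :
    secondDeriv w (fun z => f z - g z) p = secondDeriv w f p - secondDeriv w g p := by
  have first : (fun z => fderiv ℝ (fun z' => f z' - g z') z w) =ᶠ[𝓝 p]
      fun z => fderiv ℝ f z w - fderiv ℝ g z w := by
    filter_upwards [eventually_differentiableAt hf, eventually_differentiableAt hg] with z hfz hgz
    rw [fderiv_fun_sub hfz hgz]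
    rfl
  rw [secondDeriv, first.fderiv_eq, fderiv_fun_sub (differentiableAt_fderiv_apply hf w)
    (differentiableAt_fderiv_apply hg w)]
  rfl

lemma fderiv_comp_affine {c : E} {A : G →L[ℝ] E} {z : G} (hf : DifferentiableAt ℝ f (c + A z))
    (w : G) : fderiv ℝ (fun z' => f (c + A z')) z w = fderiv ℝ f (c + A z) (A w) := by
  have hA : HasFDerivAt (fun z' => c + A z') A z := A.hasFDerivAt.const_add c
  exact congrArg (· w) (hf.hasFDerivAt.comp z hA).fderiv

lemma secondDeriv_comp_affine {c : E} {A : G →L[ℝ] E} {z : G} (hf : ContDiffAt ℝ 2 f (c + A z))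
    (w : G) : secondDeriv w (fun z' => f (c + A z')) z = secondDeriv (A w) f (c + A z) := by
  have hA : ContinuousAt (fun z' => c + A z') z := by fun_prop
  have first : (fun z' => fderiv ℝ (fun z'' => f (c + A z'')) z' w) =ᶠ[𝓝 z]
      fun z' => fderiv ℝ f (c + A z') (A w) := by
    filter_upwards [hA.eventually (eventually_differentiableAt hf)] with z' hz'
    exact fderiv_comp_affine hz' w
  rw [secondDeriv, first.fderiv_eq]
  exact fderiv_comp_affine (f := fun p => fderiv ℝ f p (A w))
    (differentiableAt_fderiv_apply hf (A w)) w

lemma secondDeriv_comp_add_right (f : E → ℝ) (w c p : E) :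
    secondDeriv w (fun z => f (z + c)) p = secondDeriv w f (p + c) := by
  simp only [secondDeriv, fderiv_comp_add_right]
  exact DFunLike.congr_fun (fderiv_comp_add_right (f := fun z => fderiv ℝ f z w) c) w

lemma continuousAt_secondDeriv (hf : ContDiffAt ℝ 2 f p) (w : E) :
    ContinuousAt (secondDeriv w f) p := by
  have first : ContDiffAt ℝ 1 (fun z => fderiv ℝ f z w) p :=
    (hf.fderiv_right (m := 1) (by norm_num)).clm_apply contDiffAt_const
  exact (first.fderiv_right (m := 0) (by norm_num)).continuousAt.clm_apply continuousAt_const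

lemma fderiv_apply_eq_zero_of_notMem {L : Set E} (hL : IsClosed L) (hf : ∀ z ∉ L, f z = 0)
    (hp : p ∉ L) (w : E) : fderiv ℝ f p w = 0 := by
  have hf0 : f =ᶠ[𝓝 p] fun _ => 0 := by
    filter_upwards [hL.isOpen_compl.mem_nhds hp] with z hz using hf z hz
  simp [hf0.fderiv_eq]

lemma secondDeriv_eq_zero_of_notMem {L : Set E} (hL : IsClosed L) (hf : ∀ z ∉ L, f z = 0)
    (hp : p ∉ L) (w : E) : secondDeriv w f p = 0 :=
  fderiv_apply_eq_zero_of_notMem hL (fun _ hz => fderiv_apply_eq_zero_of_notMem hL hf hz w) hp w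

lemma integral_mul_secondDeriv [FiniteDimensional ℝ E] [MeasurableSpace E] [BorelSpace E]
    (μ : Measure E) [μ.IsAddHaarMeasure] (hf : ContDiff ℝ 2 f) (hfc : HasCompactSupport f)
    (hg : ContDiff ℝ 2 g) (w : E) :
    ∫ p, f p * secondDeriv w g p ∂μ = ∫ p, secondDeriv w f p * g p ∂μ := by
  have df : Continuous (fun p => fderiv ℝ f p w) := continuous_iff_continuousAt.2 fun p =>
    (differentiableAt_fderiv_apply hf.contDiffAt w).continuousAt
  have dg : Continuous (fun p => fderiv ℝ g p w) := continuous_iff_continuousAt.2 fun p =>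
    (differentiableAt_fderiv_apply hg.contDiffAt w).continuousAt
  have ddf : Continuous (secondDeriv w f) := continuous_iff_continuousAt.2 fun p =>
    continuousAt_secondDeriv hf.contDiffAt w
  have ddg : Continuous (secondDeriv w g) := continuous_iff_continuousAt.2 fun p =>
    continuousAt_secondDeriv hg.contDiffAt w
  have hfc' : HasCompactSupport (fun p => fderiv ℝ f p w) := hfc.fderiv_apply ℝ w
  have hfc'' : HasCompactSupport (secondDeriv w f) := hfc'.fderiv_apply ℝ w
  have i02 := (hf.continuous.mul ddg).integrable_of_hasCompactSupport
    (μ := μ) hfc.mul_right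
  have i11 := (df.mul dg).integrable_of_hasCompactSupport (μ := μ) hfc'.mul_right
  have i20 := (ddf.mul hg.continuous).integrable_of_hasCompactSupport
    (μ := μ) hfc''.mul_right
  have i01 := (hf.continuous.mul dg).integrable_of_hasCompactSupport (μ := μ) hfc.mul_right
  have i10 := (df.mul hg.continuous).integrable_of_hasCompactSupport (μ := μ) hfc'.mul_right
  calc ∫ p, f p * secondDeriv w g p ∂μ = -∫ p, fderiv ℝ f p w * fderiv ℝ g p w ∂μ :=
        integral_mul_fderiv_eq_neg_fderiv_mul_of_integrable i11 i02 i01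
          (fun p _ => hf.differentiable (by norm_num) p)
          (fun p _ => differentiableAt_fderiv_apply hg.contDiffAt w)
    _ = ∫ p, secondDeriv w f p * g p ∂μ := by
        rw [integral_mul_fderiv_eq_neg_fderiv_mul_of_integrable i20 i11 i10
          (fun p _ => differentiableAt_fderiv_apply hf.contDiffAt w)
          (fun p _ => hg.differentiable (by norm_num) p), neg_neg]
        rfl

end DirectionalDerivatives

section HalfSpace

variable {m : ℕ}

lemma integrableOn_of_eq_zero_of_notMem {X : Type*} [TopologicalSpace X] [MeasurableSpace X]
    [BorelSpace X] [T2Space X] {μ : Measure X} [IsFiniteMeasureOnCompacts μ] {S L : Set X}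
    (hS : IsClosed S) (hL : IsCompact L) {f : X → ℝ} (hf : ContinuousOn f S)
    (hf0 : ∀ p ∈ S, p ∉ L → f p = 0) : IntegrableOn f S μ :=
  ((hf.mono inter_subset_left).integrableOn_compact (hL.inter_left hS)).of_forall_sdiff_eq_zero
    hS.measurableSet fun p hp => hf0 p hp.1 fun hpL => hp.2 ⟨hp.1, hpL⟩

lemma integral_Ioi_mul_deriv_of_eq_zero {f f' g g' : ℝ → ℝ} {L : Set ℝ} (hL : IsCompact L)
    (hf : ∀ ξ, 0 ≤ ξ → HasDerivAt f (f' ξ) ξ) (hg : ∀ ξ, 0 ≤ ξ → HasDerivAt g (g' ξ) ξ)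
    (hf' : ContinuousOn f' (Ici 0)) (hg' : ContinuousOn g' (Ici 0)) (hfL : ∀ ξ ∉ L, f ξ = 0)
    (hfL' : ∀ ξ ∉ L, f' ξ = 0) :
    ∫ ξ in Ioi 0, f ξ * g' ξ = -(f 0 * g 0) - ∫ ξ in Ioi 0, f' ξ * g ξ := by
  have cf : ContinuousOn f (Ici 0) := fun ξ hξ => (hf ξ hξ).continuousAt.continuousWithinAt
  have cg : ContinuousOn g (Ici 0) := fun ξ hξ => (hg ξ hξ).continuousAt.continuousWithinAt
  have integrable {k k' : ℝ → ℝ} (hk : ContinuousOn k (Ici 0)) (hk' : ContinuousOn k' (Ici 0))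
      (hkL : ∀ ξ ∉ L, k ξ = 0) : IntegrableOn (k * k') (Ioi 0) :=
    (integrableOn_of_eq_zero_of_notMem isClosed_Ici hL (hk.mul hk') fun ξ _ hξ => by
      rw [Pi.mul_apply, hkL ξ hξ, zero_mul]).mono_set Ioi_subset_Ici_self
  have atBoundary : Tendsto (f * g) (𝓝[>] 0) (𝓝 (f 0 * g 0)) :=
    ((cf.mul cg) 0 self_mem_Ici).mono_left (nhdsWithin_mono 0 Ioi_subset_Ici_self)
  have atInfinity : Tendsto (f * g) atTop (𝓝 0) := by
    obtain ⟨N, hN⟩ := hL.bddAbove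
    refine tendsto_const_nhds.congr' ?_
    filter_upwards [eventually_gt_atTop N] with ξ hξ
    rw [Pi.mul_apply, hfL ξ fun hmem => hξ.not_ge (hN hmem), zero_mul]
  rw [integral_Ioi_mul_deriv_eq_deriv_mul (fun ξ hξ => hf ξ (le_of_lt hξ))
    (fun ξ hξ => hg ξ (le_of_lt hξ)) (integrable cf hg' hfL) (integrable hf' cg hfL') atBoundary
    atInfinity, zero_sub]

lemma integral_Ioi_mul_secondDeriv {f g : ℝ → ℝ} {L : Set ℝ} (hL : IsCompact L)
    (hf : ∀ ξ, 0 ≤ ξ → ContDiffAt ℝ 2 f ξ) (hg : ∀ ξ, 0 ≤ ξ → ContDiffAt ℝ 2 g ξ)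
    (hfL : ∀ ξ ∉ L, f ξ = 0) (hf0 : f 0 = 0) :
    ∫ ξ in Ioi 0, f ξ * secondDeriv 1 g ξ =
      (∫ ξ in Ioi 0, secondDeriv 1 f ξ * g ξ) + fderiv ℝ f 0 1 * g 0 := by
  have first {k : ℝ → ℝ} (hk : ∀ ξ, 0 ≤ ξ → ContDiffAt ℝ 2 k ξ) (ξ : ℝ) (hξ : 0 ≤ ξ) :
      HasDerivAt k (fderiv ℝ k ξ 1) ξ :=
    ((hk ξ hξ).differentiableAt (by norm_num)).hasDerivAt
  have second {k : ℝ → ℝ} (hk : ∀ ξ, 0 ≤ ξ → ContDiffAt ℝ 2 k ξ) (ξ : ℝ) (hξ : 0 ≤ ξ) :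
      HasDerivAt (fun ξ' => fderiv ℝ k ξ' 1) (secondDeriv 1 k ξ) ξ :=
    (differentiableAt_fderiv_apply (hk ξ hξ) 1).hasDerivAt
  have cont_first {k : ℝ → ℝ} (hk : ∀ ξ, 0 ≤ ξ → ContDiffAt ℝ 2 k ξ) :
      ContinuousOn (fun ξ => fderiv ℝ k ξ 1) (Ici 0) :=
    fun ξ hξ => (second hk ξ hξ).continuousAt.continuousWithinAt
  have cont_second {k : ℝ → ℝ} (hk : ∀ ξ, 0 ≤ ξ → ContDiffAt ℝ 2 k ξ) :
      ContinuousOn (secondDeriv 1 k) (Ici 0) :=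
    fun ξ hξ => (continuousAt_secondDeriv (hk ξ hξ) 1).continuousWithinAt
  have hfL' : ∀ ξ ∉ L, fderiv ℝ f ξ 1 = 0 := fun ξ hξ =>
    fderiv_apply_eq_zero_of_notMem hL.isClosed hfL hξ 1
  have hfL'' : ∀ ξ ∉ L, secondDeriv 1 f ξ = 0 := fun ξ hξ =>
    secondDeriv_eq_zero_of_notMem hL.isClosed hfL hξ 1
  rw [integral_Ioi_mul_deriv_of_eq_zero hL (first hf) (second hg) (cont_first hf) (cont_second hg)
      hfL hfL',
    integral_Ioi_mul_deriv_of_eq_zero hL (second hf) (first hg) (cont_second hf) (cont_first hg)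
      hfL' hfL'', hf0]
  ring

/-- The coordinate directions of `ℝ × ℝ^m`: `none` is normal to the boundary `x = 0`. -/
def coordDir : Option (Fin m) → ℝ × Tangent m
  | none => (1, 0)
  | some i => (0, EuclideanSpace.basisFun (Fin m) ℝ i)

/-- The Laplacian of `ℝ × ℝ^m`. The product carries no inner product in Mathlib, so it is written
as the sum of the second derivatives in the coordinate directions. -/
def prodLaplacian (f : ℝ × Tangent m → ℝ) (p : ℝ × Tangent m) : ℝ :=
  ∑ i, secondDeriv (coordDir i) f p

lemma secondDeriv_slice_normal {f : ℝ × Tangent m → ℝ} {x : ℝ} {y : Tangent m}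
    (hf : ContDiffAt ℝ 2 f (x, y)) :
    secondDeriv 1 (fun x' => f (x', y)) x = secondDeriv (1, 0) f (x, y) := by
  simpa using secondDeriv_comp_affine (c := (0, y)) (A := ContinuousLinearMap.inl ℝ ℝ (Tangent m))
    (z := x) (f := f) (by simpa using hf) 1

lemma fderiv_slice_normal {f : ℝ × Tangent m → ℝ} {x : ℝ} {y : Tangent m}
    (hf : DifferentiableAt ℝ f (x, y)) :
    fderiv ℝ (fun x' => f (x', y)) x 1 = fderiv ℝ f (x, y) (1, 0) := by
  simpa using fderiv_comp_affine (c := (0, y)) (A := ContinuousLinearMap.inl ℝ ℝ (Tangent m))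
    (z := x) (f := f) (by simpa using hf) 1

lemma secondDeriv_slice_tangential {f : ℝ × Tangent m → ℝ} {x : ℝ} {y : Tangent m}
    (hf : ContDiffAt ℝ 2 f (x, y)) (w : Tangent m) :
    secondDeriv w (fun y' => f (x, y')) y = secondDeriv (0, w) f (x, y) := by
  simpa using secondDeriv_comp_affine (c := (x, 0)) (A := ContinuousLinearMap.inr ℝ ℝ (Tangent m))
    (z := y) (f := f) (by simpa using hf) w

lemma spaceLaplacian_eq_prodLaplacian {u : ℝ → Tangent m → ℝ → ℝ} {x : ℝ} {y : Tangent m} {t : ℝ}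
    (hu : ContDiffAt ℝ 2 (fun p : ℝ × Tangent m => u p.1 p.2 t) (x, y)) :
    spaceLaplacian u x y t = prodLaplacian (fun p => u p.1 p.2 t) (x, y) := by
  have tangential : ContDiffAt ℝ 2 (fun y' => u x y' t) y :=
    hu.comp y (contDiffAt_const.prodMk contDiffAt_id)
  have normal : iteratedDeriv 2 (fun x' => u x' y t) x =
      secondDeriv (1, 0) (fun p : ℝ × Tangent m => u p.1 p.2 t) (x, y) := by
    rw [← secondDeriv_slice_normal hu, iteratedDeriv_succ, iteratedDeriv_one]
    rfl
  rw [spaceLaplacian, prodLaplacian, Fintype.sum_option, normal,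
    InnerProductSpace.laplacian_eq_iteratedFDeriv_orthonormalBasis _
      (EuclideanSpace.basisFun (Fin m) ℝ)]
  refine congrArg _ (Finset.sum_congr rfl fun i _ => ?_)
  rw [iteratedFDeriv_two_eq_secondDeriv tangential, secondDeriv_slice_tangential hu]
  rfl

lemma prodLaplacian_mul {f g : ℝ × Tangent m → ℝ} {p : ℝ × Tangent m} (hf : ContDiffAt ℝ 2 f p)
    (hg : ContDiffAt ℝ 2 g p) :
    prodLaplacian (fun z => f z * g z) p = prodLaplacian f p * g p +
      2 * ∑ i, fderiv ℝ f p (coordDir i) * fderiv ℝ g p (coordDir i) +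
        f p * prodLaplacian g p := by
  simp only [prodLaplacian, secondDeriv_mul hf hg, Finset.sum_add_distrib, Finset.sum_mul,
    Finset.mul_sum]

lemma prodLaplacian_comp_add_right (f : ℝ × Tangent m → ℝ) (c p : ℝ × Tangent m) :
    prodLaplacian (fun z => f (z + c)) p = prodLaplacian f (p + c) :=
  Finset.sum_congr rfl fun i _ => secondDeriv_comp_add_right f (coordDir i) c p

lemma prodLaplacian_eq_zero_of_notMem {f : ℝ × Tangent m → ℝ} {L : Set (ℝ × Tangent m)}
    (hL : IsClosed L) (hfL : ∀ p ∉ L, f p = 0) {p : ℝ × Tangent m} (hp : p ∉ L) :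
    prodLaplacian f p = 0 :=
  Finset.sum_eq_zero fun i _ => secondDeriv_eq_zero_of_notMem hL hfL hp (coordDir i)

lemma measurableSet_halfSpace (m : ℕ) : MeasurableSet (halfSpace m) :=
  measurableSet_Ioi.prod MeasurableSet.univ

lemma isOpen_halfSpace (m : ℕ) : IsOpen (halfSpace m) := isOpen_Ioi.prod isOpen_univ

lemma restrict_halfSpace (m : ℕ) :
    (volume.restrict (halfSpace m) : Measure (ℝ × Tangent m)) =
      (volume.restrict (Ioi 0)).prod volume := by
  rw [halfSpace, Measure.volume_eq_prod, ← Measure.prod_restrict, Measure.restrict_univ]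

/-- The closed half-space `{(x, y) : x ≥ 0, y ∈ ℝ^m}`. -/
def closedHalfSpace (m : ℕ) : Set (ℝ × Tangent m) := {p | 0 ≤ p.1}

lemma mk_mem_closedHalfSpace {ξ : ℝ} (hξ : 0 ≤ ξ) (η : Tangent m) :
    (ξ, η) ∈ closedHalfSpace m := hξ

lemma isClosed_closedHalfSpace (m : ℕ) : IsClosed (closedHalfSpace m) :=
  isClosed_le continuous_const continuous_fst

lemma halfSpace_subset_closedHalfSpace (m : ℕ) : halfSpace m ⊆ closedHalfSpace m :=
  fun p hp => le_of_lt (b := p.1) hp.1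

variable {φ v : ℝ × Tangent m → ℝ} {L : Set (ℝ × Tangent m)}

lemma integrableOn_halfSpace (hL : IsCompact L) (hv : ContinuousOn v (closedHalfSpace m))
    (hvL : ∀ p ∉ L, v p = 0) : IntegrableOn v (halfSpace m) :=
  (integrableOn_of_eq_zero_of_notMem (isClosed_closedHalfSpace m) hL hv fun p _ => hvL p).mono_set
    (halfSpace_subset_closedHalfSpace m)

lemma integrableOn_mul_secondDeriv (hL : IsCompact L)
    (hφ : ∀ p ∈ closedHalfSpace m, ContDiffAt ℝ 2 φ p)
    (hv : ∀ p ∈ closedHalfSpace m, ContDiffAt ℝ 2 v p) (hφL : ∀ p ∉ L, φ p = 0)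
    (w : ℝ × Tangent m) :
    IntegrableOn (fun p => φ p * secondDeriv w v p) (halfSpace m) ∧
      IntegrableOn (fun p => secondDeriv w φ p * v p) (halfSpace m) := by
  refine ⟨integrableOn_halfSpace hL (fun p hp => ?_) fun p hp => by rw [hφL p hp, zero_mul],
    integrableOn_halfSpace hL (fun p hp => ?_) fun p hp => by
      rw [secondDeriv_eq_zero_of_notMem hL.isClosed hφL hp, zero_mul]⟩
  · exact ((hφ p hp).continuousAt.mul (continuousAt_secondDeriv (hv p hp) w)).continuousWithinAt
  · exact ((continuousAt_secondDeriv (hφ p hp) w).mul (hv p hp).continuousAt).continuousWithinAt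

lemma integral_halfSpace_mul_secondDeriv_tangential (hL : IsCompact L)
    (hφ : ∀ p ∈ closedHalfSpace m, ContDiffAt ℝ 2 φ p)
    (hv : ∀ p ∈ closedHalfSpace m, ContDiffAt ℝ 2 v p) (hφL : ∀ p ∉ L, φ p = 0) (w : Tangent m) :
    ∫ p in halfSpace m, φ p * secondDeriv (0, w) v p =
      ∫ p in halfSpace m, secondDeriv (0, w) φ p * v p := by
  have slice {k : ℝ × Tangent m → ℝ} (hk : ∀ p ∈ closedHalfSpace m, ContDiffAt ℝ 2 k p) {ξ : ℝ}
      (hξ : 0 < ξ) : ContDiff ℝ 2 (fun η => k (ξ, η)) := contDiff_iff_contDiffAt.2 fun η =>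
    (hk _ (mk_mem_closedHalfSpace hξ.le η)).comp η (contDiffAt_const.prodMk contDiffAt_id)
  obtain ⟨i1, i2⟩ := integrableOn_mul_secondDeriv hL hφ hv hφL (0, w)
  rw [IntegrableOn, restrict_halfSpace] at i1 i2
  rw [restrict_halfSpace, integral_prod _ i1, integral_prod _ i2]
  refine setIntegral_congr_fun measurableSet_Ioi fun ξ hξ => ?_
  have hcompact : HasCompactSupport (fun η => φ (ξ, η)) :=
    HasCompactSupport.intro (hL.image continuous_snd) fun η hη =>
      hφL _ fun hmem => hη ⟨_, hmem, rfl⟩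
  have mem := mk_mem_closedHalfSpace (m := m) (le_of_lt hξ)
  simp only [← secondDeriv_slice_tangential (hφ _ (mem _)),
    ← secondDeriv_slice_tangential (hv _ (mem _))]
  exact integral_mul_secondDeriv volume (slice hφ hξ) hcompact (slice hv hξ) w

lemma integral_halfSpace_mul_secondDeriv_normal (hL : IsCompact L)
    (hφ : ∀ p ∈ closedHalfSpace m, ContDiffAt ℝ 2 φ p)
    (hv : ∀ p ∈ closedHalfSpace m, ContDiffAt ℝ 2 v p) (hφL : ∀ p ∉ L, φ p = 0)
    (hφ0 : ∀ η, φ (0, η) = 0) :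
    ∫ p in halfSpace m, φ p * secondDeriv (1, 0) v p =
      (∫ p in halfSpace m, secondDeriv (1, 0) φ p * v p) +
        ∫ η, fderiv ℝ φ (0, η) (1, 0) * v (0, η) := by
  have slice {k : ℝ × Tangent m → ℝ} (hk : ∀ p ∈ closedHalfSpace m, ContDiffAt ℝ 2 k p)
      (η : Tangent m) (ξ : ℝ) (hξ : 0 ≤ ξ) : ContDiffAt ℝ 2 (fun ξ' => k (ξ', η)) ξ :=
    (hk _ (mk_mem_closedHalfSpace hξ η)).comp ξ (contDiffAt_id.prodMk contDiffAt_const)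
  have halfLine (η : Tangent m) : ∫ ξ in Ioi 0, φ (ξ, η) * secondDeriv (1, 0) v (ξ, η) =
      (∫ ξ in Ioi 0, secondDeriv (1, 0) φ (ξ, η) * v (ξ, η)) +
        fderiv ℝ φ (0, η) (1, 0) * v (0, η) := by
    have normal {k : ℝ × Tangent m → ℝ} (hk : ∀ p ∈ closedHalfSpace m, ContDiffAt ℝ 2 k p) :
        EqOn (fun ξ => secondDeriv (1, 0) k (ξ, η)) (secondDeriv 1 fun ξ => k (ξ, η)) (Ioi 0) :=
      fun ξ hξ => (secondDeriv_slice_normal (hk _ (mk_mem_closedHalfSpace (le_of_lt hξ) η))).symm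
    have dφ := (hφ _ (mk_mem_closedHalfSpace le_rfl η)).differentiableAt (by norm_num)
    rw [← fderiv_slice_normal dφ,
      setIntegral_congr_fun measurableSet_Ioi fun ξ hξ => congrArg (φ (ξ, η) * ·) (normal hv hξ),
      setIntegral_congr_fun measurableSet_Ioi fun ξ hξ => congrArg (· * v (ξ, η)) (normal hφ hξ)]
    exact integral_Ioi_mul_secondDeriv (hL.image continuous_fst) (slice hφ η) (slice hv η)
      (fun ξ hξ => hφL _ fun hmem => hξ ⟨_, hmem, rfl⟩) (hφ0 η)
  have boundary : Integrable (fun η => fderiv ℝ φ (0, η) (1, 0) * v (0, η)) := by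
    refine Continuous.integrable_of_hasCompactSupport ?_ (HasCompactSupport.intro
      (hL.image continuous_snd) fun η hη => ?_)
    · refine continuous_iff_continuousAt.2 fun η => ?_
      have hmem : (0, η) ∈ closedHalfSpace m := mk_mem_closedHalfSpace le_rfl η
      exact ((differentiableAt_fderiv_apply (hφ _ hmem) (1, 0)).continuousAt.mul
        (hv _ hmem).continuousAt).comp (f := fun η => (0, η)) (by fun_prop)
    · rw [fderiv_apply_eq_zero_of_notMem hL.isClosed hφL fun hmem => hη ⟨_, hmem, rfl⟩, zero_mul]
  obtain ⟨i1, i2⟩ := integrableOn_mul_secondDeriv hL hφ hv hφL (1, 0)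
  rw [IntegrableOn, restrict_halfSpace] at i1 i2
  rw [restrict_halfSpace, integral_prod_symm _ i1, integral_prod_symm _ i2,
    ← integral_add i2.integral_prod_right boundary]
  exact integral_congr_ae (ae_of_all _ halfLine)

lemma integral_halfSpace_mul_prodLaplacian (hL : IsCompact L)
    (hφ : ∀ p ∈ closedHalfSpace m, ContDiffAt ℝ 2 φ p)
    (hv : ∀ p ∈ closedHalfSpace m, ContDiffAt ℝ 2 v p) (hφL : ∀ p ∉ L, φ p = 0)
    (hφ0 : ∀ η, φ (0, η) = 0) :
    ∫ p in halfSpace m, φ p * prodLaplacian v p =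
      (∫ p in halfSpace m, prodLaplacian φ p * v p) +
        ∫ η, fderiv ℝ φ (0, η) (1, 0) * v (0, η) := by
  have integrable := fun i => integrableOn_mul_secondDeriv hL hφ hv hφL (coordDir i)
  simp only [prodLaplacian, Finset.mul_sum, Finset.sum_mul]
  rw [integral_finsetSum _ fun i _ => (integrable i).1,
    integral_finsetSum _ fun i _ => (integrable i).2, Fintype.sum_option, Fintype.sum_option]
  simp only [coordDir, integral_halfSpace_mul_secondDeriv_tangential hL hφ hv hφL,
    integral_halfSpace_mul_secondDeriv_normal hL hφ hv hφL hφ0]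
  ring

end HalfSpace

section Parabolic

variable {E : Type*} [NormedAddCommGroup E] [NormedSpace ℝ E] {S : Set E} {I : Set ℝ}
  {v w : E → ℝ → ℝ}

/-- `v` is twice differentiable in space and once in time at the points of `S × I`, with jointly
continuous derivatives; only the directional derivatives that enter a parabolic equation are
mentioned. -/
structure IsParabolicRegular (S : Set E) (I : Set ℝ) (v : E → ℝ → ℝ) : Prop where
  contDiffAt : ∀ p ∈ S, ∀ τ ∈ I, ContDiffAt ℝ 2 (fun z => v z τ) p
  differentiableAt : ∀ p ∈ S, ∀ τ ∈ I, DifferentiableAt ℝ (v p) τ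
  continuousOn : ContinuousOn (fun q : E × ℝ => v q.1 q.2) (S ×ˢ I)
  continuousOn_fderiv : ∀ e : E,
    ContinuousOn (fun q : E × ℝ => fderiv ℝ (fun z => v z q.2) q.1 e) (S ×ˢ I)
  continuousOn_secondDeriv : ∀ e : E,
    ContinuousOn (fun q : E × ℝ => secondDeriv e (fun z => v z q.2) q.1) (S ×ˢ I)
  continuousOn_deriv : ContinuousOn (fun q : E × ℝ => deriv (v q.1) q.2) (S ×ˢ I)

namespace IsParabolicRegular

lemma continuousOn_slice (hv : IsParabolicRegular S I v) {τ : ℝ} (hτ : τ ∈ I) :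
    ContinuousOn (fun p => v p τ) S :=
  fun p hp => (hv.contDiffAt p hp τ hτ).continuousAt.continuousWithinAt

lemma mono {S' : Set E} {I' : Set ℝ} (hv : IsParabolicRegular S I v) (hS : S' ⊆ S) (hI : I' ⊆ I) :
    IsParabolicRegular S' I' v where
  contDiffAt p hp τ hτ := hv.contDiffAt p (hS hp) τ (hI hτ)
  differentiableAt p hp τ hτ := hv.differentiableAt p (hS hp) τ (hI hτ)
  continuousOn := hv.continuousOn.mono (prod_mono hS hI)
  continuousOn_fderiv e := (hv.continuousOn_fderiv e).mono (prod_mono hS hI)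
  continuousOn_secondDeriv e := (hv.continuousOn_secondDeriv e).mono (prod_mono hS hI)
  continuousOn_deriv := hv.continuousOn_deriv.mono (prod_mono hS hI)

lemma comp_add_right (hv : IsParabolicRegular S I v) (c : E) :
    IsParabolicRegular ((· + c) ⁻¹' S) I fun p => v (p + c) := by
  have hmaps : MapsTo (fun q : E × ℝ => (q.1 + c, q.2)) (((· + c) ⁻¹' S) ×ˢ I) (S ×ˢ I) :=
    fun q hq => hq
  have hshift : ContinuousOn (fun q : E × ℝ => (q.1 + c, q.2)) (((· + c) ⁻¹' S) ×ˢ I) := by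
    fun_prop
  refine ⟨fun p hp τ hτ => (hv.contDiffAt (p + c) hp τ hτ).comp p
    (contDiffAt_id.add contDiffAt_const), fun p hp τ hτ => hv.differentiableAt (p + c) hp τ hτ,
    hv.continuousOn.comp hshift hmaps, fun e => ?_, fun e => ?_,
    hv.continuousOn_deriv.comp hshift hmaps⟩
  · exact ((hv.continuousOn_fderiv e).comp hshift hmaps).congr fun q _ =>
      DFunLike.congr_fun (fderiv_comp_add_right (f := fun z => v z q.2) c) e
  · exact ((hv.continuousOn_secondDeriv e).comp hshift hmaps).congr fun q _ =>
      secondDeriv_comp_add_right (fun z => v z q.2) e c q.1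

lemma sub (hv : IsParabolicRegular S I v) (hw : IsParabolicRegular S I w) :
    IsParabolicRegular S I fun p τ => v p τ - w p τ where
  contDiffAt p hp τ hτ := (hv.contDiffAt p hp τ hτ).sub (hw.contDiffAt p hp τ hτ)
  differentiableAt p hp τ hτ := (hv.differentiableAt p hp τ hτ).sub (hw.differentiableAt p hp τ hτ)
  continuousOn := hv.continuousOn.sub hw.continuousOn
  continuousOn_fderiv e := by
    refine ((hv.continuousOn_fderiv e).sub (hw.continuousOn_fderiv e)).congr fun q hq => ?_
    rw [fderiv_fun_sub ((hv.contDiffAt _ hq.1 _ hq.2).differentiableAt (by norm_num))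
      ((hw.contDiffAt _ hq.1 _ hq.2).differentiableAt (by norm_num))]
    rfl
  continuousOn_secondDeriv e :=
    ((hv.continuousOn_secondDeriv e).sub (hw.continuousOn_secondDeriv e)).congr fun q hq =>
      secondDeriv_sub (hv.contDiffAt _ hq.1 _ hq.2) (hw.contDiffAt _ hq.1 _ hq.2) e
  continuousOn_deriv := (hv.continuousOn_deriv.sub hw.continuousOn_deriv).congr fun q hq =>
    deriv_fun_sub (hv.differentiableAt _ hq.1 _ hq.2) (hw.differentiableAt _ hq.1 _ hq.2)

lemma mul (hv : IsParabolicRegular S I v) (hw : IsParabolicRegular S I w) :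
    IsParabolicRegular S I fun p τ => v p τ * w p τ where
  contDiffAt p hp τ hτ := (hv.contDiffAt p hp τ hτ).mul (hw.contDiffAt p hp τ hτ)
  differentiableAt p hp τ hτ := (hv.differentiableAt p hp τ hτ).mul (hw.differentiableAt p hp τ hτ)
  continuousOn := hv.continuousOn.mul hw.continuousOn
  continuousOn_fderiv e := by
    refine ((hv.continuousOn.mul (hw.continuousOn_fderiv e)).add
      (hw.continuousOn.mul (hv.continuousOn_fderiv e))).congr fun q hq => ?_
    rw [fderiv_fun_mul ((hv.contDiffAt _ hq.1 _ hq.2).differentiableAt (by norm_num))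
      ((hw.contDiffAt _ hq.1 _ hq.2).differentiableAt (by norm_num))]
    rfl
  continuousOn_secondDeriv e :=
    ((((hv.continuousOn_secondDeriv e).mul hw.continuousOn).add (continuousOn_const.mul
      ((hv.continuousOn_fderiv e).mul (hw.continuousOn_fderiv e)))).add
      (hv.continuousOn.mul (hw.continuousOn_secondDeriv e))).congr fun q hq =>
        secondDeriv_mul (hv.contDiffAt _ hq.1 _ hq.2) (hw.contDiffAt _ hq.1 _ hq.2) e
  continuousOn_deriv :=
    ((hv.continuousOn_deriv.mul hw.continuousOn).add
      (hv.continuousOn.mul hw.continuousOn_deriv)).congr fun q hq =>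
        deriv_fun_mul (hv.differentiableAt _ hq.1 _ hq.2) (hw.differentiableAt _ hq.1 _ hq.2)

lemma of_contDiff {χ : E → ℝ} (hχ : ContDiff ℝ 2 χ) :
    IsParabolicRegular S I fun p _ => χ p where
  contDiffAt _ _ _ _ := hχ.contDiffAt
  differentiableAt _ _ _ _ := differentiableAt_const _
  continuousOn := (hχ.continuous.comp continuous_fst).continuousOn
  continuousOn_fderiv e := (((hχ.continuous_fderiv (by norm_num)).clm_apply
    continuous_const).comp continuous_fst).continuousOn
  continuousOn_secondDeriv e := ((continuous_iff_continuousAt.2 fun _ =>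
    continuousAt_secondDeriv hχ.contDiffAt e).comp continuous_fst).continuousOn
  continuousOn_deriv := by simpa only [deriv_const] using continuousOn_const

lemma continuousOn_prodLaplacian {m : ℕ} {S : Set (ℝ × Tangent m)} {v : ℝ × Tangent m → ℝ → ℝ}
    (hv : IsParabolicRegular S I v) :
    ContinuousOn (fun q : (ℝ × Tangent m) × ℝ => prodLaplacian (fun z => v z q.2) q.1)
      (S ×ˢ I) :=
  continuousOn_finsetSum _ fun i _ => hv.continuousOn_secondDeriv (coordDir i)

end IsParabolicRegular

end Parabolic

section GreenIdentity

variable {m : ℕ} {s r : ℝ} {φ v : ℝ × Tangent m → ℝ → ℝ} {L : Set (ℝ × Tangent m)}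

lemma integrableOn_halfSpace_prod (hL : IsCompact L) {f : (ℝ × Tangent m) × ℝ → ℝ}
    (hf : ContinuousOn f (closedHalfSpace m ×ˢ Icc s r))
    (hfL : ∀ p ∉ L, ∀ τ ∈ Icc s r, f (p, τ) = 0) :
    IntegrableOn f (halfSpace m ×ˢ Ioc s r) := by
  refine (integrableOn_of_eq_zero_of_notMem ((isClosed_closedHalfSpace m).prod isClosed_Icc)
    (hL.prod (isCompact_Icc (a := s) (b := r))) hf fun q hq hqL => ?_).mono_set
    (prod_mono (halfSpace_subset_closedHalfSpace m) Ioc_subset_Icc_self)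
  exact hfL q.1 (fun hmem => hqL ⟨hmem, hq.2⟩) q.2 hq.2

lemma integrableOn_halfSpace_prod_mul (hL : IsCompact L) {f g : (ℝ × Tangent m) × ℝ → ℝ}
    (hf : ContinuousOn f (closedHalfSpace m ×ˢ Icc s r))
    (hg : ContinuousOn g (closedHalfSpace m ×ˢ Icc s r)) (hfL : ∀ p ∉ L, ∀ τ, f (p, τ) = 0) :
    IntegrableOn (fun q => f q * g q) (halfSpace m ×ˢ Ioc s r) :=
  integrableOn_halfSpace_prod hL (hf.mul hg) fun p hp τ _ => mul_eq_zero_of_left (hfL p hp τ) _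

section VolumeProd

variable {α β : Type*} [MeasureSpace α] [MeasureSpace β] [SFinite (volume : Measure α)]
  [SFinite (volume : Measure β)] {A : Set α} {B : Set β} {f : α × β → ℝ}

lemma volume_restrict_prod :
    (volume.restrict (A ×ˢ B) : Measure (α × β)) =
      (volume.restrict A).prod (volume.restrict B) := by
  rw [Measure.volume_eq_prod, Measure.prod_restrict]

lemma setIntegral_volume_prod_symm (hf : IntegrableOn f (A ×ˢ B)) :
    ∫ q in A ×ˢ B, f q = ∫ b in B, ∫ a in A, f (a, b) := by
  rw [IntegrableOn, volume_restrict_prod] at hf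
  rw [volume_restrict_prod, integral_prod_symm _ hf]

end VolumeProd

lemma integral_halfSpace_sub_eq_integral_deriv (hsr : s ≤ r) (hL : IsCompact L)
    (hv : IsParabolicRegular (closedHalfSpace m) (Icc s r) v)
    (hvL : ∀ p ∉ L, ∀ τ, v p τ = 0) :
    (∫ p in halfSpace m, v p r) - ∫ p in halfSpace m, v p s =
      ∫ q in halfSpace m ×ˢ Ioc s r, deriv (v q.1) q.2 := by
  have slice {τ : ℝ} (hτ : τ ∈ Icc s r) : IntegrableOn (fun p => v p τ) (halfSpace m) :=
    integrableOn_halfSpace hL (hv.continuousOn_slice hτ) fun p hp => hvL p hp τ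
  have slab : IntegrableOn (fun q : (ℝ × Tangent m) × ℝ => deriv (v q.1) q.2)
      (halfSpace m ×ˢ Ioc s r) := integrableOn_halfSpace_prod hL hv.continuousOn_deriv
    fun p hp τ _ => by simp [show v p = fun _ => 0 from funext (hvL p hp)]
  rw [IntegrableOn, volume_restrict_prod] at slab
  rw [volume_restrict_prod, integral_prod _ slab,
    ← integral_sub (slice (right_mem_Icc.2 hsr)) (slice (left_mem_Icc.2 hsr))]
  refine setIntegral_congr_fun (measurableSet_halfSpace m) fun p hp => ?_
  have hp' := halfSpace_subset_closedHalfSpace m hp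
  have hcont : ContinuousOn (deriv (v p)) (Icc s r) := hv.continuousOn_deriv.comp
    (f := fun τ => (p, τ)) (by fun_prop) fun τ hτ => ⟨hp', hτ⟩
  dsimp only
  rw [← intervalIntegral.integral_of_le hsr, intervalIntegral.integral_deriv_eq_sub]
  · exact fun τ hτ => hv.differentiableAt p hp' τ (by rwa [uIcc_of_le hsr] at hτ)
  · exact hcont.intervalIntegrable_of_Icc hsr

lemma integral_slab_mul_prodLaplacian (hL : IsCompact L)
    (hφ : IsParabolicRegular (closedHalfSpace m) (Icc s r) φ)
    (hv : IsParabolicRegular (closedHalfSpace m) (Icc s r) v) (hφL : ∀ p ∉ L, ∀ τ, φ p τ = 0)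
    (hφ0 : ∀ η τ, φ (0, η) τ = 0) :
    ∫ q in halfSpace m ×ˢ Ioc s r, φ q.1 q.2 * prodLaplacian (fun z => v z q.2) q.1 =
      (∫ q in halfSpace m ×ˢ Ioc s r, prodLaplacian (fun z => φ z q.2) q.1 * v q.1 q.2) +
        ∫ q in (univ : Set (Tangent m)) ×ˢ Ioc s r,
          fderiv ℝ (fun z => φ z q.2) (0, q.1) (1, 0) * v (0, q.1) q.2 := by
  have i1 := integrableOn_halfSpace_prod_mul hL hφ.continuousOn hv.continuousOn_prodLaplacian hφL
  have i2 := integrableOn_halfSpace_prod_mul hL hφ.continuousOn_prodLaplacian hv.continuousOn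
    fun p hp τ => prodLaplacian_eq_zero_of_notMem hL.isClosed (fun z hz => hφL z hz τ) hp
  have i3 : IntegrableOn (fun q : Tangent m × ℝ =>
      fderiv ℝ (fun z => φ z q.2) (0, q.1) (1, 0) * v (0, q.1) q.2) (univ ×ˢ Ioc s r) := by
    refine (integrableOn_of_eq_zero_of_notMem (isClosed_univ.prod isClosed_Icc)
      ((hL.image continuous_snd).prod (isCompact_Icc (a := s) (b := r)))
      (((hφ.continuousOn_fderiv (1, 0)).mul
      hv.continuousOn).comp (f := fun q : Tangent m × ℝ => ((0, q.1), q.2)) (by fun_prop)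
      fun q hq => ⟨mk_mem_closedHalfSpace le_rfl q.1, hq.2⟩) fun q hq hqL => ?_).mono_set
      (prod_mono_right Ioc_subset_Icc_self)
    have hmem : (0, q.1) ∉ L := fun hmem => hqL ⟨⟨_, hmem, rfl⟩, hq.2⟩
    exact mul_eq_zero_of_left (fderiv_apply_eq_zero_of_notMem hL.isClosed
      (fun z hz => hφL z hz q.2) hmem (1, 0)) _
  rw [setIntegral_volume_prod_symm i1, setIntegral_volume_prod_symm i2,
    setIntegral_volume_prod_symm i3, ← integral_add]
  · refine setIntegral_congr_fun measurableSet_Ioc fun τ hτ => ?_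
    have hτ' := Ioc_subset_Icc_self hτ
    simpa only [Measure.restrict_univ] using integral_halfSpace_mul_prodLaplacian hL
      (fun p hp => hφ.contDiffAt p hp τ hτ') (fun p hp => hv.contDiffAt p hp τ hτ')
      (fun p hp => hφL p hp τ) (fun η => hφ0 η τ)
  · rw [IntegrableOn, volume_restrict_prod] at i2
    exact i2.integral_prod_right
  · rw [IntegrableOn, volume_restrict_prod] at i3
    exact i3.integral_prod_right

lemma heat_green_identity (hsr : s ≤ r) (hL : IsCompact L)
    (hφ : IsParabolicRegular (closedHalfSpace m) (Icc s r) φ)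
    (hv : IsParabolicRegular (closedHalfSpace m) (Icc s r) v) (hφL : ∀ p ∉ L, ∀ τ, φ p τ = 0)
    (hφ0 : ∀ η τ, φ (0, η) τ = 0) :
    (∫ p in halfSpace m, φ p r * v p r) - ∫ p in halfSpace m, φ p s * v p s =
      (∫ q in halfSpace m ×ˢ Ioc s r,
        (deriv (φ q.1) q.2 + prodLaplacian (fun z => φ z q.2) q.1) * v q.1 q.2) +
      (∫ q in halfSpace m ×ˢ Ioc s r,
        φ q.1 q.2 * (deriv (v q.1) q.2 - prodLaplacian (fun z => v z q.2) q.1)) +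
      ∫ q in (univ : Set (Tangent m)) ×ˢ Ioc s r,
        fderiv ℝ (fun z => φ z q.2) (0, q.1) (1, 0) * v (0, q.1) q.2 := by
  have dφL : ∀ p ∉ L, ∀ τ, deriv (φ p) τ = 0 := fun p hp τ => by
    simp [show φ p = fun _ => 0 from funext (hφL p hp)]
  have i1 := integrableOn_halfSpace_prod_mul hL hφ.continuousOn_deriv hv.continuousOn dφL
  have i2 := integrableOn_halfSpace_prod_mul hL hφ.continuousOn hv.continuousOn_deriv hφL
  have i3 := integrableOn_halfSpace_prod_mul hL hφ.continuousOn_prodLaplacian hv.continuousOn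
    fun p hp τ => prodLaplacian_eq_zero_of_notMem hL.isClosed (fun z hz => hφL z hz τ) hp
  have i4 := integrableOn_halfSpace_prod_mul hL hφ.continuousOn hv.continuousOn_prodLaplacian hφL
  have time : ∫ q in halfSpace m ×ˢ Ioc s r, deriv (fun τ => φ q.1 τ * v q.1 τ) q.2 =
      (∫ q in halfSpace m ×ˢ Ioc s r, deriv (φ q.1) q.2 * v q.1 q.2) +
        ∫ q in halfSpace m ×ˢ Ioc s r, φ q.1 q.2 * deriv (v q.1) q.2 := by
    rw [← integral_add i1 i2]
    refine setIntegral_congr_fun ((measurableSet_halfSpace m).prod measurableSet_Ioc)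
      fun q hq => ?_
    have hq1 := halfSpace_subset_closedHalfSpace m hq.1
    have hq2 := Ioc_subset_Icc_self hq.2
    exact deriv_fun_mul (hφ.differentiableAt _ hq1 _ hq2) (hv.differentiableAt _ hq1 _ hq2)
  rw [integral_halfSpace_sub_eq_integral_deriv hsr hL (hφ.mul hv) fun p hp τ => by
    rw [hφL p hp, zero_mul], time]
  simp only [add_mul, mul_sub]
  rw [integral_add i1 i3, integral_sub i2 i4,
    integral_slab_mul_prodLaplacian hL hφ hv hφL hφ0]
  ring

end GreenIdentity

section Cutoff

variable {E : Type*} [NormedAddCommGroup E] [NormedSpace ℝ E]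

/-- Smooth compactly supported cutoffs that increase to `1` so slowly that their derivatives tend
to zero uniformly. -/
structure IsCutoffSequence (χ : ℕ → E → ℝ) : Prop where
  contDiff : ∀ n, ContDiff ℝ 2 (χ n)
  hasCompactSupport : ∀ n, HasCompactSupport (χ n)
  abs_le_one : ∀ n z, |χ n z| ≤ 1
  tendsto_one : ∀ z, Tendsto (fun n => χ n z) atTop (𝓝 1)
  fderiv_bound : ∀ w, ∃ C, ∀ n z, |fderiv ℝ (χ n) z w| ≤ C / (n + 1)
  secondDeriv_bound : ∀ w, ∃ C, ∀ n z, |secondDeriv w (χ n) z| ≤ C / (n + 1)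

lemma fderiv_comp_smul_apply (f : E → ℝ) (c : ℝ) (w z : E) :
    fderiv ℝ (fun z' => f (c • z')) z w = c * fderiv ℝ f (c • z) w := by
  rw [fderiv_comp_smul]
  rfl

lemma secondDeriv_comp_smul (f : E → ℝ) (c : ℝ) (w z : E) :
    secondDeriv w (fun z' => f (c • z')) z = c ^ 2 * secondDeriv w f (c • z) := by
  have first : (fun z' => fderiv ℝ (fun z'' => f (c • z'')) z' w) =
      c • fun z' => fderiv ℝ f (c • z') w :=
    funext fun z' => fderiv_comp_smul_apply f c w z'
  rw [secondDeriv, first, fderiv_const_smul_field, Pi.smul_apply, smul_apply,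
    fderiv_comp_smul_apply (fun z' => fderiv ℝ f z' w), secondDeriv, smul_eq_mul]
  ring

lemma exists_isCutoffSequence [FiniteDimensional ℝ E] : ∃ χ : ℕ → E → ℝ, IsCutoffSequence χ := by
  let θ : ContDiffBump (0 : E) := ⟨1, 2, one_pos, one_lt_two⟩
  let c : ℕ → ℝ := fun n => (n + 1 : ℝ)⁻¹
  have c_pos (n : ℕ) : 0 < c n := inv_pos.2 n.cast_add_one_pos
  have c_le_one (n : ℕ) : c n ≤ 1 := inv_le_one_of_one_le₀ (by simp)
  have hc : Tendsto c atTop (𝓝 0) := by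
    simpa only [one_div] using tendsto_one_div_add_atTop_nhds_zero_nat (𝕜 := ℝ)
  have hθ : ContDiff ℝ 2 θ := θ.contDiff
  refine ⟨fun n z => θ (c n • z), fun n => hθ.comp (contDiff_const_smul _),
    fun n => θ.hasCompactSupport.comp_smul (c_pos n).ne',
    fun n z => abs_le.2 ⟨by linarith [θ.nonneg' (c n • z)], θ.le_one⟩,
    fun z => ?_, fun w => ?_, fun w => ?_⟩
  · have := (θ.continuous.tendsto ((0 : ℝ) • z)).comp (hc.smul_const z)
    rwa [zero_smul, θ.one_of_mem_closedBall (Metric.mem_closedBall_self θ.rIn_pos.le)] at this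
  · obtain ⟨C, hC⟩ := (θ.hasCompactSupport.fderiv_apply ℝ w).exists_bound_of_continuous
      ((hθ.continuous_fderiv (by norm_num)).clm_apply continuous_const)
    refine ⟨C, fun n z => ?_⟩
    rw [fderiv_comp_smul_apply, abs_mul, abs_of_pos (c_pos n), div_eq_inv_mul]
    exact mul_le_mul_of_nonneg_left (hC _) (c_pos n).le
  · obtain ⟨C, hC⟩ := ((θ.hasCompactSupport.fderiv_apply ℝ w).fderiv_apply ℝ w
      ).exists_bound_of_continuous (continuous_iff_continuousAt.2 fun z =>
        continuousAt_secondDeriv (hθ.contDiffAt (x := z)) w)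
    refine ⟨C, fun n z => ?_⟩
    rw [secondDeriv_comp_smul, abs_mul, abs_of_nonneg (sq_nonneg _), div_eq_inv_mul]
    exact mul_le_mul (pow_le_of_le_one (c_pos n).le (c_le_one n) two_ne_zero) (hC _)
      (abs_nonneg _) (c_pos n).le

end Cutoff

section CutoffLimit

variable {X : Type*} [MeasurableSpace X] {μ : Measure X} {g : X → ℝ} {b : ℕ → X → ℝ}

lemma tendsto_integral_mul_of_bounded {b' : X → ℝ} {C : ℝ} (hg : Integrable g μ)
    (hb : ∀ n, AEStronglyMeasurable (b n) μ) (hbC : ∀ n x, |b n x| ≤ C)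
    (hlim : ∀ x, Tendsto (fun n => b n x) atTop (𝓝 (b' x))) :
    Tendsto (fun n => ∫ x, b n x * g x ∂μ) atTop (𝓝 (∫ x, b' x * g x ∂μ)) := by
  refine tendsto_integral_of_dominated_convergence (fun x => C * |g x|)
    (fun n => (hb n).mul hg.aestronglyMeasurable) (hg.abs.const_mul C)
    (fun n => ae_of_all _ fun x => ?_) (ae_of_all _ fun x => (hlim x).mul_const _)
  rw [norm_mul]
  exact mul_le_mul_of_nonneg_right (hbC n x) (abs_nonneg _)

lemma tendsto_integral_mul_of_decay {C : ℝ} (hg : Integrable g μ)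
    (hb : ∀ n, AEStronglyMeasurable (b n) μ) (hbC : ∀ n x, |b n x| ≤ C / (n + 1)) :
    Tendsto (fun n => ∫ x, b n x * g x ∂μ) atTop (𝓝 0) := by
  have decay (x : X) : Tendsto (fun n => b n x) atTop (𝓝 0) :=
    squeeze_zero_norm (hbC · x) ((tendsto_natCast_atTop_atTop.atTop_add
      tendsto_const_nhds).const_div_atTop C)
  have bound (n : ℕ) (x : X) : |b n x| ≤ C := (hbC n x).trans
    (div_le_self (by simpa using (abs_nonneg _).trans (hbC 0 x)) (by simp))
  simpa using tendsto_integral_mul_of_bounded hg hb bound decay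

end CutoffLimit

section CutoffRemoval

variable {m : ℕ} {s r : ℝ} {K v : ℝ × Tangent m → ℝ → ℝ} {χ : ℕ → ℝ × Tangent m → ℝ}

lemma IsCutoffSequence.tendsto_commutator (hχ : IsCutoffSequence χ)
    (hKv : IntegrableOn (fun q : (ℝ × Tangent m) × ℝ => K q.1 q.2 * v q.1 q.2)
      (halfSpace m ×ˢ Ioc s r))
    (hdKv : ∀ i, IntegrableOn (fun q : (ℝ × Tangent m) × ℝ =>
      fderiv ℝ (fun z => K z q.2) q.1 (coordDir i) * v q.1 q.2) (halfSpace m ×ˢ Ioc s r)) :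
    Tendsto (fun n => ∫ q in halfSpace m ×ˢ Ioc s r,
      (prodLaplacian (χ n) q.1 * K q.1 q.2 + 2 * ∑ i,
        fderiv ℝ (χ n) q.1 (coordDir i) *
          fderiv ℝ (fun z => K z q.2) q.1 (coordDir i)) * v q.1 q.2) atTop (𝓝 0) := by
  have cont_first (n : ℕ) (i) : Continuous fun q : (ℝ × Tangent m) × ℝ =>
      fderiv ℝ (χ n) q.1 (coordDir i) :=
    (((hχ.contDiff n).continuous_fderiv (by norm_num)).clm_apply continuous_const).comp
      continuous_fst
  have cont_second (n : ℕ) (i) : Continuous fun q : (ℝ × Tangent m) × ℝ =>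
      secondDeriv (coordDir i) (χ n) q.1 :=
    (continuous_iff_continuousAt.2 fun z =>
      continuousAt_secondDeriv ((hχ.contDiff n).contDiffAt (x := z)) (coordDir i)).comp
      continuous_fst
  choose C hC using fun i => hχ.fderiv_bound (coordDir (m := m) i)
  choose D hD using fun i => hχ.secondDeriv_bound (coordDir (m := m) i)
  have i1 (n : ℕ) (i) := (hdKv i).bdd_mul (cont_first n i).aestronglyMeasurable
    (ae_of_all _ fun q => hC i n q.1)
  have i2 (n : ℕ) (i) := hKv.bdd_mul (cont_second n i).aestronglyMeasurable
    (ae_of_all _ fun q => hD i n q.1)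
  have limit := (tendsto_finsetSum Finset.univ fun i _ =>
    tendsto_integral_mul_of_decay hKv (fun n => (cont_second n i).aestronglyMeasurable)
      fun n q => hD i n q.1).add
    (tendsto_finsetSum Finset.univ fun i _ =>
      (tendsto_integral_mul_of_decay (hdKv i) (fun n => (cont_first n i).aestronglyMeasurable)
        fun n q => hC i n q.1).const_mul 2)
  simp only [mul_zero, Finset.sum_const_zero, add_zero] at limit
  refine limit.congr fun n => ?_
  simp only [← integral_const_mul]
  rw [← integral_finsetSum _ fun i _ => i2 n i,
    ← integral_finsetSum _ fun i _ => (i1 n i).const_mul 2,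
    ← integral_add (integrable_finsetSum _ fun i _ => i2 n i)
      (integrable_finsetSum _ fun i _ => (i1 n i).const_mul 2)]
  refine integral_congr_ae (ae_of_all _ fun q => ?_)
  simp only [prodLaplacian, add_mul, Finset.mul_sum, Finset.sum_mul, mul_assoc]

lemma IsCutoffSequence.heat_green_identity (hχ : IsCutoffSequence χ) (hsr : s ≤ r)
    (hK : IsParabolicRegular (closedHalfSpace m) (Icc s r) K)
    (hv : IsParabolicRegular (closedHalfSpace m) (Icc s r) v)
    (hheat : ∀ p ∈ closedHalfSpace m, ∀ τ ∈ Icc s r,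
      deriv (K p) τ + prodLaplacian (fun z => K z τ) p = 0)
    (hK0 : ∀ η τ, K (0, η) τ = 0) (n : ℕ) :
    (∫ p in halfSpace m, χ n p * (K p r * v p r)) -
        ∫ p in halfSpace m, χ n p * (K p s * v p s) =
      (∫ q in halfSpace m ×ˢ Ioc s r,
        (prodLaplacian (χ n) q.1 * K q.1 q.2 + 2 * ∑ i,
          fderiv ℝ (χ n) q.1 (coordDir i) *
            fderiv ℝ (fun z => K z q.2) q.1 (coordDir i)) * v q.1 q.2) +
      (∫ q in halfSpace m ×ˢ Ioc s r,
        χ n q.1 * (K q.1 q.2 * (deriv (v q.1) q.2 - prodLaplacian (fun z => v z q.2) q.1))) +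
      ∫ q in (univ : Set (Tangent m)) ×ˢ Ioc s r,
        χ n (0, q.1) * (fderiv ℝ (fun z => K z q.2) (0, q.1) (1, 0) * v (0, q.1) q.2) := by
  have hχn : ContDiff ℝ 2 (χ n) := hχ.contDiff n
  have hgreen := HalfSpaceHeat.heat_green_identity hsr (hχ.hasCompactSupport n)
    ((IsParabolicRegular.of_contDiff hχn).mul hK) hv
    (fun p hp τ => by rw [image_eq_zero_of_notMem_tsupport hp, zero_mul])
    (fun η τ => by rw [hK0, mul_zero])
  have interior : EqOn (fun q : (ℝ × Tangent m) × ℝ => (deriv (fun τ => χ n q.1 * K q.1 τ) q.2 +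
      prodLaplacian (fun z => χ n z * K z q.2) q.1) * v q.1 q.2) (fun q =>
      (prodLaplacian (χ n) q.1 * K q.1 q.2 + 2 * ∑ i,
        fderiv ℝ (χ n) q.1 (coordDir i) *
          fderiv ℝ (fun z => K z q.2) q.1 (coordDir i)) * v q.1 q.2) (halfSpace m ×ˢ Ioc s r) :=
    fun q hq => by
      have hq1 := halfSpace_subset_closedHalfSpace m hq.1
      have hq2 := Ioc_subset_Icc_self hq.2
      simp only [deriv_const_mul_field,
        prodLaplacian_mul hχn.contDiffAt (hK.contDiffAt _ hq1 _ hq2)]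
      linear_combination χ n q.1 * v q.1 q.2 * hheat q.1 hq1 q.2 hq2
  have boundary : EqOn (fun q : Tangent m × ℝ =>
      fderiv ℝ (fun z => χ n z * K z q.2) (0, q.1) (1, 0) * v (0, q.1) q.2)
      (fun q => χ n (0, q.1) * (fderiv ℝ (fun z => K z q.2) (0, q.1) (1, 0) * v (0, q.1) q.2))
      (univ ×ˢ Ioc s r) := fun q hq => by
    dsimp only
    rw [fderiv_fun_mul (hχn.differentiable (by norm_num) _)
      ((hK.contDiffAt _ (mk_mem_closedHalfSpace le_rfl q.1) _
        (Ioc_subset_Icc_self hq.2)).differentiableAt (by norm_num)), hK0, zero_smul, add_zero,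
      smul_apply, smul_eq_mul, mul_assoc]
  rw [setIntegral_congr_fun ((measurableSet_halfSpace m).prod measurableSet_Ioc) interior,
    setIntegral_congr_fun (MeasurableSet.univ.prod measurableSet_Ioc) boundary] at hgreen
  simpa only [mul_assoc] using hgreen

lemma heat_green_identity_of_integrableOn (hsr : s ≤ r)
    (hK : IsParabolicRegular (closedHalfSpace m) (Icc s r) K)
    (hv : IsParabolicRegular (closedHalfSpace m) (Icc s r) v)
    (hheat : ∀ p ∈ closedHalfSpace m, ∀ τ ∈ Icc s r,
      deriv (K p) τ + prodLaplacian (fun z => K z τ) p = 0)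
    (hK0 : ∀ η τ, K (0, η) τ = 0)
    (hs : IntegrableOn (fun p => K p s * v p s) (halfSpace m))
    (hr : IntegrableOn (fun p => K p r * v p r) (halfSpace m))
    (hKv : IntegrableOn (fun q : (ℝ × Tangent m) × ℝ => K q.1 q.2 * v q.1 q.2)
      (halfSpace m ×ˢ Ioc s r))
    (hdKv : ∀ i, IntegrableOn (fun q : (ℝ × Tangent m) × ℝ =>
      fderiv ℝ (fun z => K z q.2) q.1 (coordDir i) * v q.1 q.2) (halfSpace m ×ˢ Ioc s r))
    (hsource : IntegrableOn (fun q : (ℝ × Tangent m) × ℝ =>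
      K q.1 q.2 * (deriv (v q.1) q.2 - prodLaplacian (fun z => v z q.2) q.1))
      (halfSpace m ×ˢ Ioc s r))
    (hboundary : IntegrableOn (fun q : Tangent m × ℝ =>
      fderiv ℝ (fun z => K z q.2) (0, q.1) (1, 0) * v (0, q.1) q.2) (univ ×ˢ Ioc s r)) :
    (∫ p in halfSpace m, K p r * v p r) - ∫ p in halfSpace m, K p s * v p s =
      (∫ q in halfSpace m ×ˢ Ioc s r,
        K q.1 q.2 * (deriv (v q.1) q.2 - prodLaplacian (fun z => v z q.2) q.1)) +
      ∫ q in (univ : Set (Tangent m)) ×ˢ Ioc s r,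
        fderiv ℝ (fun z => K z q.2) (0, q.1) (1, 0) * v (0, q.1) q.2 := by
  obtain ⟨χ, hχ⟩ := exists_isCutoffSequence (E := ℝ × Tangent m)
  have remove {Y : Type} [TopologicalSpace Y] [MeasurableSpace Y] [BorelSpace Y] {μ : Measure Y}
      {g : Y → ℝ} (hg : Integrable g μ) {π : Y → ℝ × Tangent m} (hπ : Continuous π) :
      Tendsto (fun n => ∫ x, χ n (π x) * g x ∂μ) atTop (𝓝 (∫ x, g x ∂μ)) := by
    simpa only [one_mul, Function.comp] using tendsto_integral_mul_of_bounded hg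
      (fun n => ((hχ.contDiff n).continuous.comp hπ).aestronglyMeasurable)
      (fun n x => hχ.abs_le_one n (π x)) fun x => hχ.tendsto_one (π x)
  have rhs := ((hχ.tendsto_commutator hKv hdKv).add (remove hsource continuous_fst)).add
    (remove hboundary (π := fun q => (0, q.1)) (by fun_prop))
  simp only [← hχ.heat_green_identity hsr hK hv hheat hK0] at rhs
  have lhs := (remove hr continuous_id).sub (remove hs continuous_id)
  simpa only [zero_add] using tendsto_nhds_unique lhs rhs

end CutoffRemoval

section HeatKernel

variable {E G : Type*} [NormedAddCommGroup E] [InnerProductSpace ℝ E] [NormedAddCommGroup G]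
  [NormedSpace ℝ G]

/-- The heat kernel of a finite-dimensional inner product space at time `σ > 0`. -/
def heatKernel (z : E) (σ : ℝ) : ℝ :=
  Real.exp (-‖z‖ ^ 2 / (4 * σ)) / (2 * √(Real.pi * σ)) ^ Module.finrank ℝ E

lemma two_mul_sqrt_pi_mul_pos {σ : ℝ} (hσ : 0 < σ) : 0 < 2 * √(Real.pi * σ) :=
  mul_pos two_pos (Real.sqrt_pos.2 (mul_pos Real.pi_pos hσ))

lemma heatKernel_nonneg (z : E) (σ : ℝ) : 0 ≤ heatKernel z σ := by
  unfold heatKernel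
  positivity

lemma heatKernel_neg (z : E) (σ : ℝ) : heatKernel (-z) σ = heatKernel z σ := by
  simp only [heatKernel, norm_neg]

lemma contDiff_heatKernel (σ : ℝ) : ContDiff ℝ 2 fun z : E => heatKernel z σ :=
  ((contDiff_norm_sq ℝ).neg.div_const _).exp.div_const _

lemma hasFDerivAt_heatKernel (z : E) (σ : ℝ) :
    HasFDerivAt (fun z => heatKernel z σ) (-(heatKernel z σ / (2 * σ)) • innerSL ℝ z) z := by
  have h := ((hasFDerivAt_id z).norm_sq.neg.mul_const (4 * σ)⁻¹).exp.mul_const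
    ((2 * √(Real.pi * σ)) ^ Module.finrank ℝ E)⁻¹
  simp only [← div_eq_mul_inv] at h
  refine h.congr_fderiv ?_
  ext w
  simp only [heatKernel, id, Pi.neg_apply, ContinuousLinearMap.comp_id, smul_apply, neg_apply,
    smul_eq_mul, coe_innerSL_apply]
  ring

lemma fderiv_heatKernel (z e : E) (σ : ℝ) :
    fderiv ℝ (fun z => heatKernel z σ) z e = -(heatKernel z σ / (2 * σ)) * inner ℝ z e := by
  rw [(hasFDerivAt_heatKernel z σ).fderiv]
  rfl

lemma secondDeriv_heatKernel (z e : E) (σ : ℝ) :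
    secondDeriv e (fun z => heatKernel z σ) z =
      (inner ℝ z e ^ 2 / (4 * σ ^ 2) - ‖e‖ ^ 2 / (2 * σ)) * heatKernel z σ := by
  have h := (((hasFDerivAt_heatKernel z σ).mul_const (2 * σ)⁻¹).fun_neg).fun_mul
    ((hasFDerivAt_id z).inner ℝ (hasFDerivAt_const e z))
  simp only [← div_eq_mul_inv, id] at h
  simp only [secondDeriv, fderiv_heatKernel, h.fderiv]
  simp only [neg_smul, mul_inv_rev, smul_neg, neg_neg, add_apply, neg_apply, smul_apply,
    ContinuousLinearMap.comp_apply, ContinuousLinearMap.prod_apply,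
    ContinuousLinearMap.id_apply, zero_apply, fderivInnerCLM_apply, inner_zero_right,
    inner_self_eq_norm_sq_to_K, Real.ringHom_apply, zero_add, smul_eq_mul, coe_innerSL_apply]
  ring

lemma hasDerivAt_two_mul_sqrt_pi_mul {σ : ℝ} (hσ : 0 < σ) :
    HasDerivAt (fun σ => 2 * √(Real.pi * σ)) ((2 * √(Real.pi * σ)) / (2 * σ)) σ := by
  have hpos : 0 < Real.pi * σ := mul_pos Real.pi_pos hσ
  refine ((((hasDerivAt_id σ).const_mul Real.pi).sqrt hpos.ne').const_mul 2).congr_deriv ?_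
  have := Real.sqrt_pos.2 hpos
  simp only [id]
  field_simp
  rw [Real.sq_sqrt hpos.le]

lemma hasDerivAt_heatKernel_time (z : E) {σ : ℝ} (hσ : 0 < σ) :
    HasDerivAt (fun σ => heatKernel z σ)
      ((‖z‖ ^ 2 / (4 * σ ^ 2) - Module.finrank ℝ E / (2 * σ)) * heatKernel z σ) σ := by
  have hS := two_mul_sqrt_pi_mul_pos hσ
  have exponent : HasDerivAt (fun σ : ℝ => -‖z‖ ^ 2 / (4 * σ)) (‖z‖ ^ 2 / (4 * σ ^ 2)) σ := by
    refine ((hasDerivAt_const σ (-‖z‖ ^ 2)).fun_div ((hasDerivAt_id σ).const_mul 4)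
      (by positivity)).congr_deriv ?_
    simp only [id]
    field_simp
    ring
  refine (exponent.exp.fun_div ((hasDerivAt_two_mul_sqrt_pi_mul hσ).fun_pow
    (Module.finrank ℝ E)) (pow_pos hS _).ne').congr_deriv ?_
  unfold heatKernel
  generalize Module.finrank ℝ E = d
  generalize 2 * √(Real.pi * σ) = S at hS
  cases d <;> push_cast <;> field_simp <;> ring

lemma continuousOn_heatKernel :
    ContinuousOn (fun q : E × ℝ => heatKernel q.1 q.2) {q | 0 < q.2} := by
  refine ContinuousOn.div (ContinuousOn.rexp (ContinuousOn.div (by fun_prop) (by fun_prop) ?_))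
    (by fun_prop) ?_
  · exact fun q hq => (mul_pos four_pos hq).ne'
  · exact fun q hq => (pow_pos (two_mul_sqrt_pi_mul_pos hq) _).ne'

lemma isParabolicRegular_heatKernel_comp (c : E) (A : G →L[ℝ] E) (t : ℝ) :
    IsParabolicRegular univ (Iio t) fun p τ => heatKernel (c + A p) (t - τ) := by
  have hkernel : ContinuousOn (fun q : G × ℝ => heatKernel (c + A q.1) (t - q.2))
      (univ ×ˢ Iio t) :=
    continuousOn_heatKernel.comp (f := fun q : G × ℝ => (c + A q.1, t - q.2)) (by fun_prop)
      fun q hq => sub_pos.2 (mem_Iio.1 hq.2)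
  have hσ : ∀ q ∈ (univ : Set G) ×ˢ Iio t, t - q.2 ≠ 0 := fun q hq => (sub_pos.2 hq.2).ne'
  have htime (p : G) {τ : ℝ} (hτ : τ < t) := (hasDerivAt_heatKernel_time (c + A p)
    (sub_pos.2 hτ)).comp_const_sub t τ
  refine ⟨fun p _ τ _ => ?_, fun p _ τ hτ => (htime p hτ).differentiableAt, hkernel,
    fun e => ?_, fun e => ?_, ?_⟩
  · exact ((contDiff_heatKernel (t - τ)).comp (contDiff_const.add A.contDiff)).contDiffAt
  · refine ContinuousOn.congr (f := fun q : G × ℝ => -(heatKernel (c + A q.1) (t - q.2) /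
      (2 * (t - q.2))) * inner ℝ (c + A q.1) (A e)) ?_ fun q _ => ?_
    · exact (hkernel.div (by fun_prop) fun q hq => mul_ne_zero two_ne_zero (hσ q hq)).neg.mul
        (by fun_prop)
    · rw [fderiv_comp_affine (hasFDerivAt_heatKernel _ _).differentiableAt, fderiv_heatKernel]
  · refine ContinuousOn.congr (f := fun q : G × ℝ => (inner ℝ (c + A q.1) (A e) ^ 2 /
      (4 * (t - q.2) ^ 2) - ‖A e‖ ^ 2 / (2 * (t - q.2))) * heatKernel (c + A q.1) (t - q.2)) ?_
      fun q _ => ?_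
    · refine ((ContinuousOn.div (by fun_prop) (by fun_prop) fun q hq => ?_).sub
        (ContinuousOn.div (by fun_prop) (by fun_prop) fun q hq => ?_)).mul hkernel
      · exact mul_ne_zero four_ne_zero (pow_ne_zero 2 (hσ q hq))
      · exact mul_ne_zero two_ne_zero (hσ q hq)
    · rw [secondDeriv_comp_affine (f := fun z => heatKernel z (t - q.2))
        (contDiff_heatKernel _).contDiffAt, secondDeriv_heatKernel]
  · refine ContinuousOn.congr (f := fun q : G × ℝ => -((‖c + A q.1‖ ^ 2 / (4 * (t - q.2) ^ 2) -
      Module.finrank ℝ E / (2 * (t - q.2))) * heatKernel (c + A q.1) (t - q.2))) ?_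
      fun q hq => (htime q.1 hq.2).deriv
    refine (((ContinuousOn.div (by fun_prop) (by fun_prop) fun q hq => ?_).sub
      (ContinuousOn.div (by fun_prop) (by fun_prop) fun q hq => ?_)).mul hkernel).neg
    · exact mul_ne_zero four_ne_zero (pow_ne_zero 2 (hσ q hq))
    · exact mul_ne_zero two_ne_zero (hσ q hq)

end HeatKernel

section GreenFunction

variable {m : ℕ}

/-- The heat kernel of `ℝ × ℝ^m`, computed with the Euclidean norm instead of the supremum norm that
the product carries. -/
def spaceKernel (z : ℝ × Tangent m) (σ : ℝ) : ℝ := heatKernel (WithLp.toLp 2 z) σ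

lemma norm_toLp_sq (z : ℝ × Tangent m) : ‖WithLp.toLp 2 z‖ ^ 2 = z.1 ^ 2 + ‖z.2‖ ^ 2 := by
  simp [WithLp.prod_norm_sq_eq_of_L2]

lemma finrank_withLp_prod : Module.finrank ℝ (WithLp 2 (ℝ × Tangent m)) = m + 1 := by
  rw [(WithLp.linearEquiv 2 ℝ (ℝ × Tangent m)).finrank_eq, Module.finrank_prod,
    Module.finrank_self, finrank_euclideanSpace_fin, add_comm]

lemma spaceKernel_eq_mul (z : ℝ × Tangent m) (σ : ℝ) :
    spaceKernel z σ = heatKernel z.1 σ * heatKernel z.2 σ := by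
  simp only [spaceKernel, heatKernel, norm_toLp_sq, finrank_withLp_prod, Module.finrank_self,
    finrank_euclideanSpace_fin, Real.norm_eq_abs, sq_abs]
  rw [neg_add, add_div, Real.exp_add]
  ring

lemma greenLine_eq_heatKernel_sub (x t ξ τ : ℝ) :
    greenLine x t ξ τ = heatKernel (x - ξ) (t - τ) - heatKernel (x + ξ) (t - τ) := by
  simp only [greenLine, heatKernel, Module.finrank_self, pow_one, Real.norm_eq_abs, sq_abs, sub_div]

lemma green_eq_mul_greenLine (x : ℝ) (y : Tangent m) (t ξ : ℝ) (η : Tangent m) (τ : ℝ) :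
    green x y t ξ η τ = heatKernel (y - η) (t - τ) * greenLine x t ξ τ := by
  simp only [green, heatKernel, finrank_euclideanSpace_fin]

/-- The map `(ξ, η) ↦ (ε ξ, -η)`. Added to a point `P`, it gives the displacement to `P` from
`(ξ, η)` if `ε = -1` and from the mirror image `(-ξ, η)` if `ε = 1`. -/
def imageMap (ε : ℝ) : ℝ × Tangent m →L[ℝ] ℝ × Tangent m :=
  (ε • ContinuousLinearMap.fst ℝ ℝ (Tangent m)).prod (-ContinuousLinearMap.snd ℝ ℝ (Tangent m))

lemma imageMap_apply (ε : ℝ) (p : ℝ × Tangent m) : imageMap ε p = (ε * p.1, -p.2) := rfl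

lemma green_eq_spaceKernel_sub (P : ℝ × Tangent m) (t : ℝ) (p : ℝ × Tangent m) (τ : ℝ) :
    green P.1 P.2 t p.1 p.2 τ =
      spaceKernel (P + imageMap (-1) p) (t - τ) - spaceKernel (P + imageMap 1 p) (t - τ) := by
  simp only [green_eq_mul_greenLine, greenLine_eq_heatKernel_sub, spaceKernel_eq_mul,
    imageMap_apply, Prod.fst_add, Prod.snd_add, ← sub_eq_add_neg, neg_one_mul, one_mul]
  ring

/-- The identification of `ℝ × ℝ^m` with the corresponding Euclidean space. -/
def toEuclidean : ℝ × Tangent m →L[ℝ] WithLp 2 (ℝ × Tangent m) :=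
  ((WithLp.prodContinuousLinearEquiv 2 ℝ ℝ (Tangent m)).symm : _ →L[ℝ] _)

lemma toEuclidean_apply (z : ℝ × Tangent m) : toEuclidean z = WithLp.toLp 2 z := rfl

lemma spaceKernel_add_imageMap (P : ℝ × Tangent m) (ε : ℝ) (p : ℝ × Tangent m) (σ : ℝ) :
    spaceKernel (P + imageMap ε p) σ =
      heatKernel (toEuclidean P + (toEuclidean ∘L imageMap ε) p) σ := rfl

lemma isParabolicRegular_spaceKernel (P : ℝ × Tangent m) (ε t : ℝ) :
    IsParabolicRegular univ (Iio t) fun p τ => spaceKernel (P + imageMap ε p) (t - τ) :=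
  isParabolicRegular_heatKernel_comp (toEuclidean P) (toEuclidean ∘L imageMap ε) t

lemma isParabolicRegular_green (P : ℝ × Tangent m) (t : ℝ) :
    IsParabolicRegular univ (Iio t) fun (p : ℝ × Tangent m) τ => green P.1 P.2 t p.1 p.2 τ := by
  simp only [green_eq_spaceKernel_sub]
  exact (isParabolicRegular_spaceKernel P (-1) t).sub (isParabolicRegular_spaceKernel P 1 t)

lemma sum_inner_imageMap_coordDir_sq (z : ℝ × Tangent m) {ε : ℝ} (hε : ε ^ 2 = 1) :
    ∑ i, inner ℝ (toEuclidean z) (toEuclidean (imageMap ε (coordDir i))) ^ 2 =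
      ‖toEuclidean z‖ ^ 2 := by
  have parseval := (EuclideanSpace.basisFun (Fin m) ℝ).sum_sq_norm_inner_left z.2
  simp only [Real.norm_eq_abs, sq_abs, EuclideanSpace.basisFun_apply] at parseval
  simp [toEuclidean_apply, norm_toLp_sq, coordDir, imageMap_apply, mul_pow, hε, parseval]

lemma norm_imageMap_coordDir_sq {ε : ℝ} (hε : ε ^ 2 = 1) (i : Option (Fin m)) :
    ‖toEuclidean (imageMap ε (coordDir i))‖ ^ 2 = 1 := by
  cases i <;> simp [toEuclidean_apply, coordDir, imageMap_apply, hε]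

lemma deriv_spaceKernel_add_prodLaplacian (P p : ℝ × Tangent m) {ε t τ : ℝ} (hε : ε ^ 2 = 1)
    (hτ : τ < t) :
    deriv (fun τ' => spaceKernel (P + imageMap ε p) (t - τ')) τ +
      prodLaplacian (fun z => spaceKernel (P + imageMap ε z) (t - τ)) p = 0 := by
  have space (i : Option (Fin m)) :
      secondDeriv (coordDir i) (fun z => spaceKernel (P + imageMap ε z) (t - τ)) p =
        (inner ℝ (toEuclidean (P + imageMap ε p)) (toEuclidean (imageMap ε (coordDir i))) ^ 2 /
          (4 * (t - τ) ^ 2) - 1 / (2 * (t - τ))) * spaceKernel (P + imageMap ε p) (t - τ) := by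
    simp only [spaceKernel_add_imageMap]
    rw [secondDeriv_comp_affine (f := fun z => heatKernel z (t - τ))
      (contDiff_heatKernel _).contDiffAt, secondDeriv_heatKernel, ContinuousLinearMap.comp_apply,
      ContinuousLinearMap.comp_apply, norm_imageMap_coordDir_sq hε, map_add]
  have time := ((hasDerivAt_heatKernel_time (toEuclidean (P + imageMap ε p))
    (sub_pos.2 hτ)).comp_const_sub t τ).deriv
  have sum : ∑ i : Option (Fin m), (inner ℝ (toEuclidean (P + imageMap ε p))
      (toEuclidean (imageMap ε (coordDir i))) ^ 2 / (4 * (t - τ) ^ 2) - 1 / (2 * (t - τ))) =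
      ‖toEuclidean (P + imageMap ε p)‖ ^ 2 / (4 * (t - τ) ^ 2) - (m + 1 : ℕ) / (2 * (t - τ)) := by
    rw [Finset.sum_sub_distrib, ← Finset.sum_div, sum_inner_imageMap_coordDir_sq _ hε]
    simp [div_eq_mul_inv]
  rw [prodLaplacian, Finset.sum_congr rfl fun i _ => space i, ← Finset.sum_mul, sum]
  rw [finrank_withLp_prod] at time
  exact (congrArg (· + _) time).trans (neg_add_cancel _)

lemma deriv_green_add_prodLaplacian (P p : ℝ × Tangent m) {t τ : ℝ} (hτ : τ < t) :
    deriv (green P.1 P.2 t p.1 p.2) τ +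
      prodLaplacian (fun z => green P.1 P.2 t z.1 z.2 τ) p = 0 := by
  have hreg (ε : ℝ) := isParabolicRegular_spaceKernel P ε t
  have time : deriv (green P.1 P.2 t p.1 p.2) τ = _ :=
    (congrArg (deriv · τ) (funext (green_eq_spaceKernel_sub P t p))).trans (deriv_fun_sub
      ((hreg (-1)).differentiableAt p (mem_univ p) τ hτ)
      ((hreg 1).differentiableAt p (mem_univ p) τ hτ))
  have space : prodLaplacian (fun z => green P.1 P.2 t z.1 z.2 τ) p =
      prodLaplacian (fun z => spaceKernel (P + imageMap (-1) z) (t - τ)) p -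
        prodLaplacian (fun z => spaceKernel (P + imageMap 1 z) (t - τ)) p := by
    simp only [green_eq_spaceKernel_sub, prodLaplacian, ← Finset.sum_sub_distrib]
    exact Finset.sum_congr rfl fun i _ => secondDeriv_sub
      ((hreg (-1)).contDiffAt p (mem_univ p) τ hτ) ((hreg 1).contDiffAt p (mem_univ p) τ hτ) _
  rw [time, space]
  linarith [deriv_spaceKernel_add_prodLaplacian P p (neg_one_sq (R := ℝ)) hτ,
    deriv_spaceKernel_add_prodLaplacian P p (one_pow (M := ℝ) 2) hτ]

lemma green_zero_right (P : ℝ × Tangent m) (t : ℝ) (η : Tangent m) (τ : ℝ) :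
    green P.1 P.2 t 0 η τ = 0 := by simp [green, greenLine]

end GreenFunction

section HeatSolution

variable {m : ℕ} {h : ℝ → Tangent m → ℝ} {f : Tangent m → ℝ → ℝ} {u : ℝ → Tangent m → ℝ → ℝ}

/-- `u` is a classical solution of the linear problem `u_t - Δu = -f(y, t)` in the half-space with
`u(0, y, t) = 0` and `u(x, y, t) → h(x, y)` as `t → 0⁺`. Nothing is assumed about the derivatives of
`u` at the boundary. -/
structure IsHeatSolution (f : Tangent m → ℝ → ℝ) (h : ℝ → Tangent m → ℝ)
    (u : ℝ → Tangent m → ℝ → ℝ) : Prop where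
  continuousOn : ContinuousOn (fun q : ℝ × Tangent m × ℝ => u q.1 q.2.1 q.2.2)
    {q | 0 ≤ q.1 ∧ 0 < q.2.2}
  contDiffOn_space : ∀ t : ℝ, 0 < t →
    ContDiffOn ℝ 2 (fun p : ℝ × Tangent m => u p.1 p.2 t) (halfSpace m)
  continuousOn_space_deriv : ∀ k : ℕ, k ≤ 2 →
    ContinuousOn (fun q : ℝ × Tangent m × ℝ =>
      iteratedFDeriv ℝ k (fun p : ℝ × Tangent m => u p.1 p.2 q.2.2) (q.1, q.2.1))
      {q | 0 < q.1 ∧ 0 < q.2.2}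
  differentiableAt_time : ∀ (x : ℝ) (y : Tangent m) (t : ℝ), 0 < x → 0 < t →
    DifferentiableAt ℝ (fun t' : ℝ => u x y t') t
  continuousOn_time_deriv :
    ContinuousOn (fun q : ℝ × Tangent m × ℝ => deriv (fun t' : ℝ => u q.1 q.2.1 t') q.2.2)
      {q | 0 < q.1 ∧ 0 < q.2.2}
  equation : ∀ (x : ℝ) (y : Tangent m) (t : ℝ), 0 < x → 0 < t →
    deriv (fun t' : ℝ => u x y t') t - spaceLaplacian u x y t = -f y t
  boundary : ∀ (y : Tangent m) (t : ℝ), 0 < t → u 0 y t = 0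
  initial_tendsto : ∀ (x : ℝ) (y : Tangent m), 0 < x →
    Tendsto (fun t : ℝ => u x y t) (𝓝[>] 0) (𝓝 (h x y))

lemma IsClassicalSolution.isHeatSolution {F : ℝ → ℝ} (hu : IsClassicalSolution F h u) :
    IsHeatSolution (source F (boundaryFlux u)) h u where
  __ := hu

/-- On bounded time intervals the source `f` and the solution `u` grow more slowly than every
Gaussian, `f` with a factor that is integrable down to `t = 0`. -/
structure IsSubGaussian (f : Tangent m → ℝ → ℝ) (u : ℝ → Tangent m → ℝ → ℝ) : Prop where
  solution_bound : ∀ T > (0 : ℝ), ∀ a > (0 : ℝ), ∃ A : ℝ,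
    ∀ (x : ℝ) (y : Tangent m) (t : ℝ), 0 < x → 0 < t → t ≤ T →
      |u x y t| ≤ A * Real.exp (a * (x ^ 2 + ‖y‖ ^ 2))
  source_bound : ∀ T > (0 : ℝ), ∀ a > (0 : ℝ), ∃ g : ℝ → ℝ,
    IntegrableOn g (Ioc 0 T) ∧ (∀ s > (0 : ℝ), BddAbove (g '' Icc s T)) ∧
    ∀ (y : Tangent m) (t : ℝ), 0 < t → t ≤ T → |f y t| ≤ g t * Real.exp (a * ‖y‖ ^ 2)

lemma HasSubGaussianGrowth.isSubGaussian {F : ℝ → ℝ} (hu : HasSubGaussianGrowth F u) :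
    IsSubGaussian (source F (boundaryFlux u)) u where
  __ := hu

namespace IsHeatSolution

lemma isParabolicRegular (hu : IsHeatSolution f h u) :
    IsParabolicRegular (halfSpace m) (Ioi 0) fun p τ => u p.1 p.2 τ := by
  have hsmooth (p) (hp : p ∈ halfSpace m) (τ : ℝ) (hτ : 0 < τ) :=
    (hu.contDiffOn_space τ hτ).contDiffAt ((isOpen_halfSpace m).mem_nhds hp)
  have assoc : MapsTo (fun q : (ℝ × Tangent m) × ℝ => (q.1.1, q.1.2, q.2)) (halfSpace m ×ˢ Ioi 0)
      {q | 0 < q.1 ∧ 0 < q.2.2} := fun q hq => ⟨hq.1.1, hq.2⟩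
  have hderiv (k : ℕ) (hk : k ≤ 2) := (hu.continuousOn_space_deriv k hk).comp
    (f := fun q : (ℝ × Tangent m) × ℝ => (q.1.1, q.1.2, q.2)) (by fun_prop) assoc
  refine ⟨hsmooth, fun p hp τ hτ => hu.differentiableAt_time _ _ _ hp.1 hτ,
    hu.continuousOn.comp (by fun_prop) fun q hq => ⟨le_of_lt (assoc hq).1, hq.2⟩, fun e => ?_,
    fun e => ?_, hu.continuousOn_time_deriv.comp (by fun_prop) assoc⟩
  · refine ((ContinuousMultilinearMap.apply ℝ (fun _ : Fin 1 => ℝ × Tangent m) ℝ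
      fun _ => e).continuous.comp_continuousOn (hderiv 1 one_le_two)).congr fun q _ => ?_
    exact (iteratedFDeriv_one_apply (𝕜 := ℝ) (f := fun p : ℝ × Tangent m => u p.1 p.2 q.2)
      fun _ => e).symm
  · refine ((ContinuousMultilinearMap.apply ℝ (fun _ : Fin 2 => ℝ × Tangent m) ℝ
      ![e, e]).continuous.comp_continuousOn (hderiv 2 le_rfl)).congr fun q hq => ?_
    exact (iteratedFDeriv_two_eq_secondDeriv (hsmooth q.1 hq.1 q.2 hq.2) e).symm

lemma deriv_sub_prodLaplacian (hu : IsHeatSolution f h u) {p : ℝ × Tangent m}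
    (hp : p ∈ halfSpace m) {τ : ℝ} (hτ : 0 < τ) :
    deriv (u p.1 p.2) τ - prodLaplacian (fun z => u z.1 z.2 τ) p = -f p.2 τ := by
  rw [← hu.equation p.1 p.2 τ hp.1 hτ,
    spaceLaplacian_eq_prodLaplacian (hu.isParabolicRegular.contDiffAt p hp τ hτ)]

lemma continuousOn_source (hu : IsHeatSolution f h u) :
    ContinuousOn (fun q : Tangent m × ℝ => f q.1 q.2) (univ ×ˢ Ioi 0) := by
  have hreg := hu.isParabolicRegular
  have hmaps : MapsTo (fun q : Tangent m × ℝ => (((1 : ℝ), q.1), q.2)) (univ ×ˢ Ioi 0)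
      (halfSpace m ×ˢ Ioi 0) := fun q hq => ⟨⟨mem_Ioi.2 one_pos, mem_univ _⟩, hq.2⟩
  refine ((hreg.continuousOn_deriv.sub hreg.continuousOn_prodLaplacian).neg.comp (by fun_prop)
    hmaps).congr fun q hq => ?_
  exact neg_eq_iff_eq_neg.1 (hu.deriv_sub_prodLaplacian (hmaps hq).1 hq.2).symm

end IsHeatSolution

end HeatSolution

section GaussianBounds

variable {E : Type*} [NormedAddCommGroup E] [InnerProductSpace ℝ E]

lemma norm_sq_half_sub_le {G : Type*} [SeminormedAddCommGroup G] (x y : G) :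
    ‖y‖ ^ 2 / 2 - ‖x‖ ^ 2 ≤ ‖x + y‖ ^ 2 := by
  have triangle : ‖y‖ ≤ ‖x + y‖ + ‖x‖ := by simpa using norm_sub_le (x + y) x
  nlinarith [sq_nonneg (‖x + y‖ - ‖x‖), norm_nonneg y]

lemma one_add_norm_mul_heatKernel_le {δ σ t : ℝ} (hδ : 0 < δ) (hδσ : δ ≤ σ) (hσt : σ ≤ t) (z : E) :
    (1 + ‖z‖) * heatKernel z σ ≤ Real.exp (2 * t) / (2 * √(Real.pi * δ)) ^ Module.finrank ℝ E *
      Real.exp (-(1 / (8 * t)) * ‖z‖ ^ 2) := by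
  have hσ : 0 < σ := hδ.trans_le hδσ
  have ht : 0 < t := hσ.trans_le hσt
  have amgm : ‖z‖ ≤ 2 * t + ‖z‖ ^ 2 / (8 * t) := by
    have : 2 * t + ‖z‖ ^ 2 / (8 * t) - ‖z‖ = (‖z‖ - 4 * t) ^ 2 / (8 * t) := by
      field_simp
      ring
    linarith [div_nonneg (sq_nonneg (‖z‖ - 4 * t)) (by positivity : 0 ≤ 8 * t)]
  have hlinear : 1 + ‖z‖ ≤ Real.exp (2 * t + ‖z‖ ^ 2 / (8 * t)) := by
    linarith [Real.add_one_le_exp (2 * t + ‖z‖ ^ 2 / (8 * t))]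
  have hkernel : heatKernel z σ ≤
      Real.exp (-‖z‖ ^ 2 / (4 * t)) / (2 * √(Real.pi * δ)) ^ Module.finrank ℝ E := by
    have := two_mul_sqrt_pi_mul_pos hδ
    simp only [heatKernel, neg_div]
    gcongr
  calc (1 + ‖z‖) * heatKernel z σ
      ≤ Real.exp (2 * t + ‖z‖ ^ 2 / (8 * t)) *
          (Real.exp (-‖z‖ ^ 2 / (4 * t)) / (2 * √(Real.pi * δ)) ^ Module.finrank ℝ E) :=
        mul_le_mul hlinear hkernel (heatKernel_nonneg z σ) (Real.exp_pos _).le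
    _ = Real.exp (2 * t) / (2 * √(Real.pi * δ)) ^ Module.finrank ℝ E *
          Real.exp (-(1 / (8 * t)) * ‖z‖ ^ 2) := by
        rw [mul_div_assoc', ← Real.exp_add, div_mul_eq_mul_div, ← Real.exp_add]
        congr 2
        field_simp
        ring

lemma integrable_exp_neg_mul_norm_sq [FiniteDimensional ℝ E] [MeasurableSpace E] [BorelSpace E]
    {κ : ℝ} (hκ : 0 < κ) : Integrable fun z : E => Real.exp (-κ * ‖z‖ ^ 2) := by
  refine Integrable.of_integral_ne_zero ?_
  rw [GaussianFourier.integral_rexp_neg_mul_sq_norm hκ]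
  positivity

variable {m : ℕ}

/-- The Gaussian `exp (-κ |p|²)` on `ℝ × ℝ^m`, with the Euclidean norm. -/
def gaussian (κ : ℝ) (p : ℝ × Tangent m) : ℝ := Real.exp (-κ * (p.1 ^ 2 + ‖p.2‖ ^ 2))

lemma gaussian_pos (κ : ℝ) (p : ℝ × Tangent m) : 0 < gaussian κ p := Real.exp_pos _

lemma gaussian_mul_gaussian (κ κ' : ℝ) (p : ℝ × Tangent m) :
    gaussian κ p * gaussian κ' p = gaussian (κ + κ') p := by
  rw [gaussian, gaussian, gaussian, ← Real.exp_add]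
  ring_nf

lemma integrable_gaussian {κ : ℝ} (hκ : 0 < κ) :
    Integrable (gaussian κ : ℝ × Tangent m → ℝ) := by
  refine ((integrable_exp_neg_mul_sq hκ).mul_prod
    (integrable_exp_neg_mul_norm_sq (E := Tangent m) hκ)).congr (ae_of_all _ fun p => ?_)
  rw [gaussian, mul_add, Real.exp_add]

lemma gaussian_toEuclidean_le {κ : ℝ} (hκ : 0 ≤ κ) (P p : ℝ × Tangent m) {ε : ℝ} (hε : ε ^ 2 = 1) :
    Real.exp (-κ * ‖toEuclidean (P + imageMap ε p)‖ ^ 2) ≤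
      Real.exp (κ * ‖toEuclidean P‖ ^ 2) * gaussian (κ / 2) p := by
  have hp : ‖toEuclidean (imageMap ε p)‖ ^ 2 = p.1 ^ 2 + ‖p.2‖ ^ 2 := by
    simp [toEuclidean_apply, norm_toLp_sq, imageMap_apply, mul_pow, hε]
  have h := norm_sq_half_sub_le (toEuclidean P) (toEuclidean (imageMap ε p))
  rw [gaussian, ← Real.exp_add, Real.exp_le_exp, map_add]
  rw [hp] at h
  nlinarith

lemma fderiv_spaceKernel_imageMap (P p e : ℝ × Tangent m) (ε σ : ℝ) :
    fderiv ℝ (fun z => spaceKernel (P + imageMap ε z) σ) p e =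
      -(spaceKernel (P + imageMap ε p) σ / (2 * σ)) *
        inner ℝ (toEuclidean (P + imageMap ε p)) (toEuclidean (imageMap ε e)) := by
  simp only [spaceKernel_add_imageMap]
  rw [fderiv_comp_affine (hasFDerivAt_heatKernel _ σ).differentiableAt, fderiv_heatKernel,
    ContinuousLinearMap.comp_apply, ContinuousLinearMap.comp_apply, map_add]

lemma abs_fderiv_spaceKernel_le (P p : ℝ × Tangent m) {ε δ σ : ℝ} (hε : ε ^ 2 = 1) (hδ : 0 < δ)
    (hδσ : δ ≤ σ) (i : Option (Fin m)) :
    |fderiv ℝ (fun z => spaceKernel (P + imageMap ε z) σ) p (coordDir i)| ≤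
      1 / (2 * δ) * (‖toEuclidean (P + imageMap ε p)‖ * spaceKernel (P + imageMap ε p) σ) := by
  have hσ : 0 < σ := hδ.trans_le hδσ
  have hK : 0 ≤ spaceKernel (P + imageMap ε p) σ := heatKernel_nonneg _ _
  have hdir : ‖toEuclidean (imageMap ε (coordDir i))‖ = 1 :=
    (sq_eq_sq₀ (norm_nonneg _) zero_le_one).1
      ((norm_imageMap_coordDir_sq hε i).trans (one_pow 2).symm)
  have hinner := abs_real_inner_le_norm (toEuclidean (P + imageMap ε p))
    (toEuclidean (imageMap ε (coordDir i)))
  rw [hdir, mul_one] at hinner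
  rw [fderiv_spaceKernel_imageMap, abs_mul, abs_neg, abs_of_nonneg (by positivity),
    div_eq_mul_one_div, mul_comm (spaceKernel _ _), mul_assoc, mul_comm (‖_‖)]
  gcongr

lemma exists_abs_spaceKernel_le (P : ℝ × Tangent m) {r t : ℝ} (hr : 0 ≤ r) (hrt : r < t) :
    ∃ C, ∀ ε : ℝ, ε ^ 2 = 1 → ∀ p : ℝ × Tangent m, ∀ τ ∈ Icc 0 r,
      |spaceKernel (P + imageMap ε p) (t - τ)| ≤ C * gaussian (1 / (16 * t)) p ∧
      ∀ i, |fderiv ℝ (fun z => spaceKernel (P + imageMap ε z) (t - τ)) p (coordDir i)| ≤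
        C * gaussian (1 / (16 * t)) p := by
  have hδ : 0 < t - r := sub_pos.2 hrt
  have := two_mul_sqrt_pi_mul_pos hδ
  set B := Real.exp (2 * t) / (2 * √(Real.pi * (t - r))) ^
    Module.finrank ℝ (WithLp 2 (ℝ × Tangent m)) * Real.exp (1 / (8 * t) * ‖toEuclidean P‖ ^ 2)
  have hB0 : 0 ≤ B := by positivity
  refine ⟨(1 + 1 / (2 * (t - r))) * B, fun ε hε p τ hτ => ?_⟩
  have hσ : t - r ≤ t - τ := sub_le_sub_left hτ.2 t
  have hG := gaussian_pos (1 / (16 * t)) p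
  have hB : (1 + ‖toEuclidean (P + imageMap ε p)‖) * spaceKernel (P + imageMap ε p) (t - τ) ≤
      B * gaussian (1 / (16 * t)) p := by
    refine (one_add_norm_mul_heatKernel_le hδ hσ (sub_le_self t hτ.1) _).trans ?_
    rw [mul_assoc, show 1 / (16 * t) = 1 / (8 * t) / 2 by ring]
    exact mul_le_mul_of_nonneg_left (gaussian_toEuclidean_le
      (one_div_nonneg.2 (by linarith)) P p hε) (by positivity)
  have hK : 0 ≤ spaceKernel (P + imageMap ε p) (t - τ) := heatKernel_nonneg _ _
  rw [add_mul, one_mul] at hB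
  have hzK := mul_nonneg (norm_nonneg (toEuclidean (P + imageMap ε p))) hK
  have hconst : 0 ≤ 1 / (2 * (t - r)) := by positivity
  rw [abs_of_nonneg hK, add_mul, one_mul, add_mul, mul_assoc]
  refine ⟨by linarith [mul_nonneg hconst (mul_nonneg hB0 hG.le)], fun i => ?_⟩
  have hderiv := abs_fderiv_spaceKernel_le P p hε hδ hσ i
  have hweighted := mul_le_mul_of_nonneg_left ((le_add_of_nonneg_left hK).trans hB) hconst
  linarith [mul_nonneg hB0 hG.le]

lemma exists_abs_green_le (P : ℝ × Tangent m) {r t : ℝ} (hr : 0 ≤ r) (hrt : r < t) :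
    ∃ C, ∀ p : ℝ × Tangent m, ∀ τ ∈ Icc 0 r,
      |green P.1 P.2 t p.1 p.2 τ| ≤ C * gaussian (1 / (16 * t)) p ∧
      ∀ i, |fderiv ℝ (fun z => green P.1 P.2 t z.1 z.2 τ) p (coordDir i)| ≤
        C * gaussian (1 / (16 * t)) p := by
  obtain ⟨C, hC⟩ := exists_abs_spaceKernel_le P hr hrt
  refine ⟨2 * C, fun p τ hτ => ?_⟩
  obtain ⟨source, dsource⟩ := hC (-1) (by norm_num) p τ hτ
  obtain ⟨image, dimage⟩ := hC 1 (by norm_num) p τ hτ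
  simp only [green_eq_spaceKernel_sub]
  refine ⟨(abs_sub _ _).trans (by linarith), fun i => ?_⟩
  have hdiff (ε : ℝ) : DifferentiableAt ℝ (fun z => spaceKernel (P + imageMap ε z) (t - τ)) p :=
    ((isParabolicRegular_spaceKernel P ε t).contDiffAt p (mem_univ p) τ
      (hτ.2.trans_lt hrt)).differentiableAt (by norm_num)
  rw [fderiv_fun_sub (hdiff _) (hdiff _), sub_apply]
  exact (abs_sub _ _).trans (by linarith [dsource i, dimage i])

end GaussianBounds

section InteriorRepresentation

variable {m : ℕ} {h : ℝ → Tangent m → ℝ} {f : Tangent m → ℝ → ℝ} {u : ℝ → Tangent m → ℝ → ℝ}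
  {s r t : ℝ}

lemma integrable_slab_bound {κ : ℝ} (hκ : 0 < κ) {g : ℝ → ℝ} (hg : IntegrableOn g (Ioc s r)) :
    IntegrableOn (fun q : (ℝ × Tangent m) × ℝ => gaussian κ q.1 * g q.2)
      (halfSpace m ×ˢ Ioc s r) := by
  rw [IntegrableOn, volume_restrict_prod]
  exact (integrable_gaussian hκ).integrableOn.mul_prod hg

lemma integrableOn_slab_of_abs_le {κ D : ℝ} (hκ : 0 < κ) {g : (ℝ × Tangent m) × ℝ → ℝ}
    (hg : ContinuousOn g (closedHalfSpace m ×ˢ Icc s r))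
    (hD : ∀ q ∈ closedHalfSpace m ×ˢ Icc s r, |g q| ≤ D * gaussian κ q.1) :
    IntegrableOn g (halfSpace m ×ˢ Ioc s r) := by
  have hsub := prod_mono (halfSpace_subset_closedHalfSpace m)
    (Ioc_subset_Icc_self (a := s) (b := r))
  have hmeas := (measurableSet_halfSpace m).prod (measurableSet_Ioc (a := s) (b := r))
  exact (integrable_slab_bound hκ (integrableOn_const (by simp))).mono'
    ((hg.mono hsub).aestronglyMeasurable hmeas)
    ((ae_restrict_mem hmeas).mono fun q hq => (hD q (hsub hq)).trans_eq (mul_comm _ _))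

lemma integrable_boundary_bound {κ : ℝ} (hκ : 0 < κ) (C : ℝ) :
    IntegrableOn (fun q : Tangent m × ℝ => C * gaussian κ (0, q.1)) (univ ×ˢ Ioc s r) := by
  rw [IntegrableOn, volume_restrict_prod, Measure.restrict_univ]
  refine ((integrable_exp_neg_mul_norm_sq (E := Tangent m) hκ).mul_prod
    (integrable_const C)).congr (ae_of_all _ fun q => ?_)
  simp only [gaussian]
  ring_nf

lemma integrableOn_boundary_of_abs_le {κ D : ℝ} (hκ : 0 < κ) {g : Tangent m × ℝ → ℝ}
    (hg : ContinuousOn g (univ ×ˢ Icc s r))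
    (hD : ∀ q ∈ univ ×ˢ Icc s r, |g q| ≤ D * gaussian κ (0, q.1)) :
    IntegrableOn g (univ ×ˢ Ioc s r) := by
  have hsub := prod_mono (subset_refl (univ : Set (Tangent m)))
    (Ioc_subset_Icc_self (a := s) (b := r))
  have hmeas : MeasurableSet ((univ : Set (Tangent m)) ×ˢ Ioc s r) :=
    MeasurableSet.univ.prod measurableSet_Ioc
  exact (integrable_boundary_bound hκ D).mono' ((hg.mono hsub).aestronglyMeasurable hmeas)
    ((ae_restrict_mem hmeas).mono fun q hq => hD q (hsub hq))

lemma abs_mul_le_gaussian {κ a b C B g v : ℝ} {p : ℝ × Tangent m} (hκ : κ = a + b)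
    (hg : |g| ≤ C * gaussian κ p) (hv : |v| ≤ B * gaussian (-b) p) :
    |g * v| ≤ C * B * gaussian a p := by
  calc |g * v| ≤ (C * gaussian κ p) * (B * gaussian (-b) p) := by
        rw [abs_mul]
        exact mul_le_mul hg hv (abs_nonneg _) ((abs_nonneg _).trans hg)
    _ = C * B * (gaussian κ p * gaussian (-b) p) := by ring
    _ = C * B * gaussian a p := by rw [gaussian_mul_gaussian, hκ, add_neg_cancel_right]

lemma IsSubGaussian.exists_abs_shift_le (hg : IsSubGaussian f u) (ht : 0 < t) :
    ∃ B, ∀ p : ℝ × Tangent m, ∀ ε ∈ Icc (0 : ℝ) 1, 0 < p.1 + ε → ∀ τ ∈ Ioc 0 t,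
      |u (p.1 + ε) p.2 τ| ≤ B * gaussian (-(1 / (32 * t))) p := by
  obtain ⟨A, hA⟩ := hg.solution_bound t ht (1 / (64 * t)) (by positivity)
  have hA0 : 0 ≤ A := nonneg_of_mul_nonneg_left
    ((abs_nonneg _).trans (hA 1 0 t one_pos ht le_rfl)) (Real.exp_pos _)
  refine ⟨A * Real.exp (1 / (32 * t)), fun p ε hε hpε τ hτ => ?_⟩
  refine (hA _ p.2 τ hpε hτ.1 hτ.2).trans ?_
  rw [mul_assoc, gaussian, ← Real.exp_add]
  refine mul_le_mul_of_nonneg_left (Real.exp_le_exp.2 ?_) hA0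
  have hsq : (p.1 + ε) ^ 2 ≤ 2 + 2 * p.1 ^ 2 := by
    nlinarith [sq_nonneg (p.1 - ε), mul_self_le_mul_self hε.1 hε.2]
  calc 1 / (64 * t) * ((p.1 + ε) ^ 2 + ‖p.2‖ ^ 2)
      ≤ 1 / (64 * t) * (2 + 2 * p.1 ^ 2 + 2 * ‖p.2‖ ^ 2) := by
        gcongr
        linarith [sq_nonneg ‖p.2‖]
    _ = _ := by
        field_simp
        ring

lemma IsHeatSolution.isParabolicRegular_shift (hu : IsHeatSolution f h u) {ε : ℝ} (hε : 0 < ε)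
    (hs : 0 < s) :
    IsParabolicRegular (closedHalfSpace m) (Icc s r) fun p τ => u (p.1 + ε) p.2 τ := by
  have := (hu.isParabolicRegular.comp_add_right (ε, 0)).mono
    (S' := closedHalfSpace m) (I' := Icc s r)
    (fun p hp => ⟨add_pos_of_nonneg_of_pos hp hε, mem_univ _⟩) fun τ hτ => hs.trans_le hτ.1
  simpa only [Prod.fst_add, Prod.snd_add, add_zero] using this

lemma IsHeatSolution.deriv_sub_prodLaplacian_shift (hu : IsHeatSolution f h u) {ε : ℝ} (hε : 0 < ε)
    {p : ℝ × Tangent m} (hp : p ∈ closedHalfSpace m) {τ : ℝ} (hτ : 0 < τ) :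
    deriv (u (p.1 + ε) p.2) τ - prodLaplacian (fun z => u (z.1 + ε) z.2 τ) p = -f p.2 τ := by
  have := prodLaplacian_comp_add_right (fun z => u z.1 z.2 τ) (ε, 0) p
  simp only [Prod.fst_add, Prod.snd_add, add_zero] at this
  rw [this, ← hu.deriv_sub_prodLaplacian (p := (p.1 + ε, p.2))
    ⟨add_pos_of_nonneg_of_pos hp hε, mem_univ _⟩ hτ, Prod.add_def]
  simp only [add_zero]

lemma IsSubGaussian.exists_abs_green_mul_le (hg : IsSubGaussian f u) (P : ℝ × Tangent m)
    (hr : 0 ≤ r) (hrt : r < t) :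
    ∃ D, ∀ p : ℝ × Tangent m, ∀ ε ∈ Icc (0 : ℝ) 1, 0 < p.1 + ε → ∀ τ ∈ Ioc 0 r,
      |green P.1 P.2 t p.1 p.2 τ * u (p.1 + ε) p.2 τ| ≤ D * gaussian (1 / (32 * t)) p ∧
      ∀ i, |fderiv ℝ (fun z => green P.1 P.2 t z.1 z.2 τ) p (coordDir i) * u (p.1 + ε) p.2 τ| ≤
        D * gaussian (1 / (32 * t)) p := by
  obtain ⟨C, hC⟩ := exists_abs_green_le P hr hrt
  obtain ⟨B, hB⟩ := hg.exists_abs_shift_le (hr.trans_lt hrt)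
  refine ⟨C * B, fun p ε hε hpε τ hτ => ?_⟩
  have hu := hB p ε hε hpε τ ⟨hτ.1, hτ.2.trans hrt.le⟩
  have hgreen := hC p τ (Ioc_subset_Icc_self hτ)
  exact ⟨abs_mul_le_gaussian (by ring) hgreen.1 hu,
    fun i => abs_mul_le_gaussian (by ring) (hgreen.2 i) hu⟩

lemma IsHeatSolution.integrableOn_green_mul_source (hu : IsHeatSolution f h u)
    (hg : IsSubGaussian f u) (P : ℝ × Tangent m) (hs : 0 ≤ s) (hr : 0 ≤ r) (hrt : r < t) :
    IntegrableOn (fun q : (ℝ × Tangent m) × ℝ => green P.1 P.2 t q.1.1 q.1.2 q.2 * f q.1.2 q.2)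
      (halfSpace m ×ˢ Ioc s r) := by
  have ht : 0 < t := hr.trans_lt hrt
  obtain ⟨C, hC⟩ := exists_abs_green_le P hr hrt
  obtain ⟨g, hgi, -, hgf⟩ := hg.source_bound t ht (1 / (32 * t)) (by positivity)
  have hpos {q : (ℝ × Tangent m) × ℝ} (hq : q ∈ halfSpace m ×ˢ Ioc s r) : 0 < q.2 :=
    hs.trans_lt hq.2.1
  have hmeas := (measurableSet_halfSpace m).prod (measurableSet_Ioc (a := s) (b := r))
  refine (integrable_slab_bound (κ := 1 / (32 * t)) (by positivity)
    ((hgi.mono_set (Ioc_subset_Ioc hs hrt.le)).const_mul C)).mono'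
    (ContinuousOn.aestronglyMeasurable ?_ hmeas)
    ((ae_restrict_mem hmeas).mono fun q hq => ?_)
  · exact ((isParabolicRegular_green P t).continuousOn.mono
      (prod_mono (subset_univ _) fun τ hτ => hτ.2.trans_lt hrt)).mul
        (hu.continuousOn_source.comp (f := fun q : (ℝ × Tangent m) × ℝ => (q.1.2, q.2))
          (by fun_prop) fun q hq => ⟨mem_univ _, hpos hq⟩)
  · have hτt := hq.2.2.trans hrt.le
    have hg0 : 0 ≤ g q.2 := nonneg_of_mul_nonneg_left
      ((abs_nonneg _).trans (hgf 0 q.2 (hpos hq) hτt)) (Real.exp_pos _)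
    have hf : |f q.1.2 q.2| ≤ g q.2 * gaussian (-(1 / (32 * t))) q.1 := by
      refine (hgf q.1.2 q.2 (hpos hq) hτt).trans (mul_le_mul_of_nonneg_left ?_ hg0)
      rw [gaussian, neg_neg]
      gcongr
      exact le_add_of_nonneg_left (sq_nonneg _)
    exact (abs_mul_le_gaussian (by ring) (hC q.1 q.2 ⟨(hpos hq).le, hq.2.2⟩).1 hf).trans_eq
      (mul_comm _ _)

lemma isParabolicRegular_green_closedHalfSpace (P : ℝ × Tangent m) (hrt : r < t) :
    IsParabolicRegular (closedHalfSpace m) (Icc s r) fun p τ => green P.1 P.2 t p.1 p.2 τ :=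
  (isParabolicRegular_green P t).mono (subset_univ _) fun _ hτ => hτ.2.trans_lt hrt

lemma IsHeatSolution.integrableOn_green_mul_shift (hu : IsHeatSolution f h u)
    (hg : IsSubGaussian f u) (P : ℝ × Tangent m) {ε τ : ℝ} (hε : ε ∈ Ioc (0 : ℝ) 1) (hτ : 0 < τ)
    (hτt : τ < t) :
    IntegrableOn (fun p => green P.1 P.2 t p.1 p.2 τ * u (p.1 + ε) p.2 τ) (halfSpace m) := by
  have hκ : 0 < 1 / (32 * t) := one_div_pos.2 (by linarith)
  obtain ⟨D, hD⟩ := hg.exists_abs_green_mul_le P hτ.le hτt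
  have hmem : τ ∈ Icc τ τ := ⟨le_rfl, le_rfl⟩
  have hcont := ((isParabolicRegular_green_closedHalfSpace (s := τ) P hτt).continuousOn_slice
    hmem).mul ((hu.isParabolicRegular_shift (s := τ) hε.1 hτ).continuousOn_slice hmem)
  refine ((integrable_gaussian hκ).integrableOn.const_mul D).mono'
    ((hcont.mono (halfSpace_subset_closedHalfSpace m)).aestronglyMeasurable
      (measurableSet_halfSpace m))
    ((ae_restrict_mem (measurableSet_halfSpace m)).mono fun p hp => ?_)
  exact (hD p ε (Ioc_subset_Icc_self hε) (add_pos hp.1 hε.1) τ ⟨hτ, le_rfl⟩).1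

lemma IsHeatSolution.integrableOn_boundary_shift (hu : IsHeatSolution f h u)
    (hg : IsSubGaussian f u) (P : ℝ × Tangent m) {ε : ℝ} (hε : ε ∈ Ioc (0 : ℝ) 1) (hs : 0 < s)
    (hr : 0 ≤ r) (hrt : r < t) :
    IntegrableOn (fun q : Tangent m × ℝ =>
      fderiv ℝ (fun z : ℝ × Tangent m => green P.1 P.2 t z.1 z.2 q.2) (0, q.1) (1, 0) *
        u (0 + ε) q.1 q.2) (univ ×ˢ Ioc s r) := by
  have hκ : 0 < 1 / (32 * t) := one_div_pos.2 (by linarith)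
  obtain ⟨D, hD⟩ := hg.exists_abs_green_mul_le P hr hrt
  have hface : MapsTo (fun q : Tangent m × ℝ => (((0 : ℝ), q.1), q.2)) (univ ×ˢ Icc s r)
      (closedHalfSpace m ×ˢ Icc s r) := fun q hq => ⟨mk_mem_closedHalfSpace le_rfl q.1, hq.2⟩
  have hcont := ((isParabolicRegular_green_closedHalfSpace P hrt).continuousOn_fderiv (1, 0)).mul
    (hu.isParabolicRegular_shift hε.1 hs).continuousOn
  refine integrableOn_boundary_of_abs_le (D := D) hκ
    (hcont.comp (f := fun q : Tangent m × ℝ => (((0 : ℝ), q.1), q.2)) (by fun_prop) hface)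
    fun q hq => ?_
  exact (hD (0, q.1) ε (Ioc_subset_Icc_self hε) (by linarith [hε.1]) q.2
    ⟨hs.trans_le hq.2.1, hq.2.2⟩).2 none

lemma IsHeatSolution.integral_green_mul_shift_sub (hu : IsHeatSolution f h u)
    (hg : IsSubGaussian f u) (P : ℝ × Tangent m) {ε : ℝ} (hε : ε ∈ Ioc (0 : ℝ) 1) (hs : 0 < s)
    (hsr : s ≤ r) (hrt : r < t) :
    (∫ p in halfSpace m, green P.1 P.2 t p.1 p.2 r * u (p.1 + ε) p.2 r) -
        ∫ p in halfSpace m, green P.1 P.2 t p.1 p.2 s * u (p.1 + ε) p.2 s =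
      -(∫ q in halfSpace m ×ˢ Ioc s r, green P.1 P.2 t q.1.1 q.1.2 q.2 * f q.1.2 q.2) +
        ∫ q in univ ×ˢ Ioc s r,
          fderiv ℝ (fun z : ℝ × Tangent m => green P.1 P.2 t z.1 z.2 q.2) (0, q.1) (1, 0) *
            u (0 + ε) q.1 q.2 := by
  have hr := hs.trans_le hsr
  have hκ : 0 < 1 / (32 * t) := one_div_pos.2 (by linarith)
  obtain ⟨D, hD⟩ := hg.exists_abs_green_mul_le P hr.le hrt
  have hD' {q : (ℝ × Tangent m) × ℝ} (hq : q ∈ closedHalfSpace m ×ˢ Icc s r) :=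
    hD q.1 ε (Ioc_subset_Icc_self hε) (add_pos_of_nonneg_of_pos hq.1 hε.1) q.2
      ⟨hs.trans_le hq.2.1, hq.2.2⟩
  have hK := isParabolicRegular_green_closedHalfSpace (s := s) P hrt
  have hv := hu.isParabolicRegular_shift (s := s) (r := r) hε.1 hs
  have hmeas := (measurableSet_halfSpace m).prod (measurableSet_Ioc (a := s) (b := r))
  have hsource : EqOn
      (fun q : (ℝ × Tangent m) × ℝ => -(green P.1 P.2 t q.1.1 q.1.2 q.2 * f q.1.2 q.2))
      (fun q => green P.1 P.2 t q.1.1 q.1.2 q.2 * (deriv (u (q.1.1 + ε) q.1.2) q.2 -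
        prodLaplacian (fun z => u (z.1 + ε) z.2 q.2) q.1)) (halfSpace m ×ˢ Ioc s r) := by
    intro q hq
    dsimp only
    rw [hu.deriv_sub_prodLaplacian_shift hε.1 (halfSpace_subset_closedHalfSpace m hq.1)
      (hs.trans hq.2.1), mul_neg]
  have green_identity := heat_green_identity_of_integrableOn hsr hK hv
    (fun p _ τ hτ => deriv_green_add_prodLaplacian P p (hτ.2.trans_lt hrt)) (green_zero_right P t)
    (hu.integrableOn_green_mul_shift hg P hε hs (hsr.trans_lt hrt))
    (hu.integrableOn_green_mul_shift hg P hε hr hrt)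
    (integrableOn_slab_of_abs_le hκ (hK.continuousOn.mul hv.continuousOn) fun q hq => (hD' hq).1)
    (fun i => integrableOn_slab_of_abs_le hκ
      ((hK.continuousOn_fderiv (coordDir i)).mul hv.continuousOn) fun q hq => (hD' hq).2 i)
    ((hu.integrableOn_green_mul_source hg P hs.le hr.le hrt).neg.congr_fun hsource hmeas)
    (hu.integrableOn_boundary_shift hg P hε hs hr.le hrt)
  rw [green_identity, ← setIntegral_congr_fun hmeas hsource, integral_neg]

lemma IsHeatSolution.tendsto_shift (hu : IsHeatSolution f h u) {x : ℝ} (hx : 0 ≤ x) (y : Tangent m)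
    {τ : ℝ} (hτ : 0 < τ) : Tendsto (fun ε => u (x + ε) y τ) (𝓝[>] 0) (𝓝 (u x y τ)) := by
  have hmaps : ∀ᶠ ε in 𝓝[>] (0 : ℝ), ((x + ε, y, τ) : ℝ × Tangent m × ℝ) ∈
      {q : ℝ × Tangent m × ℝ | 0 ≤ q.1 ∧ 0 < q.2.2} :=
    eventually_mem_nhdsWithin.mono fun ε hε => ⟨add_nonneg hx (le_of_lt hε), hτ⟩
  have hpath : Tendsto (fun ε => ((x + ε, y, τ) : ℝ × Tangent m × ℝ)) (𝓝[>] 0)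
      (𝓝 (x, y, τ)) := by
    have : Continuous fun ε => ((x + ε, y, τ) : ℝ × Tangent m × ℝ) := by fun_prop
    simpa using (this.tendsto 0).mono_left nhdsWithin_le_nhds
  exact (hu.continuousOn (x, y, τ) ⟨hx, hτ⟩).tendsto.comp
    (tendsto_nhdsWithin_iff.2 ⟨hpath, hmaps⟩)

lemma IsHeatSolution.tendsto_integral_green_mul_shift (hu : IsHeatSolution f h u)
    (hg : IsSubGaussian f u) (P : ℝ × Tangent m) {τ : ℝ} (hτ : 0 < τ) (hτt : τ < t) :
    Tendsto (fun ε => ∫ p in halfSpace m, green P.1 P.2 t p.1 p.2 τ * u (p.1 + ε) p.2 τ) (𝓝[>] 0)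
      (𝓝 (∫ p in halfSpace m, green P.1 P.2 t p.1 p.2 τ * u p.1 p.2 τ)) := by
  have hκ : 0 < 1 / (32 * t) := one_div_pos.2 (by linarith)
  obtain ⟨D, hD⟩ := hg.exists_abs_green_mul_le P hτ.le hτt
  have hε : ∀ᶠ ε in 𝓝[>] (0 : ℝ), ε ∈ Ioc (0 : ℝ) 1 := Ioc_mem_nhdsGT one_pos
  refine tendsto_integral_filter_of_dominated_convergence _
    (hε.mono fun ε hε => (hu.integrableOn_green_mul_shift hg P hε hτ hτt).aestronglyMeasurable)
    (hε.mono fun ε hε => (ae_restrict_mem (measurableSet_halfSpace m)).mono fun p hp => ?_)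
    ((integrable_gaussian hκ).integrableOn.const_mul D)
    ((ae_restrict_mem (measurableSet_halfSpace m)).mono fun p hp =>
      (hu.tendsto_shift (le_of_lt hp.1) p.2 hτ).const_mul _)
  exact (hD p ε (Ioc_subset_Icc_self hε) (add_pos hp.1 hε.1) τ ⟨hτ, le_rfl⟩).1

lemma IsHeatSolution.tendsto_integral_boundary_shift (hu : IsHeatSolution f h u)
    (hg : IsSubGaussian f u) (P : ℝ × Tangent m) (hs : 0 < s) (hr : 0 ≤ r) (hrt : r < t) :
    Tendsto (fun ε => ∫ q in univ ×ˢ Ioc s r,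
      fderiv ℝ (fun z : ℝ × Tangent m => green P.1 P.2 t z.1 z.2 q.2) (0, q.1) (1, 0) *
        u (0 + ε) q.1 q.2) (𝓝[>] 0) (𝓝 0) := by
  have hκ : 0 < 1 / (32 * t) := one_div_pos.2 (by linarith)
  obtain ⟨D, hD⟩ := hg.exists_abs_green_mul_le P hr hrt
  have hε : ∀ᶠ ε in 𝓝[>] (0 : ℝ), ε ∈ Ioc (0 : ℝ) 1 := Ioc_mem_nhdsGT one_pos
  have hmem : ∀ᵐ q ∂volume.restrict ((univ : Set (Tangent m)) ×ˢ Ioc s r), q.2 ∈ Ioc s r :=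
    (ae_restrict_mem (MeasurableSet.univ.prod measurableSet_Ioc)).mono fun q hq => hq.2
  refine (tendsto_integral_filter_of_dominated_convergence (f := fun _ => 0) _
    (hε.mono fun ε hε => (hu.integrableOn_boundary_shift hg P hε hs hr hrt).aestronglyMeasurable)
    (hε.mono fun ε hε => hmem.mono fun q hq => (hD (0, q.1) ε (Ioc_subset_Icc_self hε)
      (by linarith [hε.1]) q.2 ⟨hs.trans hq.1, hq.2⟩).2 none)
    (integrable_boundary_bound hκ D)
    (hmem.mono fun q hq => ?_)).trans_eq (by rw [integral_zero])
  have := (hu.tendsto_shift le_rfl q.1 (hs.trans hq.1)).const_mul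
    (fderiv ℝ (fun z : ℝ × Tangent m => green P.1 P.2 t z.1 z.2 q.2) (0, q.1) (1, 0))
  rwa [hu.boundary q.1 q.2 (hs.trans hq.1), mul_zero] at this

lemma IsHeatSolution.integral_green_mul_sub (hu : IsHeatSolution f h u) (hg : IsSubGaussian f u)
    (P : ℝ × Tangent m) (hs : 0 < s) (hsr : s ≤ r) (hrt : r < t) :
    (∫ p in halfSpace m, green P.1 P.2 t p.1 p.2 r * u p.1 p.2 r) -
        ∫ p in halfSpace m, green P.1 P.2 t p.1 p.2 s * u p.1 p.2 s =
      -∫ q in halfSpace m ×ˢ Ioc s r, green P.1 P.2 t q.1.1 q.1.2 q.2 * f q.1.2 q.2 := by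
  have hr := hs.trans_le hsr
  refine tendsto_nhds_unique ((hu.tendsto_integral_green_mul_shift hg P hr hrt).sub
    (hu.tendsto_integral_green_mul_shift hg P hs (hsr.trans_lt hrt))) ?_
  have hε : ∀ᶠ ε in 𝓝[>] (0 : ℝ), ε ∈ Ioc (0 : ℝ) 1 := Ioc_mem_nhdsGT one_pos
  refine Tendsto.congr'
    (hε.mono fun ε hε => (hu.integral_green_mul_shift_sub hg P hε hs hsr hrt).symm) ?_
  simpa only [add_zero] using
    tendsto_const_nhds.add (hu.tendsto_integral_boundary_shift hg P hs hr.le hrt)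

end InteriorRepresentation

section HeatFlow

variable {E : Type*} [NormedAddCommGroup E] [InnerProductSpace ℝ E]

lemma heatKernel_eq_mul_heatKernel_smul (z : E) {σ : ℝ} (hσ : 0 < σ) (τ : ℝ) :
    heatKernel z τ = √σ ^ Module.finrank ℝ E * heatKernel (√σ • z) (τ * σ) := by
  have hn : 0 < √σ ^ Module.finrank ℝ E := pow_pos (Real.sqrt_pos.2 hσ) _
  have hexponent : -(√σ * ‖z‖) ^ 2 / (4 * (τ * σ)) = -‖z‖ ^ 2 / (4 * τ) := by
    rw [mul_pow, Real.sq_sqrt hσ.le, mul_comm σ, ← neg_mul, ← mul_assoc,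
      mul_div_mul_right _ _ hσ.ne']
  rw [heatKernel, heatKernel, norm_smul, Real.norm_of_nonneg (Real.sqrt_nonneg σ), hexponent,
    ← mul_assoc Real.pi, Real.sqrt_mul' _ hσ.le, ← mul_assoc, mul_pow _ √σ, mul_div_assoc',
    mul_comm (_ ^ _), mul_div_mul_right _ _ hn.ne']

lemma heatKernel_mul_exp_norm_sq_div (z : E) {σ : ℝ} (hσ : 0 < σ) :
    heatKernel z σ * Real.exp (‖z‖ ^ 2 / (8 * σ)) =
      √2 ^ Module.finrank ℝ E * heatKernel z (2 * σ) := by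
  have hsqrt : 2 * √(Real.pi * (2 * σ)) = √2 * (2 * √(Real.pi * σ)) := by
    rw [mul_left_comm Real.pi, Real.sqrt_mul two_pos.le, mul_left_comm]
  rw [heatKernel, heatKernel, hsqrt, mul_pow √2, div_mul_eq_mul_div, ← Real.exp_add,
    ← mul_div_assoc, mul_div_mul_left _ _ (by positivity)]
  congr 2
  field_simp
  ring

lemma heatKernel_mul_exp_le (y η : E) {a σ : ℝ} (ha : 0 ≤ a) (hσ : 0 < σ) (haσ : 16 * a * σ ≤ 1) :
    heatKernel (y - η) σ * Real.exp (a * ‖η‖ ^ 2) ≤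
      √2 ^ Module.finrank ℝ E * Real.exp (2 * a * ‖y‖ ^ 2) * heatKernel (y - η) (2 * σ) := by
  have hη : ‖η‖ ^ 2 ≤ 2 * ‖y‖ ^ 2 + 2 * ‖y - η‖ ^ 2 := by
    have := norm_sq_half_sub_le (-y) η
    rw [norm_neg, neg_add_eq_sub, norm_sub_rev] at this
    linarith
  have hexp : a * ‖η‖ ^ 2 ≤ 2 * a * ‖y‖ ^ 2 + ‖y - η‖ ^ 2 / (8 * σ) :=
    calc a * ‖η‖ ^ 2 ≤ a * (2 * ‖y‖ ^ 2 + 2 * ‖y - η‖ ^ 2) := by gcongr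
      _ = 2 * a * ‖y‖ ^ 2 + 16 * a * σ * (‖y - η‖ ^ 2 / (8 * σ)) := by
        field_simp
        ring
      _ ≤ 2 * a * ‖y‖ ^ 2 + 1 * (‖y - η‖ ^ 2 / (8 * σ)) := by gcongr
      _ = _ := by rw [one_mul]
  calc heatKernel (y - η) σ * Real.exp (a * ‖η‖ ^ 2)
      ≤ heatKernel (y - η) σ * Real.exp (2 * a * ‖y‖ ^ 2 + ‖y - η‖ ^ 2 / (8 * σ)) :=
        mul_le_mul_of_nonneg_left (Real.exp_le_exp.2 hexp) (heatKernel_nonneg _ _)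
    _ = Real.exp (2 * a * ‖y‖ ^ 2) *
          (heatKernel (y - η) σ * Real.exp (‖y - η‖ ^ 2 / (8 * σ))) := by
        rw [Real.exp_add]
        ring
    _ = _ := by
        rw [heatKernel_mul_exp_norm_sq_div _ hσ]
        ring

lemma abs_heatKernel_mul_le {φ : E → ℝ} {a A σ : ℝ} (ha : 0 ≤ a)
    (hφ : ∀ η, |φ η| ≤ A * Real.exp (a * ‖η‖ ^ 2)) (hσ : 0 < σ) (haσ : 16 * a * σ ≤ 1) (y η : E) :
    |heatKernel (y - η) σ * φ η| ≤
      √2 ^ Module.finrank ℝ E * Real.exp (2 * a * ‖y‖ ^ 2) * A * heatKernel (y - η) (2 * σ) := by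
  have hA : 0 ≤ A := nonneg_of_mul_nonneg_left ((abs_nonneg _).trans (hφ 0)) (Real.exp_pos _)
  rw [abs_mul, abs_of_nonneg (heatKernel_nonneg _ _)]
  calc heatKernel (y - η) σ * |φ η|
      ≤ heatKernel (y - η) σ * (A * Real.exp (a * ‖η‖ ^ 2)) :=
        mul_le_mul_of_nonneg_left (hφ η) (heatKernel_nonneg _ _)
    _ = A * (heatKernel (y - η) σ * Real.exp (a * ‖η‖ ^ 2)) := by ring
    _ ≤ A * (√2 ^ Module.finrank ℝ E * Real.exp (2 * a * ‖y‖ ^ 2) *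
          heatKernel (y - η) (2 * σ)) :=
        mul_le_mul_of_nonneg_left (heatKernel_mul_exp_le y η ha hσ haσ) hA
    _ = _ := by ring

lemma abs_heatKernel_one_mul_le {φ : E → ℝ} {a A σ : ℝ} (ha : 0 ≤ a)
    (hφ : ∀ η, |φ η| ≤ A * Real.exp (a * ‖η‖ ^ 2)) (hσ : 0 < σ) (haσ : 16 * a * σ ≤ 1) (y w : E) :
    |heatKernel w 1 * φ (y - √σ • w)| ≤
      √2 ^ Module.finrank ℝ E * Real.exp (2 * a * ‖y‖ ^ 2) * A * heatKernel w 2 := by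
  have h := mul_le_mul_of_nonneg_left (abs_heatKernel_mul_le ha hφ hσ haσ y (y - √σ • w))
    (pow_nonneg (Real.sqrt_nonneg σ) (Module.finrank ℝ E))
  rw [sub_sub_cancel, abs_mul, abs_of_nonneg (heatKernel_nonneg _ _)] at h
  rw [abs_mul, abs_of_nonneg (heatKernel_nonneg _ _), heatKernel_eq_mul_heatKernel_smul w hσ 1,
    heatKernel_eq_mul_heatKernel_smul w hσ 2, one_mul, mul_assoc]
  exact h.trans_eq (mul_left_comm _ _ _)

variable [MeasurableSpace E]

/-- The convolution of `φ` with the heat kernel, i.e. the solution at time `σ > 0` of the heat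
equation with initial value `φ`. -/
def heatFlow [FiniteDimensional ℝ E] [BorelSpace E] (φ : E → ℝ) (y : E) (σ : ℝ) : ℝ :=
  ∫ η, heatKernel (y - η) σ * φ η

variable [FiniteDimensional ℝ E] [BorelSpace E]

lemma heatFlow_eq_integral_exp_div (φ : E → ℝ) (y : E) (σ : ℝ) :
    heatFlow φ y σ = (∫ η, Real.exp (-‖y - η‖ ^ 2 / (4 * σ)) * φ η) /
      (2 * √(Real.pi * σ)) ^ Module.finrank ℝ E := by
  simp only [heatFlow, heatKernel, div_mul_eq_mul_div, integral_div]

lemma integral_heatKernel {σ : ℝ} (hσ : 0 < σ) : ∫ z : E, heatKernel z σ = 1 := by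
  have hS := two_mul_sqrt_pi_mul_pos hσ
  have hsq : Real.pi / (1 / (4 * σ)) = (2 * √(Real.pi * σ)) ^ 2 := by
    rw [mul_pow, Real.sq_sqrt (by positivity)]
    field_simp
    norm_num
  have hker (z : E) : heatKernel z σ = Real.exp (-(1 / (4 * σ)) * ‖z‖ ^ 2) /
      (2 * √(Real.pi * σ)) ^ Module.finrank ℝ E := by
    rw [heatKernel, neg_mul, one_div_mul_eq_div, neg_div]
  simp_rw [hker]
  rw [integral_div, GaussianFourier.integral_rexp_neg_mul_sq_norm (by positivity), hsq,
    ← Real.rpow_natCast _ 2, ← Real.rpow_mul hS.le, Nat.cast_ofNat,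
    mul_div_cancel₀ _ two_ne_zero, Real.rpow_natCast, div_self (pow_pos hS _).ne']

lemma integrable_heatKernel {σ : ℝ} (hσ : 0 < σ) : Integrable fun z : E => heatKernel z σ :=
  Integrable.of_integral_ne_zero ((integral_heatKernel hσ).trans_ne one_ne_zero)

lemma integrable_heatKernel_mul {φ : E → ℝ} {a A σ : ℝ} (hmeas : AEStronglyMeasurable φ)
    (ha : 0 ≤ a) (hφ : ∀ η, |φ η| ≤ A * Real.exp (a * ‖η‖ ^ 2)) (hσ : 0 < σ)
    (haσ : 16 * a * σ ≤ 1) (y : E) : Integrable fun η => heatKernel (y - η) σ * φ η := by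
  refine (((integrable_heatKernel (by positivity : 0 < 2 * σ)).comp_sub_left y).const_mul _).mono'
    (AEStronglyMeasurable.mul ?_ hmeas) (ae_of_all _ (abs_heatKernel_mul_le ha hφ hσ haσ y))
  exact ((contDiff_heatKernel σ).continuous.comp (by fun_prop)).aestronglyMeasurable

lemma abs_heatFlow_le {φ : E → ℝ} {a A σ : ℝ} (ha : 0 ≤ a)
    (hφ : ∀ η, |φ η| ≤ A * Real.exp (a * ‖η‖ ^ 2)) (hσ : 0 < σ) (haσ : 16 * a * σ ≤ 1) (y : E) :
    |heatFlow φ y σ| ≤ √2 ^ Module.finrank ℝ E * Real.exp (2 * a * ‖y‖ ^ 2) * A := by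
  have hσ2 : 0 < 2 * σ := by positivity
  have h := norm_integral_le_of_norm_le (f := fun η => heatKernel (y - η) σ * φ η)
    (((integrable_heatKernel hσ2).comp_sub_left y).const_mul _)
    (ae_of_all _ (abs_heatKernel_mul_le ha hφ hσ haσ y))
  rwa [integral_const_mul, integral_sub_left_eq_self (fun z => heatKernel z (2 * σ)),
    integral_heatKernel hσ2, mul_one] at h

lemma heatFlow_eq_integral_smul (φ : E → ℝ) (y : E) {σ : ℝ} (hσ : 0 < σ) :
    heatFlow φ y σ = ∫ w : E, heatKernel w 1 * φ (y - √σ • w) := by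
  have hs : 0 < √σ := Real.sqrt_pos.2 hσ
  have hn : 0 < √σ ^ Module.finrank ℝ E := pow_pos hs _
  have hscale (w : E) : heatKernel w 1 * φ (y - √σ • w) =
      √σ ^ Module.finrank ℝ E * (heatKernel (√σ • w) σ * φ (y - √σ • w)) := by
    rw [heatKernel_eq_mul_heatKernel_smul w hσ 1, one_mul, mul_assoc]
  simp_rw [hscale]
  rw [integral_const_mul, Measure.integral_comp_smul volume
    (fun z => heatKernel z σ * φ (y - z)), abs_of_pos (inv_pos.2 hn), smul_eq_mul,
    mul_inv_cancel_left₀ hn.ne', heatFlow,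
    ← integral_sub_left_eq_self (fun z => heatKernel z σ * φ (y - z)) volume y]
  simp only [sub_sub_cancel]

lemma tendsto_heatFlow {φ : E → ℝ → ℝ} {a A c : ℝ} {y : E} (ha : 0 ≤ a)
    (hmeas : ∀ᶠ σ in 𝓝[>] (0 : ℝ), Measurable fun η => φ η σ)
    (hbound : ∀ᶠ σ in 𝓝[>] (0 : ℝ), ∀ η, |φ η σ| ≤ A * Real.exp (a * ‖η‖ ^ 2))
    (hlim : Tendsto (fun q : E × ℝ => φ q.1 q.2) (𝓝 y ×ˢ 𝓝[>] 0) (𝓝 c)) :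
    Tendsto (fun σ => heatFlow (fun η => φ η σ) y σ) (𝓝[>] 0) (𝓝 c) := by
  have hpos : ∀ᶠ σ : ℝ in 𝓝[>] 0, 0 < σ := self_mem_nhdsWithin
  have hsmall : ∀ᶠ σ : ℝ in 𝓝[>] 0, 16 * a * σ ≤ 1 := by
    have : Tendsto (fun σ : ℝ => 16 * a * σ) (𝓝[>] 0) (𝓝 (16 * a * 0)) :=
      (continuous_const_mul _).continuousAt.tendsto.mono_left nhdsWithin_le_nhds
    rw [mul_zero] at this
    exact this.eventually_le_const one_pos
  have hunit : ∫ w : E, heatKernel w 1 * c = c := by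
    rw [integral_mul_const, integral_heatKernel one_pos, one_mul]
  have hrescaled : Tendsto (fun σ => ∫ w : E, heatKernel w 1 * φ (y - √σ • w) σ) (𝓝[>] 0)
      (𝓝 (∫ w : E, heatKernel w 1 * c)) := by
    refine tendsto_integral_filter_of_dominated_convergence
      (fun w => √2 ^ Module.finrank ℝ E * Real.exp (2 * a * ‖y‖ ^ 2) * A * heatKernel w 2) ?_ ?_
      ((integrable_heatKernel two_pos).const_mul _) (ae_of_all _ fun w => ?_)
    · filter_upwards [hmeas] with σ hσ
      exact ((contDiff_heatKernel 1).continuous.measurable.mul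
        (hσ.comp (by fun_prop : Measurable fun w : E => y - √σ • w))).aestronglyMeasurable
    · filter_upwards [hpos, hsmall, hbound] with σ hσ haσ hφ
      exact ae_of_all _ (abs_heatKernel_one_mul_le ha hφ hσ haσ y)
    · have hpoint : Tendsto (fun σ : ℝ => (y - √σ • w, σ)) (𝓝[>] 0) (𝓝 y ×ˢ 𝓝[>] 0) := by
        refine Tendsto.prodMk ?_ tendsto_id
        have : ContinuousAt (fun σ : ℝ => y - √σ • w) 0 := by fun_prop
        simpa using this.tendsto.mono_left nhdsWithin_le_nhds
      exact (hlim.comp hpoint).const_mul _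
  rw [hunit] at hrescaled
  refine hrescaled.congr' ?_
  filter_upwards [hpos] with σ hσ
  rw [heatFlow_eq_integral_smul _ _ hσ]

end HeatFlow

section ErrorFunction

lemma integrable_exp_neg_sq : Integrable fun X : ℝ => Real.exp (-X ^ 2) := by
  simpa using integrable_exp_neg_mul_sq one_pos

lemma hasDerivAt_erf (z : ℝ) : HasDerivAt erf (2 / √Real.pi * Real.exp (-z ^ 2)) z :=
  ((by fun_prop : Continuous fun X : ℝ => Real.exp (-X ^ 2)).integral_hasStrictDerivAt 0
    z).hasDerivAt.const_mul _

lemma continuous_erf : Continuous erf :=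
  continuous_iff_continuousAt.2 fun z => (hasDerivAt_erf z).continuousAt

lemma erf_zero : erf 0 = 0 := by simp [erf]

lemma erf_neg (z : ℝ) : erf (-z) = -erf z := by
  have h := intervalIntegral.integral_comp_neg (a := 0) (b := z) fun X : ℝ => Real.exp (-X ^ 2)
  simp only [even_two, Even.neg_pow, neg_zero] at h
  rw [erf, erf, intervalIntegral.integral_symm, ← h, mul_neg]

lemma exists_tendsto_erf_atTop : ∃ l, Tendsto erf atTop (𝓝 l) :=
  ⟨_, (intervalIntegral_tendsto_integral_Ioi 0 integrable_exp_neg_sq.integrableOn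
    tendsto_id).const_mul _⟩

lemma exists_abs_erf_le : ∃ C, ∀ z, |erf z| ≤ C := by
  refine ⟨2 / √Real.pi * ∫ X : ℝ, Real.exp (-X ^ 2), fun z => ?_⟩
  rw [erf, abs_mul, abs_of_nonneg (by positivity)]
  gcongr
  refine (intervalIntegral.norm_integral_le_integral_norm_uIoc
    (f := fun X : ℝ => Real.exp (-X ^ 2))).trans ?_
  simp only [Real.norm_eq_abs, Real.abs_exp]
  exact setIntegral_le_integral integrable_exp_neg_sq (ae_of_all _ fun X => (Real.exp_pos _).le)

lemma heatKernel_real (z σ : ℝ) :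
    heatKernel z σ = Real.exp (-z ^ 2 / (4 * σ)) / (2 * √(Real.pi * σ)) := by
  simp only [heatKernel, Module.finrank_self, pow_one, Real.norm_eq_abs, sq_abs]

lemma hasDerivAt_erf_div {σ : ℝ} (hσ : 0 < σ) (x : ℝ) :
    HasDerivAt (fun x => erf (x / (2 * √σ))) (2 * heatKernel x σ) x := by
  refine ((hasDerivAt_erf _).comp x ((hasDerivAt_id x).div_const _)).congr_deriv ?_
  have := Real.sqrt_pos.2 hσ
  have hexponent : -(x / (2 * √σ)) ^ 2 = -x ^ 2 / (4 * σ) := by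
    rw [div_pow, mul_pow, Real.sq_sqrt hσ.le]
    ring
  rw [heatKernel_real, Real.sqrt_mul Real.pi_pos.le, id, hexponent]
  field_simp

lemma integrableOn_greenLine (x : ℝ) {t τ : ℝ} (hτ : τ < t) :
    IntegrableOn (fun ξ => greenLine x t ξ τ) (Ioi 0) := by
  have hK := integrable_heatKernel (E := ℝ) (sub_pos.2 hτ)
  simp_rw [greenLine_eq_heatKernel_sub]
  exact ((hK.comp_sub_left x).sub (hK.comp_add_left x)).integrableOn

lemma integral_greenLine (x : ℝ) {t τ : ℝ} (hτ : τ < t) :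
    ∫ ξ in Ioi 0, greenLine x t ξ τ = erf (x / (2 * √(t - τ))) := by
  have hσ : 0 < t - τ := sub_pos.2 hτ
  obtain ⟨l, hl⟩ := exists_tendsto_erf_atTop
  have hlim (c : ℝ) : Tendsto (fun ξ => erf ((ξ + c) / (2 * √(t - τ)))) atTop (𝓝 l) :=
    hl.comp ((tendsto_atTop_add_const_right _ c tendsto_id).atTop_div_const (by positivity))
  have hderiv (ξ : ℝ) : HasDerivAt (fun ξ => (erf ((ξ + -x) / (2 * √(t - τ))) -
      erf ((ξ + x) / (2 * √(t - τ)))) / 2) (greenLine x t ξ τ) ξ := by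
    refine ((((hasDerivAt_erf_div hσ (ξ + -x)).comp_add_const ξ (-x)).fun_sub
      ((hasDerivAt_erf_div hσ (ξ + x)).comp_add_const ξ x)).div_const 2).congr_deriv ?_
    rw [greenLine_eq_heatKernel_sub, ← heatKernel_neg (x - ξ), neg_sub, ← sub_eq_add_neg,
      add_comm ξ x]
    ring
  rw [integral_Ioi_of_hasDerivAt_of_tendsto (hderiv 0).continuousAt.continuousWithinAt
    (fun ξ _ => hderiv ξ) (integrableOn_greenLine x hτ)
    (((hlim (-x)).sub (hlim x)).div_const 2)]
  simp only [zero_add, neg_div, erf_neg]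
  ring

end ErrorFunction

section SmoothedSource

variable {m : ℕ} {h : ℝ → Tangent m → ℝ} {f : Tangent m → ℝ → ℝ} {u : ℝ → Tangent m → ℝ → ℝ}
  {s r t τ : ℝ}

/-- The contribution at time `t` of the source at time `τ`, diffused tangentially. -/
def smoothedSource (f : Tangent m → ℝ → ℝ) (y : Tangent m) (t τ : ℝ) : ℝ :=
  heatFlow (fun η => f η τ) y (t - τ)

lemma smoothedSource_eq (f : Tangent m → ℝ → ℝ) (y : Tangent m) (t τ : ℝ) :
    smoothedSource f y t τ = (∫ η, Real.exp (-‖y - η‖ ^ 2 / (4 * (t - τ))) * f η τ) /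
      (2 * √(Real.pi * (t - τ))) ^ m := by
  rw [smoothedSource, heatFlow_eq_integral_exp_div, finrank_euclideanSpace_fin]

lemma sixteen_mul_sub_le_one (hτ : 0 < τ) (hτt : τ < t) : 16 * (1 / (32 * t)) * (t - τ) ≤ 1 := by
  have ht : 0 < t := hτ.trans hτt
  field_simp
  linarith

namespace IsHeatSolution

lemma integrable_exp_mul_source (hu : IsHeatSolution f h u) (hg : IsSubGaussian f u)
    (y : Tangent m) (hτ : 0 < τ) (hτt : τ < t) :
    Integrable fun η : Tangent m => Real.exp (-‖y - η‖ ^ 2 / (4 * (t - τ))) * f η τ := by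
  have ht : 0 < t := hτ.trans hτt
  obtain ⟨g, -, -, hgf⟩ := hg.source_bound t ht (1 / (32 * t)) (by positivity)
  have hcont : Continuous fun η => f η τ := continuousOn_univ.1 (hu.continuousOn_source.comp
    (f := fun η : Tangent m => (η, τ)) (by fun_prop) fun η _ => ⟨mem_univ η, hτ⟩)
  refine ((integrable_heatKernel_mul hcont.aestronglyMeasurable (by positivity)
    (fun η => hgf η τ hτ hτt.le) (sub_pos.2 hτt) (sixteen_mul_sub_le_one hτ hτt) y).const_mul
    ((2 * √(Real.pi * (t - τ))) ^ m)).congr (ae_of_all _ fun η => ?_)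
  have := pow_pos (two_mul_sqrt_pi_mul_pos (sub_pos.2 hτt)) m
  simp only [heatKernel, finrank_euclideanSpace_fin]
  field_simp

lemma aestronglyMeasurable_smoothedSource (hu : IsHeatSolution f h u) (y : Tangent m) (t : ℝ) :
    AEStronglyMeasurable (smoothedSource f y t) (volume.restrict (Ioc 0 t)) := by
  rw [← restrict_Ioo_eq_restrict_Ioc]
  have hjoint : AEStronglyMeasurable
      (fun q : ℝ × Tangent m => heatKernel (y - q.2) (t - q.1) * f q.2 q.1)
      ((volume.restrict (Ioo 0 t)).prod volume) := by
    rw [← Measure.restrict_univ (μ := (volume : Measure (Tangent m))), Measure.prod_restrict]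
    refine ContinuousOn.aestronglyMeasurable (ContinuousOn.mul ?_ ?_)
      (measurableSet_Ioo.prod MeasurableSet.univ)
    · exact continuousOn_heatKernel.comp (f := fun q : ℝ × Tangent m => (y - q.2, t - q.1))
        (by fun_prop) fun q hq => sub_pos.2 hq.1.2
    · exact hu.continuousOn_source.comp (f := fun q : ℝ × Tangent m => (q.2, q.1))
        (by fun_prop) fun q hq => ⟨mem_univ _, hq.1.1⟩
  exact hjoint.integral_prod_right'

lemma integral_green_mul_source (hu : IsHeatSolution f h u) (hg : IsSubGaussian f u)
    (P : ℝ × Tangent m) (hs : 0 < s) (hsr : s ≤ r) (hrt : r < t) :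
    ∫ q in halfSpace m ×ˢ Ioc s r, green P.1 P.2 t q.1.1 q.1.2 q.2 * f q.1.2 q.2 =
      ∫ τ in s..r, erf (P.1 / (2 * √(t - τ))) * smoothedSource f P.2 t τ := by
  rw [setIntegral_volume_prod_symm
    (hu.integrableOn_green_mul_source hg P hs.le (hs.le.trans hsr) hrt),
    intervalIntegral.integral_of_le hsr]
  refine setIntegral_congr_fun measurableSet_Ioc fun τ hτ => ?_
  have hfactor (p : ℝ × Tangent m) : green P.1 P.2 t p.1 p.2 τ * f p.2 τ =
      greenLine P.1 t p.1 τ * (heatKernel (P.2 - p.2) (t - τ) * f p.2 τ) := by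
    rw [green_eq_mul_greenLine]
    ring
  simp only [hfactor]
  rw [restrict_halfSpace, integral_prod_mul (fun ξ => greenLine P.1 t ξ τ)
    (fun η => heatKernel (P.2 - η) (t - τ) * f η τ), integral_greenLine _ (hτ.2.trans_lt hrt)]
  rfl

end IsHeatSolution

namespace IsSubGaussian

lemma exists_abs_smoothedSource_le (hg : IsSubGaussian f u) (y : Tangent m) (ht : 0 < t) :
    ∃ g : ℝ → ℝ, IntegrableOn g (Ioc 0 t) ∧ (∃ M, ∀ τ ∈ Icc (t / 2) t, g τ ≤ M) ∧
      ∀ τ ∈ Ioo 0 t, |smoothedSource f y t τ| ≤ g τ := by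
  obtain ⟨g, hgi, hgb, hgf⟩ := hg.source_bound t ht (1 / (32 * t)) (by positivity)
  obtain ⟨M, hM⟩ := hgb (t / 2) (by positivity)
  refine ⟨_, hgi.const_mul _, ⟨_, fun τ hτ => mul_le_mul_of_nonneg_left
    (hM (mem_image_of_mem g hτ)) ?_⟩, fun τ hτ => abs_heatFlow_le (by positivity)
      (fun η => hgf η τ hτ.1 hτ.2.le) (sub_pos.2 hτ.2) (sixteen_mul_sub_le_one hτ.1 hτ.2) y⟩
  positivity

end IsSubGaussian

lemma IsHeatSolution.intervalIntegrable_erf_mul (hu : IsHeatSolution f h u)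
    (hg : IsSubGaussian f u) (x : ℝ) (y : Tangent m) (ht : 0 < t) :
    IntervalIntegrable (fun τ => erf (x / (2 * √(t - τ))) * smoothedSource f y t τ)
      volume 0 t := by
  obtain ⟨g, hgi, -, hgb⟩ := hg.exists_abs_smoothedSource_le y ht
  obtain ⟨C, hC⟩ := exists_abs_erf_le
  rw [intervalIntegrable_iff_integrableOn_Ioc_of_le ht.le]
  have hsource : IntegrableOn (smoothedSource f y t) (Ioc 0 t) := by
    refine hgi.mono' (hu.aestronglyMeasurable_smoothedSource y t) ?_
    rw [← restrict_Ioo_eq_restrict_Ioc]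
    exact (ae_restrict_mem measurableSet_Ioo).mono hgb
  exact hsource.bdd_mul (continuous_erf.measurable.comp (by fun_prop)).aestronglyMeasurable
    (ae_of_all _ fun τ => hC _)

end SmoothedSource

section InitialTime

variable {m : ℕ} {h : ℝ → Tangent m → ℝ} {f : Tangent m → ℝ → ℝ} {u : ℝ → Tangent m → ℝ → ℝ}
  {t τ : ℝ}

lemma continuous_green (P : ℝ × Tangent m) (hτ : τ < t) :
    Continuous fun p : ℝ × Tangent m => green P.1 P.2 t p.1 p.2 τ :=
  continuousOn_univ.1 ((isParabolicRegular_green P t).continuousOn_slice hτ)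

lemma IsSubGaussian.exists_abs_le (hg : IsSubGaussian f u) (ht : 0 < t) :
    ∃ B, ∀ p ∈ halfSpace m, ∀ τ ∈ Ioc 0 t, |u p.1 p.2 τ| ≤ B * gaussian (-(1 / (32 * t))) p := by
  obtain ⟨B, hB⟩ := hg.exists_abs_shift_le ht
  refine ⟨B, fun p hp τ hτ => ?_⟩
  simpa only [add_zero] using
    hB p 0 (left_mem_Icc.2 zero_le_one) ((add_zero p.1).symm ▸ hp.1) τ hτ

namespace IsHeatSolution

lemma aestronglyMeasurable_slice (hu : IsHeatSolution f h u) (hτ : 0 < τ) :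
    AEStronglyMeasurable (fun p : ℝ × Tangent m => u p.1 p.2 τ) (volume.restrict (halfSpace m)) :=
  (hu.isParabolicRegular.continuousOn_slice hτ).aestronglyMeasurable (measurableSet_halfSpace m)

lemma aestronglyMeasurable_initial (hu : IsHeatSolution f h u) :
    AEStronglyMeasurable (fun p : ℝ × Tangent m => h p.1 p.2) (volume.restrict (halfSpace m)) := by
  refine aestronglyMeasurable_of_tendsto_ae (atTop : Filter ℕ)
    (f := fun n p => u p.1 p.2 (1 / ((n : ℝ) + 1)))
    (fun n => hu.aestronglyMeasurable_slice Nat.one_div_pos_of_nat) ?_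
  filter_upwards [ae_restrict_mem (measurableSet_halfSpace m)] with p hp
  exact (hu.initial_tendsto p.1 p.2 hp.1).comp (tendsto_nhdsWithin_iff.2
    ⟨tendsto_one_div_add_atTop_nhds_zero_nat,
      .of_forall fun n => mem_Ioi.2 Nat.one_div_pos_of_nat⟩)

lemma exists_abs_initial_le (hu : IsHeatSolution f h u) (hg : IsSubGaussian f u) (ht : 0 < t) :
    ∃ B, ∀ p ∈ halfSpace m, |h p.1 p.2| ≤ B * gaussian (-(1 / (32 * t))) p := by
  obtain ⟨B, hB⟩ := hg.exists_abs_le ht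
  refine ⟨B, fun p hp => le_of_tendsto (hu.initial_tendsto p.1 p.2 hp.1).abs ?_⟩
  filter_upwards [Ioc_mem_nhdsGT ht] with τ hτ using hB p hp τ hτ

lemma integrableOn_mul_initial (hu : IsHeatSolution f h u) (hg : IsSubGaussian f u) (ht : 0 < t)
    {k : ℝ × Tangent m → ℝ} {C : ℝ} (hk : Continuous k)
    (hC : ∀ p, |k p| ≤ C * gaussian (1 / (16 * t)) p) :
    IntegrableOn (fun p => k p * h p.1 p.2) (halfSpace m) := by
  obtain ⟨B, hB⟩ := hu.exists_abs_initial_le hg ht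
  have hκ : 0 < 1 / (32 * t) := by positivity
  refine ((integrable_gaussian hκ).const_mul (C * B)).integrableOn.mono'
    (hk.aestronglyMeasurable.mul hu.aestronglyMeasurable_initial) ?_
  filter_upwards [ae_restrict_mem (measurableSet_halfSpace m)] with p hp
  exact abs_mul_le_gaussian (by ring) (hC p) (hB p hp)

lemma integrableOn_green_mul_initial (hu : IsHeatSolution f h u) (hg : IsSubGaussian f u)
    (P : ℝ × Tangent m) (ht : 0 < t) :
    IntegrableOn (fun p : ℝ × Tangent m => green P.1 P.2 t p.1 p.2 0 * h p.1 p.2)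
      (halfSpace m) := by
  obtain ⟨C, hC⟩ := exists_abs_green_le P le_rfl ht
  exact hu.integrableOn_mul_initial hg ht (continuous_green P ht)
    fun p => (hC p 0 (left_mem_Icc.2 le_rfl)).1

lemma tendsto_integral_green_zero (hu : IsHeatSolution f h u) (hg : IsSubGaussian f u)
    (P : ℝ × Tangent m) (ht : 0 < t) :
    Tendsto (fun s => ∫ p in halfSpace m, green P.1 P.2 t p.1 p.2 s * u p.1 p.2 s) (𝓝[>] 0)
      (𝓝 (initialPart h P.1 P.2 t)) := by
  have hhalf : 0 < t / 2 := half_pos ht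
  obtain ⟨C, hC⟩ := exists_abs_green_le P hhalf.le (half_lt_self ht)
  obtain ⟨B, hB⟩ := hg.exists_abs_le ht
  have hκ : 0 < 1 / (32 * t) := by positivity
  have hsmall : ∀ᶠ s in 𝓝[>] 0, s ∈ Ioc 0 (t / 2) := Ioc_mem_nhdsGT hhalf
  refine tendsto_integral_filter_of_dominated_convergence (fun p => C * B * gaussian _ p) ?_ ?_
    ((integrable_gaussian hκ).const_mul (C * B)).integrableOn ?_
  · filter_upwards [hsmall] with s hs
    exact (continuous_green P (hs.2.trans_lt (half_lt_self ht))).aestronglyMeasurable.mul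
      (hu.aestronglyMeasurable_slice hs.1)
  · filter_upwards [hsmall] with s hs
    filter_upwards [ae_restrict_mem (measurableSet_halfSpace m)] with p hp
    exact abs_mul_le_gaussian (by ring) (hC p s (Ioc_subset_Icc_self hs)).1
      (hB p hp s ⟨hs.1, hs.2.trans (half_le_self ht.le)⟩)
  · filter_upwards [ae_restrict_mem (measurableSet_halfSpace m)] with p hp
    have hgreen := (isParabolicRegular_green P t).differentiableAt p (mem_univ p) 0 ht
    exact (hgreen.continuousAt.tendsto.mono_left nhdsWithin_le_nhds).mul
      (hu.initial_tendsto p.1 p.2 hp.1)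

end IsHeatSolution

end InitialTime

section FinalTime

variable {m : ℕ} {h : ℝ → Tangent m → ℝ} {f : Tangent m → ℝ → ℝ} {u : ℝ → Tangent m → ℝ → ℝ}
  {t σ : ℝ}

/-- The solution at time `t - σ`, extended by zero across the boundary. It lives on Euclidean space,
so that the heat flow acts on it. -/
def backwardExtension (u : ℝ → Tangent m → ℝ → ℝ) (t : ℝ) (z : WithLp 2 (ℝ × Tangent m)) (σ : ℝ) :
    ℝ := (halfSpace m).indicator (fun p => u p.1 p.2 (t - σ)) z.ofLp

lemma green_eq_heatKernel_sub (P : ℝ × Tangent m) (t : ℝ) (p : ℝ × Tangent m) (τ : ℝ) :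
    green P.1 P.2 t p.1 p.2 τ = heatKernel (WithLp.toLp 2 P - WithLp.toLp 2 p) (t - τ) -
      heatKernel (WithLp.toLp 2 (-P.1, P.2) - WithLp.toLp 2 p) (t - τ) := by
  simp only [← WithLp.toLp_sub]
  change _ = spaceKernel _ _ - spaceKernel _ _
  rw [green_eq_mul_greenLine, greenLine_eq_heatKernel_sub, spaceKernel_eq_mul, spaceKernel_eq_mul,
    ← heatKernel_neg (P.1 + p.1), neg_add']
  simp only [Prod.fst_sub, Prod.snd_sub]
  ring

lemma IsHeatSolution.measurable_backwardExtension (hu : IsHeatSolution f h u) (hσ : σ < t) :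
    Measurable fun z => backwardExtension u t z σ := by
  classical
  have hpiecewise := (hu.isParabolicRegular.continuousOn_slice (sub_pos.2 hσ)).measurable_piecewise
    (g := fun _ => (0 : ℝ)) continuousOn_const (measurableSet_halfSpace m)
  rw [show (fun _ => (0 : ℝ)) = 0 from rfl, piecewise_eq_indicator] at hpiecewise
  exact hpiecewise.comp (WithLp.measurable_ofLp ..)

lemma IsSubGaussian.exists_abs_backwardExtension_le (hg : IsSubGaussian f u) (ht : 0 < t) :
    ∃ B, ∀ σ ∈ Ico 0 t, ∀ z, |backwardExtension u t z σ| ≤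
      B * Real.exp (1 / (32 * t) * ‖z‖ ^ 2) := by
  obtain ⟨B, hB⟩ := hg.exists_abs_le ht
  refine ⟨max B 0, fun σ hσ z => ?_⟩
  by_cases hz : z.ofLp ∈ halfSpace m
  · rw [backwardExtension, indicator_of_mem hz, WithLp.prod_norm_sq_eq_of_L2]
    refine (hB _ hz (t - σ) ⟨sub_pos.2 hσ.2, sub_le_self t hσ.1⟩).trans ?_
    rw [gaussian, neg_neg, Real.norm_eq_abs, sq_abs]
    exact mul_le_mul_of_nonneg_right (le_max_left B 0) (Real.exp_pos _).le
  · rw [backwardExtension, indicator_of_notMem hz, abs_zero]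
    positivity

lemma IsHeatSolution.tendsto_backwardExtension (hu : IsHeatSolution f h u) {P : ℝ × Tangent m}
    (hP : P ∈ halfSpace m) (ht : 0 < t) :
    Tendsto (fun q : WithLp 2 (ℝ × Tangent m) × ℝ => backwardExtension u t q.1 q.2)
      (𝓝 (WithLp.toLp 2 P) ×ˢ 𝓝[>] 0) (𝓝 (u P.1 P.2 t)) := by
  have hcont : ContinuousAt (fun q : (ℝ × Tangent m) × ℝ => u q.1.1 q.1.2 q.2) (P, t - 0) :=
    hu.isParabolicRegular.continuousOn.continuousAt
      (((isOpen_halfSpace m).prod isOpen_Ioi).mem_nhds ⟨hP, by simpa using ht⟩)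
  have hmap : Tendsto (fun q : WithLp 2 (ℝ × Tangent m) × ℝ => (q.1.ofLp, t - q.2))
      (𝓝 (WithLp.toLp 2 P) ×ˢ 𝓝[>] 0) (𝓝 (P, t - 0)) := by
    have : Continuous fun q : WithLp 2 (ℝ × Tangent m) × ℝ => (q.1.ofLp, t - q.2) := by fun_prop
    refine (this.tendsto (WithLp.toLp 2 P, 0)).mono_left ?_
    rw [nhds_prod_eq]
    exact prod_mono le_rfl nhdsWithin_le_nhds
  have hlim := hcont.tendsto.comp hmap
  simp only [sub_zero] at hlim hmap
  refine hlim.congr' ?_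
  filter_upwards [hmap.fst_nhds ((isOpen_halfSpace m).mem_nhds hP)] with q hq
  exact (indicator_of_mem hq _).symm

lemma tendsto_backwardExtension_of_neg {P : ℝ × Tangent m} (hP : P.1 < 0) :
    Tendsto (fun q : WithLp 2 (ℝ × Tangent m) × ℝ => backwardExtension u t q.1 q.2)
      (𝓝 (WithLp.toLp 2 P) ×ˢ 𝓝[>] 0) (𝓝 0) := by
  have hneg : ∀ᶠ z : WithLp 2 (ℝ × Tangent m) in 𝓝 (WithLp.toLp 2 P), z.ofLp.1 < 0 :=
    ContinuousAt.eventually_lt (by fun_prop) continuousAt_const hP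
  refine tendsto_const_nhds.congr' ?_
  filter_upwards [tendsto_fst.eventually hneg] with q hq
  exact (indicator_of_notMem (fun hmem => lt_asymm hq hmem.1) _).symm

lemma IsHeatSolution.integral_green_eq_heatFlow_sub (hu : IsHeatSolution f h u)
    (hg : IsSubGaussian f u) (P : ℝ × Tangent m) (hσ : 0 < σ) (hσt : σ < t) :
    ∫ p in halfSpace m, green P.1 P.2 t p.1 p.2 (t - σ) * u p.1 p.2 (t - σ) =
      heatFlow (fun z => backwardExtension u t z σ) (WithLp.toLp 2 P) σ -
        heatFlow (fun z => backwardExtension u t z σ) (WithLp.toLp 2 (-P.1, P.2)) σ := by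
  have ht : 0 < t := hσ.trans hσt
  obtain ⟨B, hB⟩ := hg.exists_abs_backwardExtension_le ht
  have hint := integrable_heatKernel_mul
    (hu.measurable_backwardExtension hσt).aestronglyMeasurable (by positivity)
    (hB σ ⟨hσ.le, hσt⟩) hσ
    (by simpa using sixteen_mul_sub_le_one (sub_pos.2 hσt) (sub_lt_self t hσ))
  rw [heatFlow, heatFlow, ← integral_sub (hint _) (hint _),
    ← integral_indicator (measurableSet_halfSpace m),
    ← (WithLp.volume_preserving_toLp ℝ (Tangent m)).integral_comp
      (MeasurableEquiv.toLp 2 (ℝ × Tangent m)).measurableEmbedding]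
  refine integral_congr_ae (ae_of_all _ fun p => ?_)
  simp only [backwardExtension]
  rw [indicator_mul_right, green_eq_heatKernel_sub, sub_sub_cancel, sub_mul]

lemma IsHeatSolution.tendsto_integral_green_final (hu : IsHeatSolution f h u)
    (hg : IsSubGaussian f u) {P : ℝ × Tangent m} (hP : P ∈ halfSpace m) (ht : 0 < t) :
    Tendsto (fun r => ∫ p in halfSpace m, green P.1 P.2 t p.1 p.2 r * u p.1 p.2 r) (𝓝[<] t)
      (𝓝 (u P.1 P.2 t)) := by
  obtain ⟨B, hB⟩ := hg.exists_abs_backwardExtension_le ht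
  have hsmall : ∀ᶠ σ in 𝓝[>] (0 : ℝ), σ ∈ Ioo 0 t := Ioo_mem_nhdsGT ht
  have hflow {z : WithLp 2 (ℝ × Tangent m)} {c : ℝ} := tendsto_heatFlow (y := z) (c := c)
    (by positivity : 0 ≤ 1 / (32 * t))
    (hsmall.mono fun σ hσ => hu.measurable_backwardExtension hσ.2)
    (hsmall.mono fun σ hσ => hB σ ⟨hσ.1.le, hσ.2⟩)
  have hlim := (hflow (hu.tendsto_backwardExtension hP ht)).sub
    (hflow (tendsto_backwardExtension_of_neg (P := (-P.1, P.2)) (neg_lt_zero.2 hP.1)))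
  rw [sub_zero] at hlim
  have hcont : ContinuousWithinAt (fun r => t - r) (Iio t) t := by fun_prop
  have hback := hcont.tendsto_nhdsWithin (t := Ioi 0) fun r hr => sub_pos.2 hr
  rw [sub_self] at hback
  refine (hlim.comp hback).congr' ?_
  filter_upwards [Ioo_mem_nhdsLT ht] with r hr
  rw [Function.comp_apply, ← hu.integral_green_eq_heatFlow_sub hg P (sub_pos.2 hr.2)
    (sub_lt_self t hr.1), sub_sub_cancel]

end FinalTime

section Representation

lemma sub_eq_integral_of_tendsto {E : Type*} [NormedAddCommGroup E] [NormedSpace ℝ E]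
    {Φ Q : ℝ → E} {a b : ℝ} {Φa Φb : E} (hab : a < b) (hQ : IntervalIntegrable Q volume a b)
    (hΦ : ∀ s ∈ Ioo a b, ∀ r ∈ Ioo a b, s ≤ r → Φ r - Φ s = ∫ τ in s..r, Q τ)
    (ha : Tendsto Φ (𝓝[>] a) (𝓝 Φa)) (hb : Tendsto Φ (𝓝[<] b) (𝓝 Φb)) :
    Φb - Φa = ∫ τ in a..b, Q τ := by
  set primitive : ℝ → E := fun r => ∫ τ in a..r, Q τ
  have hcont : ContinuousOn primitive (Icc a b) := by
    have := intervalIntegral.continuousOn_primitive_interval' hQ left_mem_uIcc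
    rwa [uIcc_of_le hab.le] at this
  obtain ⟨e, he⟩ := nonempty_Ioo.2 hab
  have hsub {r : ℝ} (hr : r ∈ Ioo a b) : IntervalIntegrable Q volume a r :=
    hQ.mono_set (uIcc_subset_uIcc_left (Icc_subset_uIcc (Ioo_subset_Icc_self hr)))
  have hincr {s r : ℝ} (hs : s ∈ Ioo a b) (hr : r ∈ Ioo a b) (hsr : s ≤ r) :
      Φ r - primitive r = Φ s - primitive s := by
    rw [sub_eq_sub_iff_sub_eq_sub, hΦ s hs r hr hsr]
    exact (intervalIntegral.integral_interval_sub_left (hsub hr) (hsub hs)).symm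
  have hconst : ∀ r ∈ Ioo a b, Φ r - primitive r = Φ e - primitive e := fun r hr =>
    (le_total e r).elim (hincr he hr) fun hre => (hincr hr he hre).symm
  have hleft : Φa - primitive a = Φ e - primitive e :=
    tendsto_nhds_unique (ha.sub ((hcont a (left_mem_Icc.2 hab.le)).tendsto.mono_left
      (nhdsWithin_le_of_mem (Icc_mem_nhdsGT hab)))) (tendsto_const_nhds.congr' <|
      mem_of_superset (Ioo_mem_nhdsGT hab) fun r hr => (hconst r hr).symm)
  have hright : Φb - primitive b = Φ e - primitive e :=
    tendsto_nhds_unique (hb.sub ((hcont b (right_mem_Icc.2 hab.le)).tendsto.mono_left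
      (nhdsWithin_le_of_mem (Icc_mem_nhdsLT hab)))) (tendsto_const_nhds.congr' <|
      mem_of_superset (Ioo_mem_nhdsLT hab) fun r hr => (hconst r hr).symm)
  rw [sub_eq_sub_iff_sub_eq_sub.1 (hright.trans hleft.symm)]
  simp only [primitive, intervalIntegral.integral_same, sub_zero]

variable {m : ℕ} {h : ℝ → Tangent m → ℝ} {f : Tangent m → ℝ → ℝ}
  {u : ℝ → Tangent m → ℝ → ℝ} {t : ℝ}

lemma green_zero_left (y : Tangent m) (t ξ : ℝ) (η : Tangent m) (τ : ℝ) :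
    green 0 y t ξ η τ = 0 := by simp [green, greenLine]

lemma IsHeatSolution.eq_initialPart_sub_of_mem (hu : IsHeatSolution f h u) (hg : IsSubGaussian f u)
    {P : ℝ × Tangent m} (hP : P ∈ halfSpace m) (ht : 0 < t) :
    u P.1 P.2 t = initialPart h P.1 P.2 t -
      ∫ τ in (0 : ℝ)..t, erf (P.1 / (2 * √(t - τ))) * smoothedSource f P.2 t τ := by
  have hslab : ∀ s ∈ Ioo 0 t, ∀ r ∈ Ioo 0 t, s ≤ r →
      (∫ p in halfSpace m, green P.1 P.2 t p.1 p.2 r * u p.1 p.2 r) -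
        (∫ p in halfSpace m, green P.1 P.2 t p.1 p.2 s * u p.1 p.2 s) =
      ∫ τ in s..r, -(erf (P.1 / (2 * √(t - τ))) * smoothedSource f P.2 t τ) :=
    fun s hs r hr hsr => by
      rw [hu.integral_green_mul_sub hg P hs.1 hsr hr.2,
        hu.integral_green_mul_source hg P hs.1 hsr hr.2, intervalIntegral.integral_neg]
  have hincrement := sub_eq_integral_of_tendsto ht (hu.intervalIntegrable_erf_mul hg P.1 P.2 ht).neg
    hslab (hu.tendsto_integral_green_zero hg P ht) (hu.tendsto_integral_green_final hg hP ht)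
  rw [Pi.neg_def, intervalIntegral.integral_neg] at hincrement
  linarith

theorem IsHeatSolution.eq_initialPart_sub (hu : IsHeatSolution f h u) (hg : IsSubGaussian f u)
    {x : ℝ} (hx : 0 ≤ x) (y : Tangent m) (ht : 0 < t) :
    u x y t = initialPart h x y t -
      ∫ τ in (0 : ℝ)..t, erf (x / (2 * √(t - τ))) * smoothedSource f y t τ := by
  rcases hx.eq_or_lt with rfl | hx
  · simp [hu.boundary y t ht, initialPart, green_zero_left, erf_zero]
  · exact hu.eq_initialPart_sub_of_mem hg (P := (x, y)) ⟨hx, mem_univ y⟩ ht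

end Representation

section Flux

lemma hasDerivAt_heatKernel_real (z σ : ℝ) :
    HasDerivAt (fun z : ℝ => heatKernel z σ) (-(heatKernel z σ / (2 * σ)) * z) z := by
  have hdiff : DifferentiableAt ℝ (fun z : ℝ => heatKernel z σ) z :=
    (hasFDerivAt_heatKernel z σ).differentiableAt
  exact hdiff.hasFDerivAt.hasDerivAt.congr_deriv (by rw [fderiv_heatKernel]; simp)

lemma exists_one_add_norm_mul_heatKernel_sub_le (E : Type*) [NormedAddCommGroup E]
    [InnerProductSpace ℝ E] {t : ℝ} (ht : 0 < t) (R : ℝ) :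
    ∃ C, ∀ x ξ : E, ‖x‖ ≤ R →
      (1 + ‖x - ξ‖) * heatKernel (x - ξ) t ≤ C * Real.exp (-(1 / (16 * t)) * ‖ξ‖ ^ 2) := by
  have := two_mul_sqrt_pi_mul_pos ht
  refine ⟨Real.exp (2 * t) / (2 * √(Real.pi * t)) ^ Module.finrank ℝ E *
    Real.exp (1 / (8 * t) * R ^ 2), fun x ξ hx => ?_⟩
  refine (one_add_norm_mul_heatKernel_le ht le_rfl le_rfl (x - ξ)).trans ?_
  rw [mul_assoc, ← Real.exp_add]
  gcongr
  have hhalf := norm_sq_half_sub_le x (-ξ)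
  rw [norm_neg, ← sub_eq_add_neg] at hhalf
  calc -(1 / (8 * t)) * ‖x - ξ‖ ^ 2 = -(1 / (8 * t) * ‖x - ξ‖ ^ 2) := neg_mul _ _
    _ ≤ -(1 / (8 * t) * (‖ξ‖ ^ 2 / 2 - R ^ 2)) := by
        have : ‖x‖ ^ 2 ≤ R ^ 2 := by gcongr
        gcongr
        linarith
    _ = _ := by ring

variable {m : ℕ} {h : ℝ → Tangent m → ℝ} {f : Tangent m → ℝ → ℝ}
  {u : ℝ → Tangent m → ℝ → ℝ} {t : ℝ}

lemma hasDerivAt_green (x : ℝ) (y : Tangent m) (t ξ : ℝ) (η : Tangent m) (τ : ℝ) :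
    HasDerivAt (fun x => green x y t ξ η τ) (heatKernel (y - η) (t - τ) *
      (-(heatKernel (x - ξ) (t - τ) / (2 * (t - τ))) * (x - ξ) -
        -(heatKernel (x + ξ) (t - τ) / (2 * (t - τ))) * (x + ξ))) x := by
  simp only [green_eq_mul_greenLine, greenLine_eq_heatKernel_sub]
  exact (((hasDerivAt_heatKernel_real _ _).comp_sub_const x ξ).sub
    ((hasDerivAt_heatKernel_real _ _).comp_add_const x ξ)).const_mul _

lemma hasDerivAt_greenX (x : ℝ) (y : Tangent m) (t ξ : ℝ) (η : Tangent m) (τ : ℝ) :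
    HasDerivAt (fun x => green x y t ξ η τ) (greenX x y t ξ η τ) x :=
  (hasDerivAt_green x y t ξ η τ).differentiableAt.hasDerivAt

lemma continuous_greenX (x : ℝ) (y : Tangent m) (t τ : ℝ) :
    Continuous fun p : ℝ × Tangent m => greenX x y t p.1 p.2 τ := by
  have hK (E : Type) [NormedAddCommGroup E] [InnerProductSpace ℝ E] :
      Continuous fun z : E => heatKernel z (t - τ) := (contDiff_heatKernel _).continuous
  have := hK ℝ
  have := hK (Tangent m)
  simp only [greenX, (hasDerivAt_green _ _ _ _ _ _).deriv]
  fun_prop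

lemma exists_abs_greenX_le (y : Tangent m) (ht : 0 < t) :
    ∃ C, ∀ x : ℝ, |x| ≤ 1 → ∀ p : ℝ × Tangent m,
      |greenX x y t p.1 p.2 0| ≤ C * gaussian (1 / (16 * t)) p := by
  obtain ⟨C₁, hC₁⟩ := exists_one_add_norm_mul_heatKernel_sub_le ℝ ht 1
  obtain ⟨C₂, hC₂⟩ := exists_one_add_norm_mul_heatKernel_sub_le (Tangent m) ht ‖y‖
  refine ⟨C₂ * (C₁ / t), fun x hx p => ?_⟩
  have hnormal (ξ : ℝ) : |-(heatKernel (x - ξ) t / (2 * t)) * (x - ξ)| ≤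
      C₁ / (2 * t) * Real.exp (-(1 / (16 * t)) * ξ ^ 2) := by
    have hK := heatKernel_nonneg (x - ξ) t
    have hle := hC₁ x ξ hx
    rw [Real.norm_eq_abs, Real.norm_eq_abs, sq_abs] at hle
    rw [neg_mul, abs_neg, abs_mul, abs_of_nonneg (by positivity), div_mul_eq_mul_div,
      div_mul_eq_mul_div]
    refine div_le_div_of_nonneg_right ?_ (by positivity)
    linarith
  have hmirror := hnormal (-p.1)
  rw [sub_neg_eq_add, neg_sq] at hmirror
  have htangential : |heatKernel (y - p.2) t| ≤ C₂ * Real.exp (-(1 / (16 * t)) * ‖p.2‖ ^ 2) := by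
    have hK := heatKernel_nonneg (y - p.2) t
    rw [abs_of_nonneg hK]
    refine (le_mul_of_one_le_left hK ?_).trans (hC₂ y p.2 le_rfl)
    linarith [norm_nonneg (y - p.2)]
  simp only [greenX, (hasDerivAt_green _ _ _ _ _ _).deriv, sub_zero]
  rw [abs_mul]
  calc _ ≤ C₂ * Real.exp (-(1 / (16 * t)) * ‖p.2‖ ^ 2) *
        (C₁ / (2 * t) * Real.exp (-(1 / (16 * t)) * p.1 ^ 2) +
          C₁ / (2 * t) * Real.exp (-(1 / (16 * t)) * p.1 ^ 2)) :=
        mul_le_mul htangential ((abs_sub _ _).trans (add_le_add (hnormal p.1) hmirror))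
          (abs_nonneg _) ((abs_nonneg _).trans htangential)
    _ = C₂ * (C₁ / t) * gaussian (1 / (16 * t)) p := by
        rw [gaussian, mul_add (-(1 / (16 * t))), Real.exp_add]
        ring

namespace IsHeatSolution

lemma integrableOn_greenX_mul_initial (hu : IsHeatSolution f h u) (hg : IsSubGaussian f u)
    (y : Tangent m) (ht : 0 < t) :
    IntegrableOn (fun p : ℝ × Tangent m => greenX 0 y t p.1 p.2 0 * h p.1 p.2) (halfSpace m) := by
  obtain ⟨C, hC⟩ := exists_abs_greenX_le y ht
  exact hu.integrableOn_mul_initial hg ht (continuous_greenX 0 y t 0) (hC 0 (by simp))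

lemma hasDerivAt_initialPart (hu : IsHeatSolution f h u) (hg : IsSubGaussian f u)
    (y : Tangent m) (ht : 0 < t) :
    HasDerivAt (fun x => initialPart h x y t) (initialFlux h y t) 0 := by
  obtain ⟨C, hC⟩ := exists_abs_greenX_le y ht
  obtain ⟨B, hB⟩ := hu.exists_abs_initial_le hg ht
  have hκ : 0 < 1 / (32 * t) := by positivity
  refine (hasDerivAt_integral_of_dominated_loc_of_deriv_le
    (F' := fun x p => greenX x y t p.1 p.2 0 * h p.1 p.2)
    (bound := fun p => C * B * gaussian (1 / (32 * t)) p) (Metric.ball_mem_nhds 0 one_pos)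
    (.of_forall fun x => (hu.integrableOn_green_mul_initial hg (x, y) ht).1)
    (hu.integrableOn_green_mul_initial hg (0, y) ht)
    (hu.integrableOn_greenX_mul_initial hg y ht).1 ?_
    ((integrable_gaussian hκ).const_mul _).integrableOn
    (ae_of_all _ fun p x _ => (hasDerivAt_greenX ..).mul_const _)).2
  filter_upwards [ae_restrict_mem (measurableSet_halfSpace m)] with p hp x hx
  exact abs_mul_le_gaussian (by ring) (hC x (mem_ball_zero_iff.1 hx).le p) (hB p hp)

end IsHeatSolution

lemma heatKernel_le_heatKernel_zero {E : Type*} [NormedAddCommGroup E] [InnerProductSpace ℝ E]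
    (z : E) {σ : ℝ} (hσ : 0 ≤ σ) : heatKernel z σ ≤ heatKernel (0 : E) σ := by
  simp only [heatKernel, norm_zero]
  gcongr
  simp

lemma heatKernel_zero_real (σ : ℝ) : heatKernel (0 : ℝ) σ = 1 / (2 * √(Real.pi * σ)) := by
  simp [heatKernel_real]

lemma integrableOn_heatKernel_zero (ht : 0 < t) :
    IntegrableOn (fun τ => heatKernel (0 : ℝ) (t - τ)) (Ioc 0 t) := by
  rw [← intervalIntegrable_iff_integrableOn_Ioc_of_le ht.le]
  have hrpow : IntervalIntegrable (fun σ : ℝ => 1 / (2 * √Real.pi) * σ ^ (-(1 / 2) : ℝ))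
      volume t 0 := (intervalIntegral.intervalIntegrable_rpow' (by norm_num)).const_mul _
  have hreflect := hrpow.comp_sub_left t
  simp only [sub_self, sub_zero] at hreflect
  refine hreflect.congr fun τ hτ => ?_
  rw [uIoc_of_le ht.le] at hτ
  have hσ : 0 ≤ t - τ := sub_nonneg.2 hτ.2
  simp only [heatKernel_zero_real]
  rw [Real.rpow_neg hσ, ← Real.sqrt_eq_rpow, Real.sqrt_mul Real.pi_pos.le]
  ring

namespace IsHeatSolution

lemma integrableOn_heatKernel_zero_mul (hu : IsHeatSolution f h u) (hg : IsSubGaussian f u)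
    (y : Tangent m) (ht : 0 < t) :
    IntegrableOn (fun τ => heatKernel (0 : ℝ) (t - τ) * smoothedSource f y t τ) (Ioc 0 t) := by
  obtain ⟨g, hgi, ⟨M, hM⟩, hgb⟩ := hg.exists_abs_smoothedSource_le y ht
  have hK := integrableOn_heatKernel_zero ht
  refine ((hgi.const_mul (heatKernel (0 : ℝ) (t / 2))).add (hK.const_mul (max M 0))).mono'
    (hK.1.mul (hu.aestronglyMeasurable_smoothedSource y t)) ?_
  rw [← restrict_Ioo_eq_restrict_Ioc]
  filter_upwards [ae_restrict_mem measurableSet_Ioo] with τ hτ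
  have hbound := hgb τ hτ
  have hKτ := heatKernel_nonneg (0 : ℝ) (t - τ)
  have hK2 := heatKernel_nonneg (0 : ℝ) (t / 2)
  rw [Real.norm_eq_abs, abs_mul, abs_of_nonneg hKτ]
  simp only [Pi.add_apply]
  rcases le_or_gt τ (t / 2) with hle | hlt
  · have hmono : heatKernel (0 : ℝ) (t - τ) ≤ heatKernel (0 : ℝ) (t / 2) := by
      have := two_mul_sqrt_pi_mul_pos (half_pos ht)
      simp only [heatKernel_zero_real]
      gcongr
      linarith
    exact le_add_of_le_of_nonneg (mul_le_mul hmono hbound (abs_nonneg _) hK2)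
      (mul_nonneg (le_max_right M 0) hKτ)
  · refine le_add_of_nonneg_of_le (mul_nonneg hK2 ((abs_nonneg _).trans hbound)) ?_
    rw [mul_comm]
    exact mul_le_mul_of_nonneg_right
      ((hbound.trans (hM τ ⟨hlt.le, hτ.2.le⟩)).trans (le_max_left M 0)) hKτ

lemma intervalIntegrable_heatKernel_zero_mul (hu : IsHeatSolution f h u) (hg : IsSubGaussian f u)
    (y : Tangent m) (ht : 0 < t) :
    IntervalIntegrable (fun τ => heatKernel (0 : ℝ) (t - τ) * smoothedSource f y t τ)
      volume 0 t :=
  (intervalIntegrable_iff_integrableOn_Ioc_of_le ht.le).2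
    (hu.integrableOn_heatKernel_zero_mul hg y ht)

lemma hasDerivAt_integral_erf_mul (hu : IsHeatSolution f h u) (hg : IsSubGaussian f u)
    (y : Tangent m) (ht : 0 < t) :
    HasDerivAt (fun x => ∫ τ in (0 : ℝ)..t, erf (x / (2 * √(t - τ))) * smoothedSource f y t τ)
      (2 * ∫ τ in (0 : ℝ)..t, heatKernel (0 : ℝ) (t - τ) * smoothedSource f y t τ) 0 := by
  have hflux := hu.intervalIntegrable_heatKernel_zero_mul hg y ht
  have hpos : ∀ᵐ τ : ℝ, τ ∈ uIoc 0 t → 0 < t - τ := by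
    filter_upwards [Measure.ae_ne volume t] with τ hne hτ
    rw [uIoc_of_le ht.le] at hτ
    exact sub_pos.2 (lt_of_le_of_ne hτ.2 hne)
  rw [← intervalIntegral.integral_const_mul]
  simp only [← mul_assoc]
  refine (intervalIntegral.hasDerivAt_integral_of_dominated_loc_of_deriv_le
    (F' := fun x τ => 2 * heatKernel x (t - τ) * smoothedSource f y t τ)
    (bound := fun τ => 2 * ‖heatKernel (0 : ℝ) (t - τ) * smoothedSource f y t τ‖)
    univ_mem (.of_forall fun x => (hu.intervalIntegrable_erf_mul hg x y ht).def'.1)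
    (hu.intervalIntegrable_erf_mul hg 0 y ht) ?_ ?_ (hflux.norm.const_mul 2) ?_).2
  · simpa only [mul_assoc] using (hflux.const_mul 2).def'.1
  · filter_upwards [hpos] with τ hpos hτ x _
    rw [mul_assoc, norm_mul, norm_mul, norm_mul, Real.norm_two,
      Real.norm_of_nonneg (heatKernel_nonneg x _), Real.norm_of_nonneg (heatKernel_nonneg _ _)]
    gcongr
    exact heatKernel_le_heatKernel_zero x (hpos hτ).le
  · filter_upwards [hpos] with τ hpos hτ x _
    exact (hasDerivAt_erf_div (hpos hτ) x).mul_const _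

theorem hasDerivWithinAt_boundary (hu : IsHeatSolution f h u) (hg : IsSubGaussian f u)
    (y : Tangent m) (ht : 0 < t) :
    HasDerivWithinAt (fun x => u x y t) (initialFlux h y t -
      2 * ∫ τ in (0 : ℝ)..t, heatKernel (0 : ℝ) (t - τ) * smoothedSource f y t τ) (Ici 0) 0 :=
  ((hu.hasDerivAt_initialPart hg y ht).sub
    (hu.hasDerivAt_integral_erf_mul hg y ht)).hasDerivWithinAt.congr
    (fun _ hx => hu.eq_initialPart_sub hg hx y ht) (hu.eq_initialPart_sub hg le_rfl y ht)

end IsHeatSolution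

end Flux

end HalfSpaceHeat

end

open HalfSpaceHeat in
theorem theorem2p1_general {m : ℕ} {f : Tangent m → ℝ → ℝ} {h : ℝ → Tangent m → ℝ}
    {u : ℝ → Tangent m → ℝ → ℝ} (hu : IsHeatSolution f h u) (hgrowth : IsSubGaussian f u) :
    (∀ (y : Tangent m) (t τ : ℝ), 0 < τ → τ < t →
      Integrable fun η : Tangent m => Real.exp (-‖y - η‖ ^ 2 / (4 * (t - τ))) * f η τ) ∧
    (∀ (x : ℝ) (y : Tangent m) (t : ℝ), 0 ≤ x → 0 < t →
      IntegrableOn (fun p : ℝ × Tangent m => green x y t p.1 p.2 0 * h p.1 p.2) (halfSpace m) ∧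
      IntervalIntegrable (fun τ => erf (x / (2 * √(t - τ))) / (2 * √(Real.pi * (t - τ))) ^ m *
        ∫ η, Real.exp (-‖y - η‖ ^ 2 / (4 * (t - τ))) * f η τ) volume 0 t ∧
      u x y t = initialPart h x y t -
        ∫ τ in (0 : ℝ)..t, erf (x / (2 * √(t - τ))) / (2 * √(Real.pi * (t - τ))) ^ m *
          ∫ η, Real.exp (-‖y - η‖ ^ 2 / (4 * (t - τ))) * f η τ) ∧
    (∀ (y : Tangent m) (t : ℝ), 0 < t →
      IntegrableOn (fun p : ℝ × Tangent m => greenX 0 y t p.1 p.2 0 * h p.1 p.2) (halfSpace m) ∧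
      IntervalIntegrable (fun τ => 1 / (2 * √(Real.pi * (t - τ))) ^ (m + 1) *
        ∫ η, Real.exp (-‖y - η‖ ^ 2 / (4 * (t - τ))) * f η τ) volume 0 t ∧
      HasDerivWithinAt (fun x => u x y t) (initialFlux h y t -
        2 * ∫ τ in (0 : ℝ)..t, 1 / (2 * √(Real.pi * (t - τ))) ^ (m + 1) *
          ∫ η, Real.exp (-‖y - η‖ ^ 2 / (4 * (t - τ))) * f η τ) (Ici 0) 0) := by
  have herf (x : ℝ) (y : Tangent m) (t τ : ℝ) :
      erf (x / (2 * √(t - τ))) / (2 * √(Real.pi * (t - τ))) ^ m *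
        (∫ η, Real.exp (-‖y - η‖ ^ 2 / (4 * (t - τ))) * f η τ) =
      erf (x / (2 * √(t - τ))) * smoothedSource f y t τ := by
    rw [smoothedSource_eq, div_mul_eq_mul_div, mul_div_assoc]
  have hkernel (y : Tangent m) (t τ : ℝ) :
      1 / (2 * √(Real.pi * (t - τ))) ^ (m + 1) *
        (∫ η, Real.exp (-‖y - η‖ ^ 2 / (4 * (t - τ))) * f η τ) =
      heatKernel (0 : ℝ) (t - τ) * smoothedSource f y t τ := by
    rw [smoothedSource_eq, heatKernel_zero_real, pow_succ, one_div_mul_eq_div, one_div_mul_eq_div,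
      div_div]
  simp only [herf, hkernel]
  exact ⟨fun y t τ hτ hτt => hu.integrable_exp_mul_source hgrowth y hτ hτt,
    fun x y t hx ht => ⟨hu.integrableOn_green_mul_initial hgrowth (x, y) ht,
      hu.intervalIntegrable_erf_mul hgrowth x y ht, hu.eq_initialPart_sub hgrowth hx y ht⟩,
    fun y t ht => ⟨hu.integrableOn_greenX_mul_initial hgrowth y ht,
      hu.intervalIntegrable_heatKernel_zero_mul hgrowth y ht,
      hu.hasDerivWithinAt_boundary hgrowth y ht⟩⟩

/-- Every classical solution of sub-Gaussian growth is given by the integral representation, and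
its boundary flux solves the Volterra equation; all the integrals converge absolutely.
The space dimension is `n = m + 1`. -/
theorem theorem2p1 (m : ℕ) (F : ℝ → ℝ) (h : ℝ → HalfSpaceHeat.Tangent m → ℝ)
    (u : ℝ → HalfSpaceHeat.Tangent m → ℝ → ℝ)
    (hu : HalfSpaceHeat.IsClassicalSolution F h u)
    (hgrowth : HalfSpaceHeat.HasSubGaussianGrowth F u)
    (V : HalfSpaceHeat.Tangent m → ℝ → ℝ) (hV : V = HalfSpaceHeat.boundaryFlux u) :
    -- the spatial source integrals converge
    (∀ (y : HalfSpaceHeat.Tangent m) (t τ : ℝ), 0 < τ → τ < t →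
      MeasureTheory.Integrable (fun η : HalfSpaceHeat.Tangent m =>
        Real.exp (-‖y - η‖ ^ 2 / (4 * (t - τ))) * HalfSpaceHeat.source F V η τ)) ∧
    -- the integral representation of `u`
    (∀ (x : ℝ) (y : HalfSpaceHeat.Tangent m) (t : ℝ), 0 ≤ x → 0 < t →
      MeasureTheory.IntegrableOn (fun p : ℝ × HalfSpaceHeat.Tangent m =>
        HalfSpaceHeat.green x y t p.1 p.2 0 * h p.1 p.2) (HalfSpaceHeat.halfSpace m) ∧
      IntervalIntegrable (fun τ : ℝ =>
        HalfSpaceHeat.erf (x / (2 * √(t - τ))) / (2 * √(Real.pi * (t - τ))) ^ m *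
          HalfSpaceHeat.sourceIntegral F V y t τ) MeasureTheory.volume 0 t ∧
      u x y t = HalfSpaceHeat.initialPart h x y t -
        ∫ τ in (0 : ℝ)..t,
          HalfSpaceHeat.erf (x / (2 * √(t - τ))) / (2 * √(Real.pi * (t - τ))) ^ m *
            HalfSpaceHeat.sourceIntegral F V y t τ) ∧
    -- the Volterra integral equation for the boundary flux
    (∀ (y : HalfSpaceHeat.Tangent m) (t : ℝ), 0 < t →
      MeasureTheory.IntegrableOn (fun p : ℝ × HalfSpaceHeat.Tangent m =>
        HalfSpaceHeat.greenX 0 y t p.1 p.2 0 * h p.1 p.2) (HalfSpaceHeat.halfSpace m) ∧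
      IntervalIntegrable (fun τ : ℝ =>
        1 / (2 * √(Real.pi * (t - τ))) ^ (m + 1) *
          HalfSpaceHeat.sourceIntegral F V y t τ) MeasureTheory.volume 0 t ∧
      V y t = HalfSpaceHeat.initialFlux h y t -
        2 * ∫ τ in (0 : ℝ)..t,
          1 / (2 * √(Real.pi * (t - τ))) ^ (m + 1) *
            HalfSpaceHeat.sourceIntegral F V y t τ) := by
  subst hV
  obtain ⟨hsource, hrepr, hflux⟩ := theorem2p1_general hu.isHeatSolution hgrowth.isSubGaussian
  exact ⟨hsource, hrepr, fun y t ht => ⟨(hflux y t ht).1, (hflux y t ht).2.1,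
    (hflux y t ht).2.2.derivWithin (uniqueDiffOn_Ici 0 0 self_mem_Ici)⟩⟩
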